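/- Let $k\in\mathbb N$, $0\le m<k$ real, $m\notin\{1,2,\dots\}$, $0<\alpha<1<\beta<2$, $a,b>0$; put $\Omega=(0,1)\times(-a,b)$, $\Omega_+=\Omega\cap\{y>0\}$, $\Omega_-=\Omega\cap\{y<0\}$. The Caputo derivatives with origin $0$ are $$ {}_CD^{\alpha}_{0y}u(x,y)=\frac1{\Gamma(1-\alpha)}\int_0^y\frac{u_z(x,z)}{(y-z)^{\alpha}}\,dz\quad(y>0),\qquad {}_CD^{\beta}_{0y}u(x,y)=\frac1{\Gamma(2-\beta)}\int_y^0\frac{u_{zz}(x,z)}{(z-y)^{\beta-1}}\,dz\quad(y<0). $$ **Problem D** (with data $\varphi:[0,1]\to\mathbb R$). Find $u:\overline\Omega\to\mathbb R$ such that * $\partial_x^{j}u\in C(\overline\Omega)$ for $0\le j\le 2k-1$; $\partial_x^{2k}u(x,y)$ exists for $0<x<1$, $-a\le y\le b$ and is continuous on $\Omega$; and $x^{m/2}\partial_x^{2k}u(\cdot,y)\in L_2(0,1)$ for every $y\in[-a,b]$; * for every $x\in(0,1)$, $u(x,\cdot)$ is differentiable on $(0,b)$ and twice differentiable on $(-a,0)$,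 the integrals defining ${}_CD^{\alpha}_{0y}u$ on $\Omega_+$ and ${}_CD^{\beta}_{0y}u$ on $\Omega_-$ converge absolutely, and ${}_CD^{\alpha}_{0y}u\in C(\Omega_+)$, ${}_CD^{\beta}_{0y}u\in C(\Omega_-)$; * ${}_CD^{\alpha}_{0y}u+(-1)^kx^m\partial_x^{2k}u=0$ in $\Omega_+$ and ${}_CD^{\beta}_{0y}u+(-1)^kx^m\partial_x^{2k}u=0$ in $\Omega_-$; * $\partial_x^{j}u(0,y)=\partial_x^{j}u(1,y)=0$ for $j=0,\dots,k-1$, $-a\le y\le b$; * for $0\le x\le1$ the one-sided limits exist and $u(x,+0)=u(x,-0)$, ${}_CD^{\alpha}_{0y}u(x,+0)=u_y(x,-0)$; * $u(x,b)-u(x,-a)=\varphi(x)$ for $0\le x\le 1$. Let $\lambda_1,\lambda_2,\dots$ be the eigenvalues of the problem $X^{(2k)}(x)=(-1)^k\lambda x^{-m}X(x)$ on $(0,1)$, $X^{(j)}(0)=X^{(j)}(1)=0$ $(j=0,\dots,k-1)$, i.e. the real $\lambda$ for which it has a solution $X\not\equiv0$ in $C^{2k-1}[0,1]\cap C^{2k}(0,1)$.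 With $E_{\mu,\eta}(z)=\sum_{s\ge0}z^s/\Gamma(\mu s+\eta)$ put $$\Delta(n)=E_{\alpha,1}(-\lambda_nb^\alpha)-\bigl(E_{\beta,1}(-\lambda_na^\beta)+a\lambda_nE_{\beta,2}(-\lambda_na^\beta)\bigr).$$ **Theorem.** The solution of Problem D is unique if and only if $\Delta(n)\ne0$ for every $n$. That is: Problem D has at most one solution for every $\varphi$ if and only if $\Delta(n)\neq 0$ for all $n$; and, for each individual $\varphi$ for which Problem D has a solution, that solution is the only one if and only if $\Delta(n)\ne0$ for all $n$. -/

import Mathlib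

open Set Filter Topology MeasureTheory

noncomputable section

namespace ProblemD

/-- The two-parameter Mittag-Leffler function `E_{μ,η}(z) = ∑ zⁿ / Γ(μ n + η)`. -/
def mittagLeffler (μ η z : ℝ) : ℝ :=
  ∑' n : ℕ, z ^ n / Real.Gamma (μ * n + η)

/-- The integral in the Caputo derivative of order `α ∈ (0,1)` with origin `0` exists on `(0,b)`:
`f` is differentiable on `(0,b)` and the defining integral converges absolutely at every
`y ∈ (0,b)`. -/
def CaputoPosExists (α b : ℝ) (f : ℝ → ℝ) : Prop :=
  (∀ z ∈ Ioo 0 b, DifferentiableAt ℝ f z) ∧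
  ∀ y ∈ Ioo 0 b, IntervalIntegrable (fun z => deriv f z / (y - z) ^ α) volume 0 y

/-- Caputo derivative of order `α ∈ (0,1)` with origin `0`, at a point `y > 0`. -/
def caputoPos (α : ℝ) (f : ℝ → ℝ) (y : ℝ) : ℝ :=
  1 / Real.Gamma (1 - α) * ∫ z in (0 : ℝ)..y, deriv f z / (y - z) ^ α

/-- The integral in the Caputo derivative of order `β ∈ (1,2)` with origin `0` exists on
`(-a,0)`: `f` is twice differentiable on `(-a,0)` and the defining integral converges absolutely
at every `y ∈ (-a,0)`. -/
def CaputoNegExists (β a : ℝ) (f : ℝ → ℝ) : Prop :=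
  (∀ z ∈ Ioo (-a) 0, DifferentiableAt ℝ f z ∧ DifferentiableAt ℝ (deriv f) z) ∧
  ∀ y ∈ Ioo (-a) 0,
    IntervalIntegrable (fun z => deriv (deriv f) z / (z - y) ^ (β - 1)) volume y 0

/-- Caputo derivative of order `β ∈ (1,2)` with origin `0`, at a point `y < 0`: the integral
over `(y,0)` is taken with positive orientation, so that
`(-y)^β` has derivative `Γ(β + 1)`. -/
def caputoNeg (β : ℝ) (f : ℝ → ℝ) (y : ℝ) : ℝ :=
  1 / Real.Gamma (2 - β) * ∫ z in y..(0 : ℝ), deriv (deriv f) z / (z - y) ^ (β - 1)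

/-- The partial derivative `∂ʲu/∂xʲ` at `(x,y)`, one-sided at `x = 0` and `x = 1`. -/
def dx (j : ℕ) (u : ℝ → ℝ → ℝ) (x y : ℝ) : ℝ :=
  iteratedDerivWithin j (fun s => u s y) (Icc 0 1) x

/-- `u` is a solution of Problem D with data `φ` in the rectangle `[0,1] × [-a,b]`. -/
structure IsSolution (k : ℕ) (m α β a b : ℝ) (φ : ℝ → ℝ) (u : ℝ → ℝ → ℝ) : Prop where
  /-- The `x`-derivatives up to order `2k-1` exist on the closed rectangle. -/
  contDiff_x : ∀ y ∈ Icc (-a) b,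
    ContDiffOn ℝ ((2 * k - 1 : ℕ) : WithTop ℕ∞) (fun x => u x y) (Icc 0 1)
  /-- They are jointly continuous on the closed rectangle. -/
  continuous_dx : ∀ j ≤ 2 * k - 1,
    ContinuousOn (fun p : ℝ × ℝ => dx j u p.1 p.2) (Icc 0 1 ×ˢ Icc (-a) b)
  /-- The `x`-derivative of order `2k` exists for `0 < x < 1`. -/
  differentiable_dx : ∀ y ∈ Icc (-a) b,
    DifferentiableOn ℝ (fun x => dx (2 * k - 1) u x y) (Ioo 0 1)
  /-- It is jointly continuous on the open rectangle. -/
  continuous_dx_top :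
    ContinuousOn (fun p : ℝ × ℝ => dx (2 * k) u p.1 p.2) (Ioo 0 1 ×ˢ Ioo (-a) b)
  memLp_dx_top : ∀ y ∈ Icc (-a) b,
    MemLp (fun x => x ^ (m / 2) * dx (2 * k) u x y) 2 (volume.restrict (Ioo 0 1))
  caputoPos_exists : ∀ x ∈ Ioo (0 : ℝ) 1, CaputoPosExists α b (u x)
  caputoNeg_exists : ∀ x ∈ Ioo (0 : ℝ) 1, CaputoNegExists β a (u x)
  continuous_caputoPos :
    ContinuousOn (fun p : ℝ × ℝ => caputoPos α (u p.1) p.2) (Ioo 0 1 ×ˢ Ioo 0 b)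
  continuous_caputoNeg :
    ContinuousOn (fun p : ℝ × ℝ => caputoNeg β (u p.1) p.2) (Ioo 0 1 ×ˢ Ioo (-a) 0)
  /-- The equation for `y > 0`. -/
  eq_pos : ∀ x ∈ Ioo (0 : ℝ) 1, ∀ y ∈ Ioo 0 b,
    caputoPos α (u x) y + (-1) ^ k * x ^ m * dx (2 * k) u x y = 0
  /-- The equation for `y < 0`. -/
  eq_neg : ∀ x ∈ Ioo (0 : ℝ) 1, ∀ y ∈ Ioo (-a) 0,
    caputoNeg β (u x) y + (-1) ^ k * x ^ m * dx (2 * k) u x y = 0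
  boundary : ∀ j < k, ∀ y ∈ Icc (-a) b, dx j u 0 y = 0 ∧ dx j u 1 y = 0
  /-- `u(x,+0) = u(x,-0)`. -/
  gluing : ∀ x ∈ Icc (0 : ℝ) 1, ∃ l : ℝ,
    Tendsto (u x) (𝓝[>] 0) (𝓝 l) ∧ Tendsto (u x) (𝓝[<] 0) (𝓝 l)
  /-- `D^α u(x,+0) = u_y(x,-0)`. -/
  gluing_deriv : ∀ x ∈ Icc (0 : ℝ) 1, ∃ l : ℝ,
    Tendsto (caputoPos α (u x)) (𝓝[>] 0) (𝓝 l) ∧ Tendsto (deriv (u x)) (𝓝[<] 0) (𝓝 l)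
  /-- The nonlocal condition. -/
  nonlocal : ∀ x ∈ Icc (0 : ℝ) 1, u x b - u x (-a) = φ x

/-- For the given data `φ`, Problem D has at most one solution (as a function on
`[0,1] × [-a,b]`). -/
def AtMostOneSolution (k : ℕ) (m α β a b : ℝ) (φ : ℝ → ℝ) : Prop :=
  ∀ u v : ℝ → ℝ → ℝ, IsSolution k m α β a b φ u → IsSolution k m α β a b φ v →
    ∀ x ∈ Icc (0 : ℝ) 1, ∀ y ∈ Icc (-a) b, u x y = v x y

/-- `lam` is an eigenvalue of `X⁽²ᵏ⁾ = (-1)ᵏ lam x⁻ᵐ X` on `(0,1)`,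
`X⁽ʲ⁾(0) = X⁽ʲ⁾(1) = 0` for `j < k`. -/
def IsEigenvalue (k : ℕ) (m lam : ℝ) : Prop :=
  ∃ X : ℝ → ℝ,
    ContDiffOn ℝ ((2 * k - 1 : ℕ) : WithTop ℕ∞) X (Icc 0 1) ∧
    ContDiffOn ℝ ((2 * k : ℕ) : WithTop ℕ∞) X (Ioo 0 1) ∧
    (∀ x ∈ Ioo (0 : ℝ) 1, iteratedDeriv (2 * k) X x = (-1) ^ k * lam * x ^ (-m) * X x) ∧
    (∀ j < k, iteratedDerivWithin j X (Icc 0 1) 0 = 0 ∧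
      iteratedDerivWithin j X (Icc 0 1) 1 = 0) ∧
    ∃ x ∈ Ioo (0 : ℝ) 1, X x ≠ 0

/-- `E_{α,1}(-lam b^α) - (E_{β,1}(-lam a^β) + a lam E_{β,2}(-lam a^β))`. -/
def Delta (α β a b lam : ℝ) : ℝ :=
  mittagLeffler α 1 (-lam * b ^ α) -
    (mittagLeffler β 1 (-lam * a ^ β) + a * lam * mittagLeffler β 2 (-lam * a ^ β))

end ProblemD

end

/-!
Let `X` be an eigenfunction with eigenvalue `λ` and `u` a solution with `φ = 0`. Integration by
parts shows that the coefficient `c(y) = ∫ x ^ (-m) X(x) u(x, y) dx` solves the fractional equations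
`D^α c = -λ c` for `y > 0` and `D^β c = -λ c` for `y < 0`. Both are equivalent to Volterra equations
whose solutions are Mittag-Leffler functions, so the gluing conditions at `y = 0` determine `c` up
to the factor `c(0)`, and `c(b) = c(-a)` becomes `Δ c(0) = 0`. If no `Δ` vanishes, all coefficients
of `u` are zero, and `u = 0` because the eigenfunctions are complete: their derivatives of order `k`
are the eigenvectors of a compact injective symmetric operator on the orthogonal complement, in
`L²(0,1)`, of the polynomials of degree less than `k`. If `Δ = 0` for some `X`, the separated
solution with initial profile `X` has data `φ = 0` and can be added to any given solution.
-/

noncomputable section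

namespace ProblemD

/-! ### Riemann–Liouville integrals -/

/-- The Riemann–Liouville kernel `t ^ (μ - 1) / Γ(μ)`, whose convolution powers are
`rlKernel μ * rlKernel ν = rlKernel (μ + ν)`. -/
def rlKernel (μ t : ℝ) : ℝ := t ^ (μ - 1) / Real.Gamma μ

/-- The Riemann–Liouville fractional integral of order `μ` with origin `0`. -/
def fracInt (μ : ℝ) (f : ℝ → ℝ) (y : ℝ) : ℝ :=
  ∫ z in (0 : ℝ)..y, rlKernel μ (y - z) * f z

/-- Absolute convergence of the integral defining `fracInt μ f y`. -/
def FracIntegrable (μ : ℝ) (f : ℝ → ℝ) (y : ℝ) : Prop :=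
  IntervalIntegrable (fun z ↦ rlKernel μ (y - z) * f z) volume 0 y

section Kernel

variable {μ ν t y z : ℝ}

lemma rlKernel_nonneg (hμ : 0 < μ) (ht : 0 ≤ t) : 0 ≤ rlKernel μ t :=
  div_nonneg (Real.rpow_nonneg ht _) (Real.Gamma_pos_of_pos hμ).le

lemma rlKernel_pos (hμ : 0 < μ) (ht : 0 < t) : 0 < rlKernel μ t :=
  div_pos (Real.rpow_pos_of_pos ht _) (Real.Gamma_pos_of_pos hμ)

lemma rlKernel_one (t : ℝ) : rlKernel 1 t = 1 := by simp [rlKernel]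

lemma rlKernel_two (t : ℝ) : rlKernel 2 t = t := by norm_num [rlKernel, Real.Gamma_two]

lemma rlKernel_one_sub (μ : ℝ) (ht : 0 ≤ t) :
    rlKernel (1 - μ) t = 1 / Real.Gamma (1 - μ) * (t ^ μ)⁻¹ := by
  rw [rlKernel, show 1 - μ - 1 = -μ by ring, Real.rpow_neg ht]
  ring

@[fun_prop]
lemma measurable_rlKernel (μ : ℝ) : Measurable (rlKernel μ) := by
  unfold rlKernel
  fun_prop

lemma integral_rpow_mul_sub_rpow (hμ : 0 < μ) (hν : 0 < ν) (hy : 0 < y) :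
    ∫ x in (0 : ℝ)..y, x ^ (μ - 1) * (y - x) ^ (ν - 1) =
      y ^ (μ + ν - 1) * ProbabilityTheory.beta μ ν := by
  have hcomplex := congrArg Complex.re (Complex.betaIntegral_scaled μ ν hy)
  have hintegral : ∫ x in (0 : ℝ)..y, (x : ℂ) ^ ((μ : ℂ) - 1) * ((y : ℂ) - x) ^ ((ν : ℂ) - 1) =
      ((∫ x in (0 : ℝ)..y, x ^ (μ - 1) * (y - x) ^ (ν - 1) : ℝ) : ℂ) := by
    rw [← intervalIntegral.integral_ofReal]
    refine intervalIntegral.integral_congr fun x hx ↦ ?_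
    rw [uIcc_of_le hy.le] at hx
    simp only [Complex.ofReal_mul]
    rw [Complex.ofReal_cpow hx.1, Complex.ofReal_cpow (sub_nonneg.2 hx.2)]
    push_cast
    rfl
  have hpow : (y : ℂ) ^ ((μ : ℂ) + ν - 1) = ((y ^ (μ + ν - 1) : ℝ) : ℂ) := by
    rw [Complex.ofReal_cpow hy.le]
    push_cast
    rfl
  rwa [hintegral, hpow, Complex.re_ofReal_mul, Complex.ofReal_re,
    ← ProbabilityTheory.beta_eq_betaIntegralReal μ ν hμ hν] at hcomplex

lemma integral_rlKernel_mul_rlKernel (hμ : 0 < μ) (hν : 0 < ν) (hzy : z < y) :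
    ∫ s in z..y, rlKernel μ (y - s) * rlKernel ν (s - z) = rlKernel (μ + ν) (y - z) := by
  have hΓμ := (Real.Gamma_pos_of_pos hμ).ne'
  have hΓν := (Real.Gamma_pos_of_pos hν).ne'
  calc ∫ s in z..y, rlKernel μ (y - s) * rlKernel ν (s - z)
      = ∫ s in (0 : ℝ)..y - z, rlKernel μ (y - z - s) * rlKernel ν s := by
        simpa using intervalIntegral.integral_comp_sub_right (a := z) (b := y)
          (fun s ↦ rlKernel μ (y - z - s) * rlKernel ν s) z
    _ = 1 / (Real.Gamma μ * Real.Gamma ν) *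
          ∫ s in (0 : ℝ)..y - z, s ^ (ν - 1) * (y - z - s) ^ (μ - 1) := by
        rw [← intervalIntegral.integral_const_mul]
        congr 1 with s
        unfold rlKernel
        field_simp
    _ = rlKernel (μ + ν) (y - z) := by
        rw [integral_rpow_mul_sub_rpow hν hμ (sub_pos.2 hzy), ProbabilityTheory.beta, rlKernel,
          add_comm ν μ]
        field_simp

lemma intervalIntegrable_rlKernel_mul_rlKernel (hμ : 0 < μ) (hν : 0 < ν) (hzy : z < y) :
    IntervalIntegrable (fun s ↦ rlKernel μ (y - s) * rlKernel ν (s - z)) volume z y := by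
  apply intervalIntegral.intervalIntegrable_of_integral_ne_zero
  rw [integral_rlKernel_mul_rlKernel hμ hν hzy]
  exact (rlKernel_pos (add_pos hμ hν) (sub_pos.2 hzy)).ne'

lemma fracInt_rlKernel (hμ : 0 < μ) (hν : 0 < ν) (hy : 0 < y) :
    fracInt μ (rlKernel ν) y = rlKernel (μ + ν) y := by
  simpa only [fracInt, sub_zero] using integral_rlKernel_mul_rlKernel hμ hν hy

lemma fracIntegrable_rlKernel (hμ : 0 < μ) (hν : 0 < ν) (hy : 0 < y) :
    FracIntegrable μ (rlKernel ν) y := by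
  simpa only [FracIntegrable, sub_zero] using intervalIntegrable_rlKernel_mul_rlKernel hμ hν hy

end Kernel

section FracInt

variable {μ ν y c : ℝ} {f g : ℝ → ℝ}

lemma fracInt_congr (hy : 0 ≤ y) (h : EqOn f g (Ioo 0 y)) : fracInt μ f y = fracInt μ g y := by
  simp only [fracInt, intervalIntegral.integral_of_le hy, integral_Ioc_eq_integral_Ioo]
  refine setIntegral_congr_fun measurableSet_Ioo fun z hz ↦ ?_
  simp only [h hz]

lemma FracIntegrable.congr (hf : FracIntegrable μ f y) (hy : 0 ≤ y) (h : EqOn f g (Ioo 0 y)) :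
    FracIntegrable μ g y := by
  rw [FracIntegrable, intervalIntegrable_iff_integrableOn_Ioo_of_le hy] at hf ⊢
  refine hf.congr_fun (fun z hz ↦ ?_) measurableSet_Ioo
  simp only [h hz]

lemma FracIntegrable.const_mul (hf : FracIntegrable μ f y) (c : ℝ) :
    FracIntegrable μ (fun z ↦ c * f z) y := by
  have h := IntervalIntegrable.const_mul hf c
  simp only [mul_left_comm c] at h
  exact h

lemma FracIntegrable.add (hf : FracIntegrable μ f y) (hg : FracIntegrable μ g y) :
    FracIntegrable μ (fun z ↦ f z + g z) y := by
  have h := IntervalIntegrable.add hf hg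
  simp only [← mul_add] at h
  exact h

lemma fracInt_const_mul (c : ℝ) : fracInt μ (fun z ↦ c * f z) y = c * fracInt μ f y := by
  simp only [fracInt, mul_left_comm _ c, intervalIntegral.integral_const_mul]

lemma fracInt_add (hf : FracIntegrable μ f y) (hg : FracIntegrable μ g y) :
    fracInt μ (fun z ↦ f z + g z) y = fracInt μ f y + fracInt μ g y := by
  simp only [fracInt, mul_add, intervalIntegral.integral_add hf hg]

lemma fracInt_one (f : ℝ → ℝ) (y : ℝ) : fracInt 1 f y = ∫ z in (0 : ℝ)..y, f z := by
  simp only [fracInt, rlKernel_one, one_mul]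

lemma fracIntegrable_one_iff : FracIntegrable 1 f y ↔ IntervalIntegrable f volume 0 y := by
  simp only [FracIntegrable, rlKernel_one, one_mul]

lemma FracIntegrable.mul_continuousOn (hf : FracIntegrable μ f y) (hg : ContinuousOn g (uIcc 0 y)) :
    FracIntegrable μ (fun z ↦ f z * g z) y := by
  have h := IntervalIntegrable.mul_continuousOn hf hg
  simp only [mul_assoc] at h
  exact h

lemma fracIntegrable_of_continuousOn (hμ : 0 < μ) (hy : 0 < y) (hf : ContinuousOn f (Icc 0 y)) :
    FracIntegrable μ f y := by
  have h := (fracIntegrable_rlKernel hμ one_pos hy).mul_continuousOn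
    (g := f) (by rwa [uIcc_of_le hy.le])
  simpa only [rlKernel_one, one_mul] using h

lemma FracIntegrable.aestronglyMeasurable (hf : FracIntegrable μ f y) (hμ : 0 < μ) (hy : 0 ≤ y) :
    AEStronglyMeasurable f (volume.restrict (Ioo 0 y)) := by
  rw [FracIntegrable, intervalIntegrable_iff_integrableOn_Ioo_of_le hy] at hf
  have hinv : Measurable fun z ↦ (rlKernel μ (y - z))⁻¹ := by fun_prop
  refine (hinv.aestronglyMeasurable.mul hf.aestronglyMeasurable).congr ?_
  filter_upwards [ae_restrict_mem measurableSet_Ioo] with z hz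
  exact inv_mul_cancel_left₀ (rlKernel_pos hμ (sub_pos.2 hz.2)).ne' (f z)

lemma measurableSet_triangle (a b : ℝ) :
    MeasurableSet {p : ℝ × ℝ | a < p.2 ∧ p.2 < p.1 ∧ p.1 < b} :=
  (measurableSet_lt measurable_const measurable_snd).inter
    ((measurableSet_lt measurable_snd measurable_fst).inter
      (measurableSet_lt measurable_fst measurable_const))

lemma intervalIntegral_swap_triangle {E : Type*} [NormedAddCommGroup E] [NormedSpace ℝ E]
    {F : ℝ → ℝ → E} {a b : ℝ} (hab : a ≤ b)
    (hF : IntegrableOn (Function.uncurry F) {p | a < p.2 ∧ p.2 < p.1 ∧ p.1 < b}) :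
    ∫ s in a..b, ∫ z in a..s, F s z = ∫ z in a..b, ∫ s in z..b, F s z := by
  set T : Set (ℝ × ℝ) := {p | a < p.2 ∧ p.2 < p.1 ∧ p.1 < b}
  have hT : MeasurableSet T := measurableSet_triangle a b
  have hinner_left (s : ℝ) : ∫ z, T.indicator (Function.uncurry F) (s, z) =
      (Ioo a b).indicator (fun s ↦ ∫ z in a..s, F s z) s := by
    by_cases hs : s ∈ Ioo a b
    · rw [indicator_of_mem hs, intervalIntegral.integral_of_le hs.1.le,
        integral_Ioc_eq_integral_Ioo, ← integral_indicator measurableSet_Ioo]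
      congr 1 with z
      simp only [T, indicator, mem_ofPred_eq, mem_Ioo, hs.2, and_true, Function.uncurry_apply_pair]
    · have hempty (z : ℝ) : (s, z) ∉ T := fun h ↦ hs ⟨h.1.trans h.2.1, h.2.2⟩
      simp only [indicator_of_notMem hs, indicator_of_notMem (hempty _), integral_zero]
  have hinner_right (z : ℝ) : ∫ s, T.indicator (Function.uncurry F) (s, z) =
      (Ioo a b).indicator (fun z ↦ ∫ s in z..b, F s z) z := by
    by_cases hz : z ∈ Ioo a b
    · rw [indicator_of_mem hz, intervalIntegral.integral_of_le hz.2.le,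
        integral_Ioc_eq_integral_Ioo, ← integral_indicator measurableSet_Ioo]
      congr 1 with s
      simp only [T, indicator, mem_ofPred_eq, mem_Ioo, hz.1, true_and, Function.uncurry_apply_pair]
    · have hempty (s : ℝ) : (s, z) ∉ T := fun h ↦ hz ⟨h.1, h.2.1.trans h.2.2⟩
      simp only [indicator_of_notMem hz, indicator_of_notMem (hempty _), integral_zero]
  have hswap := integral_integral_swap (f := fun s z ↦ T.indicator (Function.uncurry F) (s, z))
    ((integrable_indicator_iff hT).2 hF)
  simpa only [hinner_left, hinner_right, integral_indicator measurableSet_Ioo,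
    ← integral_Ioc_eq_integral_Ioo, ← intervalIntegral.integral_of_le hab] using hswap

lemma integrable_prod_indicator_rlKernel_mul {S : Set ℝ} {g : ℝ → ℝ} (hS : MeasurableSet S)
    (hμ : 0 < μ) (hν : 0 < ν) (hSy : ∀ z ∈ S, z < y)
    (hgm : AEStronglyMeasurable g (volume.restrict S))
    (hg : IntegrableOn (fun z ↦ rlKernel (μ + ν) (y - z) * g z) S) :
    Integrable (fun p : ℝ × ℝ ↦ {p : ℝ × ℝ | p.2 < p.1 ∧ p.1 < y}.indicator
        (fun p ↦ rlKernel μ (y - p.1) * rlKernel ν (p.1 - p.2)) p * g p.2)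
      (volume.prod (volume.restrict S)) := by
  set K : ℝ × ℝ → ℝ := {p : ℝ × ℝ | p.2 < p.1 ∧ p.1 < y}.indicator
    fun p ↦ rlKernel μ (y - p.1) * rlKernel ν (p.1 - p.2)
  have hKm : Measurable K := by
    refine Measurable.indicator (by fun_prop) ?_
    exact (measurableSet_lt measurable_snd measurable_fst).inter
      (measurableSet_lt measurable_fst measurable_const)
  have hK0 (p : ℝ × ℝ) : 0 ≤ K p := indicator_nonneg (fun p hp ↦
    mul_nonneg (rlKernel_nonneg hμ (sub_nonneg.2 hp.2.le))
      (rlKernel_nonneg hν (sub_nonneg.2 hp.1.le))) p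
  have hKz (z : ℝ) : (fun s ↦ K (s, z)) =
      (Ioo z y).indicator fun s ↦ rlKernel μ (y - s) * rlKernel ν (s - z) := rfl
  have hKi {z : ℝ} (hz : z < y) : Integrable fun s ↦ K (s, z) := by
    rw [hKz, integrable_indicator_iff measurableSet_Ioo,
      ← intervalIntegrable_iff_integrableOn_Ioo_of_le hz.le]
    exact intervalIntegrable_rlKernel_mul_rlKernel hμ hν hz
  have hKint {z : ℝ} (hz : z < y) : ∫ s, K (s, z) = rlKernel (μ + ν) (y - z) := by
    rw [hKz, integral_indicator measurableSet_Ioo, ← integral_Ioc_eq_integral_Ioo,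
      ← intervalIntegral.integral_of_le hz.le, integral_rlKernel_mul_rlKernel hμ hν hz]
  refine (integrable_prod_iff' (hKm.aestronglyMeasurable.mul hgm.comp_snd)).2 ⟨?_, ?_⟩
  · filter_upwards [ae_restrict_mem hS] with z hz using (hKi (hSy z hz)).mul_const (g z)
  · refine hg.norm.congr ?_
    filter_upwards [ae_restrict_mem hS] with z hz
    have hKnorm (s : ℝ) : ‖K (s, z)‖ = K (s, z) := Real.norm_of_nonneg (hK0 _)
    simp only [Pi.mul_apply, norm_mul, hKnorm, integral_mul_const, hKint (hSy z hz),
      Real.norm_of_nonneg (rlKernel_nonneg (add_pos hμ hν) (sub_pos.2 (hSy z hz)).le)]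

lemma FracIntegrable.integrableOn_triangle (hf : FracIntegrable (μ + ν) f y) (hμ : 0 < μ)
    (hν : 0 < ν) (hy : 0 ≤ y) :
    IntegrableOn (fun p : ℝ × ℝ ↦ rlKernel μ (y - p.1) * rlKernel ν (p.1 - p.2) * f p.2)
      {p | 0 < p.2 ∧ p.2 < p.1 ∧ p.1 < y} := by
  have hfm := hf.aestronglyMeasurable (add_pos hμ hν) hy
  rw [FracIntegrable, intervalIntegrable_iff_integrableOn_Ioo_of_le hy] at hf
  have hprod := integrable_prod_indicator_rlKernel_mul measurableSet_Ioo hμ hν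
    (fun z hz ↦ hz.2) hfm hf
  have hrestrict : (volume : Measure ℝ).prod (volume.restrict (Ioo 0 y)) =
      (volume : Measure (ℝ × ℝ)).restrict (univ ×ˢ Ioo 0 y) := by
    rw [Measure.volume_eq_prod, ← Measure.prod_restrict, Measure.restrict_univ]
  rw [hrestrict] at hprod
  refine IntegrableOn.congr_fun (IntegrableOn.mono_set hprod fun p hp ↦ ?_) (fun p hp ↦ ?_)
    (measurableSet_triangle 0 y)
  · exact ⟨mem_univ _, hp.1, hp.2.1.trans hp.2.2⟩
  · simp only [indicator_of_mem (show p ∈ {p : ℝ × ℝ | p.2 < p.1 ∧ p.1 < y} from hp.2)]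

lemma fracInt_fracInt (hμ : 0 < μ) (hν : 0 < ν) (hy : 0 < y) (hf : FracIntegrable (μ + ν) f y) :
    fracInt μ (fracInt ν f) y = fracInt (μ + ν) f y := by
  calc fracInt μ (fracInt ν f) y
      = ∫ s in (0 : ℝ)..y, ∫ z in (0 : ℝ)..s, rlKernel μ (y - s) * rlKernel ν (s - z) * f z := by
        simp only [fracInt, mul_assoc, intervalIntegral.integral_const_mul]
    _ = ∫ z in (0 : ℝ)..y, ∫ s in z..y, rlKernel μ (y - s) * rlKernel ν (s - z) * f z :=
        intervalIntegral_swap_triangle hy.le (hf.integrableOn_triangle hμ hν hy.le)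
    _ = fracInt (μ + ν) f y := by
        simp only [intervalIntegral.integral_mul_const]
        refine intervalIntegral.integral_congr_ae ?_
        filter_upwards [Measure.ae_ne volume y] with z hzy hz
        rw [uIoc_of_le hy.le] at hz
        rw [integral_rlKernel_mul_rlKernel hμ hν (lt_of_le_of_ne hz.2 hzy)]

end FracInt

/-! ### Mittag-Leffler functions and the Volterra equation -/

section MittagLeffler

variable {θ η μ c t : ℝ}

lemma rpow_mul_exp_neg_le_Gamma {R s : ℝ} (hR : 0 < R) (hs : 1 ≤ s) :
    R ^ (s - 1) * Real.exp (-R) ≤ Real.Gamma s := by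
  rw [Real.Gamma_eq_integral (by linarith), ← integral_exp_neg_Ioi R, ← integral_const_mul]
  have hconv := Real.GammaIntegral_convergent (s := s) (by linarith)
  calc ∫ x in Ioi R, R ^ (s - 1) * Real.exp (-x)
      ≤ ∫ x in Ioi R, Real.exp (-x) * x ^ (s - 1) := by
        refine setIntegral_mono_on ((integrableOn_exp_neg_Ioi R).const_mul _)
          (hconv.mono_set (Ioi_subset_Ioi hR.le)) measurableSet_Ioi fun x hx ↦ ?_
        rw [mul_comm]
        gcongr
        exact le_of_lt hx
    _ ≤ ∫ x in Ioi (0 : ℝ), Real.exp (-x) * x ^ (s - 1) := by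
        refine setIntegral_mono_set hconv ?_ (Ioi_subset_Ioi hR.le).eventuallyLE
        filter_upwards [ae_restrict_mem measurableSet_Ioi] with x (hx : 0 < x)
        exact mul_nonneg (Real.exp_pos _).le (Real.rpow_nonneg hx.le _)

lemma summable_pow_div_Gamma (hθ : 0 < θ) (η z : ℝ) :
    Summable fun n : ℕ ↦ |z| ^ n / Real.Gamma (θ * n + η) := by
  have hz := abs_nonneg z
  -- `R` is chosen so that the bound `R ^ (s - 1) * exp (-R) ≤ Γ s` gives a geometric majorant.
  obtain ⟨R, hR, hRθ⟩ : ∃ R : ℝ, 0 < R ∧ R ^ θ = 2 * |z| + 1 :=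
    ⟨(2 * |z| + 1) ^ θ⁻¹, by positivity, Real.rpow_inv_rpow (by positivity) hθ.ne'⟩
  have hratio : |z| / (2 * |z| + 1) < 1 := by rw [div_lt_one (by positivity)]; linarith
  have hgeometric := (summable_geometric_of_lt_one (by positivity) hratio).mul_left
    (Real.exp R * R ^ (1 - η))
  refine hgeometric.of_norm_bounded_eventually_nat ?_
  have htop : Tendsto (fun n : ℕ ↦ θ * n + η) atTop atTop :=
    tendsto_atTop_add_const_right _ _ (tendsto_natCast_atTop_atTop.const_mul_atTop hθ)
  filter_upwards [htop.eventually_ge_atTop 1] with n hn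
  have hΓ := Real.Gamma_pos_of_pos (zero_lt_one.trans_le hn)
  have hpow : R ^ (θ * n + η - 1) = (2 * |z| + 1) ^ n * (R ^ (1 - η))⁻¹ := by
    rw [show θ * n + η - 1 = θ * n + -(1 - η) by ring, Real.rpow_add hR, Real.rpow_mul hR.le,
      hRθ, Real.rpow_natCast, Real.rpow_neg hR.le]
  have hbound := rpow_mul_exp_neg_le_Gamma hR hn
  rw [Real.norm_of_nonneg (by positivity), div_le_iff₀ hΓ]
  calc |z| ^ n
      = Real.exp R * R ^ (1 - η) * (|z| / (2 * |z| + 1)) ^ n *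
          (R ^ (θ * n + η - 1) * Real.exp (-R)) := by
        rw [hpow, div_pow, Real.exp_neg]
        field_simp
    _ ≤ _ := mul_le_mul_of_nonneg_left hbound (by positivity)

lemma continuous_mittagLeffler (hθ : 0 < θ) (hη : 0 < η) : Continuous (mittagLeffler θ η) := by
  refine continuous_iff_continuousAt.2 fun z ↦ ?_
  have hball : ContinuousOn (mittagLeffler θ η) (Metric.ball 0 (|z| + 1)) := by
    refine continuousOn_tsum (fun n ↦ by fun_prop) (summable_pow_div_Gamma hθ η (|z| + 1))
      fun n x hx ↦ ?_
    have hΓ := Real.Gamma_pos_of_pos (show 0 < θ * n + η by positivity)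
    rw [norm_div, norm_pow, Real.norm_of_nonneg hΓ.le, abs_of_nonneg (by positivity : 0 ≤ |z| + 1)]
    gcongr
    exact (mem_ball_zero_iff.1 hx).le
  refine hball.continuousAt (Metric.isOpen_ball.mem_nhds ?_)
  rw [mem_ball_zero_iff, Real.norm_eq_abs]
  exact lt_add_one _

lemma mittagLeffler_zero (θ η : ℝ) : mittagLeffler θ η 0 = 1 / Real.Gamma η := by
  rw [mittagLeffler, tsum_eq_single 0 fun n hn ↦ by simp [hn]]
  simp

/-- The function `t ^ (η - 1) * E_{θ,η}(c * t ^ θ)`, encoded as a series of Riemann–Liouville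
kernels, on which fractional integrals act by shifting `η`. -/
def mlKernel (θ η c t : ℝ) : ℝ := ∑' n : ℕ, c ^ n * rlKernel (θ * n + η) t

lemma pow_mul_rlKernel (hθ : 0 ≤ θ) (ht : 0 < t ∨ 0 ≤ t ∧ 1 ≤ η) (c : ℝ) (n : ℕ) :
    c ^ n * rlKernel (θ * n + η) t =
      t ^ (η - 1) * ((c * t ^ θ) ^ n / Real.Gamma (θ * n + η)) := by
  have ht0 : 0 ≤ t := ht.elim le_of_lt And.left
  have hadd : t ^ (θ * n + η - 1) = t ^ (θ * n) * t ^ (η - 1) := by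
    rw [add_sub_assoc]
    rcases ht with ht | ⟨ht, hη⟩
    · exact Real.rpow_add ht _ _
    · exact Real.rpow_add_of_nonneg ht (by positivity) (sub_nonneg.2 hη)
  rw [rlKernel, hadd, Real.rpow_mul ht0, Real.rpow_natCast, mul_pow]
  ring

lemma mlKernel_eq (hθ : 0 ≤ θ) (ht : 0 < t ∨ 0 ≤ t ∧ 1 ≤ η) (c : ℝ) :
    mlKernel θ η c t = t ^ (η - 1) * mittagLeffler θ η (c * t ^ θ) := by
  simp only [mlKernel, mittagLeffler, pow_mul_rlKernel hθ ht, tsum_mul_left]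

lemma summable_abs_pow_mul_rlKernel (hθ : 0 < θ) (ht : 0 < t) (η c : ℝ) :
    Summable fun n : ℕ ↦ |c| ^ n * rlKernel (θ * n + η) t := by
  have h := (summable_pow_div_Gamma hθ η (c * t ^ θ)).mul_left (t ^ (η - 1))
  rw [abs_mul, abs_of_pos (Real.rpow_pos_of_pos ht θ)] at h
  simpa only [pow_mul_rlKernel hθ.le (.inl ht)] using h

lemma summable_pow_mul_rlKernel (hθ : 0 < θ) (hη : 0 < η) (ht : 0 < t) (c : ℝ) :
    Summable fun n : ℕ ↦ c ^ n * rlKernel (θ * n + η) t := by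
  refine (summable_abs_pow_mul_rlKernel hθ ht η c).of_norm_bounded fun n ↦ ?_
  rw [norm_mul, norm_pow, Real.norm_eq_abs,
    Real.norm_of_nonneg (rlKernel_nonneg (by positivity) ht.le)]

lemma continuous_mittagLeffler_mul_rpow (hθ : 0 < θ) (hη : 0 < η) (c : ℝ) :
    Continuous fun t : ℝ ↦ mittagLeffler θ η (c * t ^ θ) :=
  (continuous_mittagLeffler hθ hη).comp
    (continuous_const.mul (Real.continuous_rpow_const hθ.le))

lemma continuousOn_mlKernel_Ioi (hθ : 0 < θ) (hη : 0 < η) (c : ℝ) :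
    ContinuousOn (mlKernel θ η c) (Ioi 0) :=
  ((continuousOn_id.rpow_const fun _ ht ↦ .inl (ne_of_gt ht)).mul
    (continuous_mittagLeffler_mul_rpow hθ hη c).continuousOn).congr
      fun _ ht ↦ mlKernel_eq hθ.le (.inl ht) c

lemma continuousOn_mlKernel_Ici (hθ : 0 < θ) (hη : 1 ≤ η) (c : ℝ) :
    ContinuousOn (mlKernel θ η c) (Ici 0) :=
  ((Real.continuous_rpow_const (sub_nonneg.2 hη)).mul
    (continuous_mittagLeffler_mul_rpow hθ (by linarith) c)).continuousOn.congr
      fun _ ht ↦ mlKernel_eq hθ.le (.inr ⟨ht, hη⟩) c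

lemma mlKernel_one_zero (hθ : 0 < θ) (c : ℝ) : mlKernel θ 1 c 0 = 1 := by
  simp [mlKernel_eq hθ.le (.inr ⟨le_rfl, le_rfl⟩), Real.zero_rpow hθ.ne', mittagLeffler_zero]

lemma mlKernel_zero (hθ : 0 < θ) (hη : 1 < η) (c : ℝ) : mlKernel θ η c 0 = 0 := by
  rw [mlKernel_eq hθ.le (.inr ⟨le_rfl, hη.le⟩), Real.zero_rpow (sub_pos.2 hη).ne', zero_mul]

lemma mlKernel_eq_rlKernel_add (hθ : 0 < θ) (hη : 0 < η) (ht : 0 < t) (c : ℝ) :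
    mlKernel θ η c t = rlKernel η t + c * mlKernel θ (η + θ) c t := by
  rw [mlKernel, (summable_pow_mul_rlKernel hθ hη ht c).tsum_eq_zero_add, mlKernel, ← tsum_mul_left]
  have hshift (n : ℕ) : θ * ((n + 1 : ℕ) : ℝ) + η = θ * n + (η + θ) := by push_cast; ring
  simp only [hshift, pow_zero, one_mul, Nat.cast_zero, mul_zero, zero_add, pow_succ', mul_assoc]

lemma fracIntegrable_mlKernel (hμ : 0 < μ) (hθ : 0 < θ) (hη : 0 < η) (ht : 0 < t) (c : ℝ) :
    FracIntegrable μ (mlKernel θ η c) t := by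
  have hcont : Continuous fun t : ℝ ↦ Real.Gamma η * mittagLeffler θ η (c * t ^ θ) :=
    continuous_const.mul (continuous_mittagLeffler_mul_rpow hθ hη c)
  refine ((fracIntegrable_rlKernel hμ hη ht).mul_continuousOn hcont.continuousOn).congr ht.le
    fun z hz ↦ ?_
  have hΓ := (Real.Gamma_pos_of_pos hη).ne'
  simp only [mlKernel_eq hθ.le (.inl hz.1), rlKernel]
  field_simp

lemma fracInt_mlKernel (hμ : 0 < μ) (hθ : 0 < θ) (hη : 0 < η) (ht : 0 < t) (c : ℝ) :
    fracInt μ (mlKernel θ η c) t = mlKernel θ (η + μ) c t := by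
  have hterm (d : ℝ) (n : ℕ) :
      ∫ z in Ioc 0 t, d ^ n * (rlKernel μ (t - z) * rlKernel (θ * n + η) z) =
        d ^ n * rlKernel (θ * n + (η + μ)) t := by
    rw [integral_const_mul, ← intervalIntegral.integral_of_le ht.le]
    change d ^ n * fracInt μ (rlKernel (θ * n + η)) t = _
    rw [fracInt_rlKernel hμ (by positivity) ht, show μ + (θ * n + η) = θ * n + (η + μ) by ring]
  have hnorm (n : ℕ) :
      ∫ z in Ioc 0 t, ‖c ^ n * (rlKernel μ (t - z) * rlKernel (θ * n + η) z)‖ =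
        |c| ^ n * rlKernel (θ * n + (η + μ)) t := by
    rw [← hterm]
    refine setIntegral_congr_fun measurableSet_Ioc fun z hz ↦ ?_
    have hnonneg := mul_nonneg (rlKernel_nonneg hμ (sub_nonneg.2 hz.2))
      (rlKernel_nonneg (μ := θ * n + η) (by positivity) hz.1.le)
    simp only [norm_mul (c ^ n), norm_pow, Real.norm_eq_abs c, Real.norm_of_nonneg hnonneg]
  have hsum := hasSum_integral_of_summable_integral_norm (μ := volume.restrict (Ioc 0 t))
    (F := fun (n : ℕ) z ↦ c ^ n * (rlKernel μ (t - z) * rlKernel (θ * n + η) z))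
    (fun n ↦ ((intervalIntegrable_iff_integrableOn_Ioc_of_le ht.le).1
      (fracIntegrable_rlKernel hμ (by positivity) ht)).const_mul (c ^ n))
    (by simpa only [hnorm] using summable_abs_pow_mul_rlKernel hθ ht (η + μ) c)
  simp only [hterm] at hsum
  rw [mlKernel, hsum.tsum_eq, fracInt, intervalIntegral.integral_of_le ht.le]
  refine setIntegral_congr_fun measurableSet_Ioc fun z _ ↦ ?_
  simp only [mlKernel, ← tsum_mul_left, mul_left_comm]

lemma hasDerivAt_mlKernel (hθ : 0 < θ) (hη : 0 < η) (ht : 0 < t) (c : ℝ) :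
    HasDerivAt (mlKernel θ (η + 1) c) (mlKernel θ η c t) t := by
  have hcont := continuousOn_mlKernel_Ioi hθ hη c
  have hderiv := intervalIntegral.integral_hasDerivAt_right
    (fracIntegrable_one_iff.1 (fracIntegrable_mlKernel one_pos hθ hη ht c))
    (hcont.stronglyMeasurableAtFilter isOpen_Ioi t ht) (hcont.continuousAt (Ioi_mem_nhds ht))
  refine hderiv.congr_of_eventuallyEq ?_
  filter_upwards [Ioi_mem_nhds ht] with s hs
  rw [← fracInt_one, fracInt_mlKernel one_pos hθ hη hs]

lemma hasDerivAt_mlKernel_one (hθ : 0 < θ) (ht : 0 < t) (c : ℝ) :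
    HasDerivAt (mlKernel θ 1 c) (c * mlKernel θ θ c t) t := by
  refine (((hasDerivAt_mlKernel hθ hθ ht c).const_mul c).const_add 1).congr_of_eventuallyEq ?_
  filter_upwards [Ioi_mem_nhds ht] with s hs
  rw [mlKernel_eq_rlKernel_add hθ one_pos hs, rlKernel_one, add_comm θ 1]

end MittagLeffler

section Volterra

variable {θ c A B t T : ℝ} {v : ℝ → ℝ}

lemma abs_le_const_mul_rlKernel_of_eq_const_mul_fracInt {M : ℝ} (hθ : 0 < θ)
    (hM : ∀ t ∈ Ioo 0 T, |v t| ≤ M) (hv : ∀ t ∈ Ioo 0 T, v t = c * fracInt θ v t) (n : ℕ) :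
    ∀ t ∈ Ioo 0 T, |v t| ≤ M * (|c| ^ n * rlKernel (θ * n + 1) t) := by
  induction n with
  | zero => simpa [rlKernel_one] using hM
  | succ n ih =>
    intro t ht
    have hη : 0 < θ * n + 1 := by positivity
    have hfrac : |fracInt θ v t| ≤
        fracInt θ (fun z ↦ M * |c| ^ n * rlKernel (θ * n + 1) z) t := by
      rw [fracInt, ← Real.norm_eq_abs]
      refine intervalIntegral.norm_integral_le_of_norm_le ht.1.le ?_
        ((fracIntegrable_rlKernel hθ hη ht.1).const_mul _)
      filter_upwards with z hz
      have hker := rlKernel_nonneg hθ (sub_nonneg.2 hz.2)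
      rw [norm_mul, Real.norm_of_nonneg hker, mul_assoc M]
      exact mul_le_mul_of_nonneg_left (ih z ⟨hz.1, hz.2.trans_lt ht.2⟩) hker
    rw [fracInt_const_mul, fracInt_rlKernel hθ hη ht.1] at hfrac
    calc |v t| = |c| * |fracInt θ v t| := by rw [hv t ht, abs_mul]
      _ ≤ |c| * (M * |c| ^ n * rlKernel (θ + (θ * n + 1)) t) :=
        mul_le_mul_of_nonneg_left hfrac (abs_nonneg c)
      _ = M * (|c| ^ (n + 1) * rlKernel (θ * (n + 1 : ℕ) + 1) t) := by
        rw [show θ * ((n + 1 : ℕ) : ℝ) + 1 = θ + (θ * n + 1) by push_cast; ring]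
        ring

lemma eq_zero_of_eq_const_mul_fracInt {M : ℝ} (hθ : 0 < θ) (hM : ∀ t ∈ Ioo 0 T, |v t| ≤ M)
    (hv : ∀ t ∈ Ioo 0 T, v t = c * fracInt θ v t) : ∀ t ∈ Ioo 0 T, v t = 0 := by
  intro t ht
  have hlim := (summable_abs_pow_mul_rlKernel hθ ht.1 1 c).tendsto_atTop_zero.const_mul M
  rw [mul_zero] at hlim
  exact abs_nonpos_iff.1 (ge_of_tendsto' hlim fun n ↦
    abs_le_const_mul_rlKernel_of_eq_const_mul_fracInt hθ hM hv n t ht)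

/-- The continuous solution of `v = A + B * t + c * I^θ v` on `[0, ∞)`, namely
`A * E_{θ,1}(c * t ^ θ) + B * t * E_{θ,2}(c * t ^ θ)`. -/
def mlSolution (θ c A B t : ℝ) : ℝ := A * mlKernel θ 1 c t + B * mlKernel θ 2 c t

lemma mlSolution_eq (hθ : 0 ≤ θ) (ht : 0 ≤ t) (c A B : ℝ) :
    mlSolution θ c A B t =
      A * mittagLeffler θ 1 (c * t ^ θ) + B * (t * mittagLeffler θ 2 (c * t ^ θ)) := by
  rw [mlSolution, mlKernel_eq hθ (.inr ⟨ht, le_rfl⟩), mlKernel_eq hθ (.inr ⟨ht, one_le_two⟩)]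
  norm_num

lemma mlSolution_zero (hθ : 0 < θ) (c A B : ℝ) : mlSolution θ c A B 0 = A := by
  rw [mlSolution, mlKernel_one_zero hθ, mlKernel_zero hθ one_lt_two]
  ring

lemma mlSolution_const_mul (θ c A B d t : ℝ) :
    mlSolution θ c (d * A) (d * B) t = d * mlSolution θ c A B t := by
  simp only [mlSolution]
  ring

lemma continuousOn_mlSolution (hθ : 0 < θ) (c A B : ℝ) :
    ContinuousOn (mlSolution θ c A B) (Ici 0) :=
  ((continuousOn_mlKernel_Ici hθ le_rfl c).const_mul A).add
    ((continuousOn_mlKernel_Ici hθ one_le_two c).const_mul B)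

lemma mlSolution_eq_add_mul_fracInt (hθ : 0 < θ) (ht : 0 < t) (c A B : ℝ) :
    mlSolution θ c A B t = A + B * t + c * fracInt θ (mlSolution θ c A B) t := by
  have hfrac : fracInt θ (mlSolution θ c A B) t =
      A * mlKernel θ (1 + θ) c t + B * mlKernel θ (2 + θ) c t := by
    unfold mlSolution
    rw [fracInt_add ((fracIntegrable_mlKernel hθ hθ one_pos ht c).const_mul A)
      ((fracIntegrable_mlKernel hθ hθ two_pos ht c).const_mul B), fracInt_const_mul,
      fracInt_const_mul, fracInt_mlKernel hθ hθ one_pos ht, fracInt_mlKernel hθ hθ two_pos ht]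
  rw [hfrac, mlSolution, mlKernel_eq_rlKernel_add hθ one_pos ht,
    mlKernel_eq_rlKernel_add hθ two_pos ht, rlKernel_one, rlKernel_two]
  ring

lemma eqOn_mlSolution_of_eq_add_mul_fracInt (hθ : 0 < θ) (hT : 0 < T)
    (hcont : ContinuousOn v (Icc 0 T))
    (hv : ∀ t ∈ Ioo 0 T, v t = A + B * t + c * fracInt θ v t) :
    EqOn v (mlSolution θ c A B) (Icc 0 T) := by
  set w := mlSolution θ c A B
  have hw : ContinuousOn w (Icc 0 T) := (continuousOn_mlSolution hθ c A B).mono Icc_subset_Ici_self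
  have hint {f : ℝ → ℝ} (hf : ContinuousOn f (Icc 0 T)) {t : ℝ} (ht : t ∈ Ioo 0 T) :
      FracIntegrable θ f t :=
    fracIntegrable_of_continuousOn hθ ht.1 (hf.mono (Icc_subset_Icc_right ht.2.le))
  obtain ⟨M, hM⟩ := isCompact_Icc.exists_bound_of_continuousOn (hcont.add (hw.const_mul (-1)))
  have hdiff : ∀ t ∈ Ioo 0 T, v t + -1 * w t = 0 :=
    eq_zero_of_eq_const_mul_fracInt (c := c) hθ (fun t ht ↦ hM t (Ioo_subset_Icc_self ht))
      fun t ht ↦ by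
      rw [fracInt_add (hint hcont ht) ((hint hw ht).const_mul (-1)), fracInt_const_mul]
      linear_combination hv t ht - mlSolution_eq_add_mul_fracInt hθ ht.1 c A B
  have heq : EqOn v w (Ioo 0 T) := fun t ht ↦ by linarith [hdiff t ht]
  exact heq.of_subset_closure hcont hw Ioo_subset_Icc_self (closure_Ioo hT.ne).ge

lemma hasDerivAt_mlSolution (hθ : 0 < θ) (ht : 0 < t) (c A B : ℝ) :
    HasDerivAt (mlSolution θ c A B) (A * (c * mlKernel θ θ c t) + B * mlKernel θ 1 c t) t := by
  have h2 := hasDerivAt_mlKernel hθ one_pos ht c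
  rw [one_add_one_eq_two] at h2
  exact ((hasDerivAt_mlKernel_one hθ ht c).const_mul A).add (h2.const_mul B)

lemma eqOn_deriv_mlSolution (hθ : 0 < θ) (c A B : ℝ) :
    EqOn (deriv (mlSolution θ c A B))
      (fun t ↦ A * (c * mlKernel θ θ c t) + B * mlKernel θ 1 c t) (Ioi 0) :=
  fun _ ht ↦ (hasDerivAt_mlSolution hθ ht c A B).deriv

lemma hasDerivAt_deriv_mlSolution (hθ : 1 < θ) (ht : 0 < t) (c A B : ℝ) :
    HasDerivAt (deriv (mlSolution θ c A B))
      (A * (c * mlKernel θ (θ - 1) c t) + B * (c * mlKernel θ θ c t)) t := by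
  have hθ0 := zero_lt_one.trans hθ
  have hθ' := hasDerivAt_mlKernel hθ0 (sub_pos.2 hθ) ht c
  rw [sub_add_cancel] at hθ'
  exact (((hθ'.const_mul c).const_mul A).add
    ((hasDerivAt_mlKernel_one hθ0 ht c).const_mul B)).congr_of_eventuallyEq
      ((eqOn_deriv_mlSolution hθ0 c A B).eventuallyEq_of_mem (Ioi_mem_nhds ht))

lemma tendsto_deriv_mlSolution (hθ : 1 < θ) (c A B : ℝ) :
    Tendsto (deriv (mlSolution θ c A B)) (𝓝[>] 0) (𝓝 B) := by
  have hθ0 := zero_lt_one.trans hθ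
  have hcont : ContinuousOn (fun t ↦ A * (c * mlKernel θ θ c t) + B * mlKernel θ 1 c t) (Ici 0) :=
    (((continuousOn_mlKernel_Ici hθ0 hθ.le c).const_mul c).const_mul A).add
      ((continuousOn_mlKernel_Ici hθ0 le_rfl c).const_mul B)
  have hlim := (hcont 0 self_mem_Ici).tendsto.mono_left (nhdsWithin_mono _ Ioi_subset_Ici_self)
  rw [mlKernel_one_zero hθ0, mlKernel_zero hθ0 hθ, mul_zero, mul_zero, zero_add, mul_one] at hlim
  exact hlim.congr' ((eqOn_deriv_mlSolution hθ0 c A B).symm.eventuallyEq_of_mem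
    self_mem_nhdsWithin)

end Volterra

/-! ### Caputo derivatives -/

section Inversion

variable {μ ν T L : ℝ} {f : ℝ → ℝ}

lemma FracIntegrable.of_le (hf : FracIntegrable μ f T) (hμ : 0 < μ) (hμν : μ ≤ ν) (hT : 0 ≤ T) :
    FracIntegrable ν f T := by
  have hpow : ContinuousOn (fun z ↦ Real.Gamma μ / Real.Gamma ν * (T - z) ^ (ν - μ)) (uIcc 0 T) :=
    (((continuous_const.sub continuous_id).rpow_const fun _ ↦ Or.inr (sub_nonneg.2 hμν)).const_mul
      _).continuousOn
  refine (hf.mul_continuousOn hpow).congr_uIoo fun z hz ↦ ?_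
  rw [uIoo_of_le hT] at hz
  have hΓ := (Real.Gamma_pos_of_pos hμ).ne'
  have hadd := Real.rpow_add (sub_pos.2 hz.2) (μ - 1) (ν - μ)
  rw [show μ - 1 + (ν - μ) = ν - 1 by ring] at hadd
  simp only [rlKernel, hadd]
  field_simp

lemma eq_add_fracInt_fracInt_deriv (hμ0 : 0 < μ) (hμ1 : μ < 1) (hT : 0 < T)
    (hc : ContinuousOn f (Icc 0 T)) (hd : ∀ t ∈ Ioo 0 T, DifferentiableAt ℝ f t)
    (hi : FracIntegrable (1 - μ) (deriv f) T) :
    f T = f 0 + fracInt μ (fracInt (1 - μ) (deriv f)) T := by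
  have hsum : μ + (1 - μ) = 1 := by ring
  have hint : FracIntegrable 1 (deriv f) T := hi.of_le (sub_pos.2 hμ1) (by linarith) hT.le
  rw [fracInt_fracInt hμ0 (sub_pos.2 hμ1) hT (by rwa [hsum]), hsum, fracInt_one,
    intervalIntegral.integral_eq_sub_of_hasDerivAt_of_le hT.le hc
      (fun t ht ↦ (hd t ht).hasDerivAt) (fracIntegrable_one_iff.1 hint)]
  ring

lemma eq_add_fracInt_one_fracInt_one (hT : 0 < T) (hc : ContinuousOn f (Icc 0 T))
    (hd : ∀ t ∈ Ioo 0 T, DifferentiableAt ℝ f t ∧ DifferentiableAt ℝ (deriv f) t)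
    (hL : Tendsto (deriv f) (𝓝[>] 0) (𝓝 L))
    (hi : IntervalIntegrable (deriv (deriv f)) volume 0 T) :
    f T = f 0 + L * T + fracInt 1 (fracInt 1 (deriv (deriv f))) T := by
  have hderiv : ∀ t ∈ Ioo 0 T, deriv f t = L + fracInt 1 (deriv (deriv f)) t := by
    intro t ht
    rw [fracInt_one, intervalIntegral.integral_eq_sub_of_hasDerivAt_of_tendsto ht.1
      (fun s hs ↦ (hd s ⟨hs.1, hs.2.trans ht.2⟩).2.hasDerivAt) (hi.mono_set ?_) hL
      ((hd t ht).2.continuousAt.tendsto.mono_left nhdsWithin_le_nhds)]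
    · ring
    · rw [uIcc_of_le ht.1.le, uIcc_of_le hT.le]
      exact Icc_subset_Icc_right ht.2.le
  have hprim : IntervalIntegrable (fracInt 1 (deriv (deriv f))) volume 0 T := by
    simp only [funext (fracInt_one (deriv (deriv f)))]
    exact (intervalIntegral.continuousOn_primitive_interval
      ((intervalIntegrable_iff').1 hi)).intervalIntegrable
  have hftc := intervalIntegral.integral_eq_sub_of_hasDerivAt_of_le hT.le hc
    (fun t ht ↦ hderiv t ht ▸ (hd t ht).1.hasDerivAt) (intervalIntegrable_const.add hprim)
  rw [intervalIntegral.integral_add intervalIntegrable_const hprim,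
    intervalIntegral.integral_const, smul_eq_mul] at hftc
  rw [fracInt_one]
  linear_combination -hftc

lemma eq_add_fracInt_fracInt_deriv_deriv (hμ1 : 1 ≤ μ) (hμ2 : μ < 2) (hT : 0 < T)
    (hc : ContinuousOn f (Icc 0 T))
    (hd : ∀ t ∈ Ioo 0 T, DifferentiableAt ℝ f t ∧ DifferentiableAt ℝ (deriv f) t)
    (hL : Tendsto (deriv f) (𝓝[>] 0) (𝓝 L))
    (hi : FracIntegrable (2 - μ) (deriv (deriv f)) T) :
    f T = f 0 + L * T + fracInt μ (fracInt (2 - μ) (deriv (deriv f))) T := by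
  have h2μ : 0 < 2 - μ := sub_pos.2 hμ2
  have hsum : μ + (2 - μ) = 1 + 1 := by ring
  have hint1 : FracIntegrable 1 (deriv (deriv f)) T := hi.of_le h2μ (by linarith) hT.le
  have hint2 : FracIntegrable (1 + 1) (deriv (deriv f)) T := hi.of_le h2μ (by linarith) hT.le
  rw [fracInt_fracInt (by linarith) h2μ hT (by rwa [hsum]), hsum,
    ← fracInt_fracInt one_pos one_pos hT hint2]
  exact eq_add_fracInt_one_fracInt_one hT hc hd hL (fracIntegrable_one_iff.1 hint1)

end Inversion

section Caputo

variable {α β a b c y t l : ℝ} {f g : ℝ → ℝ}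

lemma fracIntegrable_one_sub_iff (hα : α < 1) (hy : 0 ≤ y) :
    FracIntegrable (1 - α) f y ↔ IntervalIntegrable (fun z ↦ f z / (y - z) ^ α) volume 0 y := by
  have hΓ := (Real.Gamma_pos_of_pos (sub_pos.2 hα)).ne'
  have hkernel : ∀ z ∈ uIoc 0 y,
      rlKernel (1 - α) (y - z) * f z = 1 / Real.Gamma (1 - α) * (f z / (y - z) ^ α) := by
    intro z hz
    rw [uIoc_of_le hy] at hz
    rw [rlKernel_one_sub α (sub_nonneg.2 hz.2)]
    ring
  refine ⟨fun h ↦ (IntervalIntegrable.const_mul h (Real.Gamma (1 - α))).congr fun z hz ↦ ?_,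
    fun h ↦ (h.const_mul (1 / Real.Gamma (1 - α))).congr fun z hz ↦ (hkernel z hz).symm⟩
  rw [hkernel z hz]
  field_simp

lemma integral_div_rpow_eq_fracInt (hy : 0 ≤ y) :
    1 / Real.Gamma (1 - α) * ∫ z in (0 : ℝ)..y, f z / (y - z) ^ α = fracInt (1 - α) f y := by
  rw [fracInt, ← intervalIntegral.integral_const_mul]
  refine intervalIntegral.integral_congr fun z hz ↦ ?_
  rw [uIcc_of_le hy] at hz
  simp only [rlKernel_one_sub α (sub_nonneg.2 hz.2)]
  ring

lemma caputoPosExists_iff (hα : α < 1) :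
    CaputoPosExists α b f ↔ (∀ t ∈ Ioo 0 b, DifferentiableAt ℝ f t) ∧
      ∀ t ∈ Ioo 0 b, FracIntegrable (1 - α) (deriv f) t :=
  and_congr_right fun _ ↦ forall₂_congr fun _ ht ↦ (fracIntegrable_one_sub_iff hα ht.1.le).symm

lemma caputoPos_eq_fracInt (hy : 0 ≤ y) : caputoPos α f y = fracInt (1 - α) (deriv f) y :=
  integral_div_rpow_eq_fracInt hy

lemma deriv_deriv_comp_neg (f : ℝ → ℝ) (t : ℝ) :
    deriv (deriv fun s ↦ f (-s)) t = deriv (deriv f) (-t) := by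
  simp only [funext (deriv_comp_neg f), deriv.fun_neg, deriv_comp_neg, neg_neg]

lemma forall_mem_Ioo_neg_zero_iff {p : ℝ → Prop} :
    (∀ y ∈ Ioo (-a) 0, p y) ↔ ∀ t ∈ Ioo 0 a, p (-t) :=
  ⟨fun h t ht ↦ h (-t) ⟨neg_lt_neg ht.2, neg_lt_zero.2 ht.1⟩,
    fun h y hy ↦ neg_neg y ▸ h (-y) ⟨neg_pos.2 hy.2, neg_lt.1 hy.1⟩⟩

lemma caputoNegExists_iff (hβ : β < 2) :
    CaputoNegExists β a f ↔
      (∀ t ∈ Ioo 0 a, DifferentiableAt ℝ (fun s ↦ f (-s)) t ∧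
        DifferentiableAt ℝ (deriv fun s ↦ f (-s)) t) ∧
      ∀ t ∈ Ioo 0 a, FracIntegrable (2 - β) (deriv (deriv fun s ↦ f (-s))) t := by
  rw [CaputoNegExists, forall_mem_Ioo_neg_zero_iff, forall_mem_Ioo_neg_zero_iff]
  refine and_congr (forall₂_congr fun t _ ↦ ?_) (forall₂_congr fun t ht ↦ ?_)
  · rw [funext (deriv_comp_neg f), differentiableAt_fun_neg_iff, differentiableAt_comp_neg,
      differentiableAt_comp_neg]
  · rw [show 2 - β = 1 - (β - 1) by ring, fracIntegrable_one_sub_iff (by linarith) ht.1.le,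
      IntervalIntegrable.symm_iff, IntervalIntegrable.iff_comp_neg, neg_neg, neg_zero]
    simp only [deriv_deriv_comp_neg, neg_add_eq_sub, sub_neg_eq_add]

lemma caputoNeg_neg_eq_fracInt (ht : 0 ≤ t) :
    caputoNeg β f (-t) = fracInt (2 - β) (deriv (deriv fun s ↦ f (-s))) t := by
  have hreflect := intervalIntegral.integral_comp_neg (a := 0) (b := t)
    fun z ↦ deriv (deriv f) z / (z - -t) ^ (β - 1)
  rw [neg_zero] at hreflect
  rw [caputoNeg, ← hreflect, show 2 - β = 1 - (β - 1) by ring, ← integral_div_rpow_eq_fracInt ht]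
  simp only [deriv_deriv_comp_neg, neg_add_eq_sub, sub_neg_eq_add]

lemma CaputoPosExists.eq_add_fracInt (hf : CaputoPosExists α b f) (hα0 : 0 < α) (hα1 : α < 1)
    (hc : ContinuousOn f (Ico 0 b)) (hy : y ∈ Ioo 0 b) :
    f y = f 0 + fracInt α (caputoPos α f) y := by
  obtain ⟨hd, hi⟩ := (caputoPosExists_iff hα1).1 hf
  rw [fracInt_congr hy.1.le fun z hz ↦ caputoPos_eq_fracInt hz.1.le]
  exact eq_add_fracInt_fracInt_deriv hα0 hα1 hy.1 (hc.mono (Icc_subset_Ico_right hy.2))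
    (fun t ht ↦ hd t ⟨ht.1, ht.2.trans hy.2⟩) (hi y hy)

lemma CaputoNegExists.eq_add_fracInt (hf : CaputoNegExists β a f) (hβ1 : 1 ≤ β) (hβ2 : β < 2)
    (hc : ContinuousOn f (Ioc (-a) 0)) (hl : Tendsto (deriv f) (𝓝[<] 0) (𝓝 l))
    (ht : t ∈ Ioo 0 a) :
    f (-t) = f 0 - l * t + fracInt β (fun s ↦ caputoNeg β f (-s)) t := by
  obtain ⟨hd, hi⟩ := (caputoNegExists_iff hβ2).1 hf
  have hneg : Tendsto (fun s : ℝ ↦ -s) (𝓝[>] 0) (𝓝[<] 0) := by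
    simpa using tendsto_neg_nhdsGT (a := (0 : ℝ))
  have hl' : Tendsto (deriv fun s ↦ f (-s)) (𝓝[>] 0) (𝓝 (-l)) := by
    simpa only [funext (deriv_comp_neg f), Function.comp_def] using (hl.comp hneg).neg
  have hc' : ContinuousOn (fun s ↦ f (-s)) (Icc 0 t) :=
    hc.comp continuousOn_neg fun s hs ↦ ⟨by linarith [hs.2, ht.2], neg_nonpos.2 hs.1⟩
  have htaylor := eq_add_fracInt_fracInt_deriv_deriv hβ1 hβ2 ht.1 hc'
    (fun s hs ↦ hd s ⟨hs.1, hs.2.trans ht.2⟩) hl' (hi t ht)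
  rw [fracInt_congr ht.1.le fun s hs ↦ caputoNeg_neg_eq_fracInt hs.1.le]
  simpa only [neg_zero, neg_mul, ← sub_eq_add_neg] using htaylor

lemma deriv_add_const_mul (c : ℝ) (hf : DifferentiableAt ℝ f y) (hg : DifferentiableAt ℝ g y) :
    deriv (fun z ↦ f z + c * g z) y = deriv f y + c * deriv g y :=
  (hf.hasDerivAt.add (hg.hasDerivAt.const_mul c)).deriv

lemma hasDerivAt_deriv_add_const_mul {U : Set ℝ} (hU : IsOpen U) (c : ℝ)
    (hf : ∀ z ∈ U, DifferentiableAt ℝ f z ∧ DifferentiableAt ℝ (deriv f) z)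
    (hg : ∀ z ∈ U, DifferentiableAt ℝ g z ∧ DifferentiableAt ℝ (deriv g) z) (hy : y ∈ U) :
    HasDerivAt (deriv fun z ↦ f z + c * g z) (deriv (deriv f) y + c * deriv (deriv g) y) y := by
  refine ((hf y hy).2.hasDerivAt.add ((hg y hy).2.hasDerivAt.const_mul c)).congr_of_eventuallyEq ?_
  filter_upwards [hU.mem_nhds hy] with z hz using deriv_add_const_mul c (hf z hz).1 (hg z hz).1

lemma CaputoPosExists.deriv_add_const_mul (hf : CaputoPosExists α b f)
    (hg : CaputoPosExists α b g) (c : ℝ) (hy : y ∈ Ioo 0 b) :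
    EqOn (fun z ↦ deriv f z + c * deriv g z) (deriv fun z ↦ f z + c * g z) (Ioo 0 y) :=
  fun z hz ↦ (ProblemD.deriv_add_const_mul c (hf.1 z ⟨hz.1, hz.2.trans hy.2⟩)
    (hg.1 z ⟨hz.1, hz.2.trans hy.2⟩)).symm

lemma CaputoPosExists.add_const_mul (hf : CaputoPosExists α b f) (hg : CaputoPosExists α b g)
    (hα : α < 1) (c : ℝ) : CaputoPosExists α b fun y ↦ f y + c * g y := by
  obtain ⟨hfd, hfi⟩ := (caputoPosExists_iff hα).1 hf
  obtain ⟨hgd, hgi⟩ := (caputoPosExists_iff hα).1 hg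
  exact (caputoPosExists_iff hα).2 ⟨fun t ht ↦ (hfd t ht).add ((hgd t ht).const_mul c),
    fun t ht ↦ ((hfi t ht).add ((hgi t ht).const_mul c)).congr ht.1.le
      (hf.deriv_add_const_mul hg c ht)⟩

lemma CaputoPosExists.caputoPos_add_const_mul (hf : CaputoPosExists α b f)
    (hg : CaputoPosExists α b g) (hα : α < 1) (c : ℝ) (hy : y ∈ Ioo 0 b) :
    caputoPos α (fun y ↦ f y + c * g y) y = caputoPos α f y + c * caputoPos α g y := by
  have hfi := ((caputoPosExists_iff hα).1 hf).2 y hy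
  have hgi := ((caputoPosExists_iff hα).1 hg).2 y hy
  simp only [caputoPos_eq_fracInt hy.1.le]
  rw [← fracInt_congr hy.1.le (hf.deriv_add_const_mul hg c hy), fracInt_add hfi (hgi.const_mul c),
    fracInt_const_mul]

lemma CaputoNegExists.deriv_deriv_add_const_mul (hf : CaputoNegExists β a f)
    (hg : CaputoNegExists β a g) (hβ : β < 2) (c : ℝ) (ht : t ∈ Ioo 0 a) :
    EqOn (fun s ↦ deriv (deriv fun s ↦ f (-s)) s + c * deriv (deriv fun s ↦ g (-s)) s)
      (deriv (deriv fun s ↦ f (-s) + c * g (-s))) (Ioo 0 t) :=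
  fun _ hs ↦ (hasDerivAt_deriv_add_const_mul isOpen_Ioo c ((caputoNegExists_iff hβ).1 hf).1
    ((caputoNegExists_iff hβ).1 hg).1 ⟨hs.1, hs.2.trans ht.2⟩).deriv.symm

lemma CaputoNegExists.add_const_mul (hf : CaputoNegExists β a f) (hg : CaputoNegExists β a g)
    (hβ : β < 2) (c : ℝ) : CaputoNegExists β a fun y ↦ f y + c * g y := by
  obtain ⟨hfd, hfi⟩ := (caputoNegExists_iff hβ).1 hf
  obtain ⟨hgd, hgi⟩ := (caputoNegExists_iff hβ).1 hg
  exact (caputoNegExists_iff hβ).2 ⟨fun t ht ↦ ⟨(hfd t ht).1.add ((hgd t ht).1.const_mul c),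
      (hasDerivAt_deriv_add_const_mul isOpen_Ioo c hfd hgd ht).differentiableAt⟩,
    fun t ht ↦ ((hfi t ht).add ((hgi t ht).const_mul c)).congr ht.1.le
      (hf.deriv_deriv_add_const_mul hg hβ c ht)⟩

lemma CaputoNegExists.caputoNeg_add_const_mul (hf : CaputoNegExists β a f)
    (hg : CaputoNegExists β a g) (hβ : β < 2) (c : ℝ) (hy : y ∈ Ioo (-a) 0) :
    caputoNeg β (fun y ↦ f y + c * g y) y = caputoNeg β f y + c * caputoNeg β g y := by
  revert y
  rw [forall_mem_Ioo_neg_zero_iff]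
  intro t ht
  have hfi := ((caputoNegExists_iff hβ).1 hf).2 t ht
  have hgi := ((caputoNegExists_iff hβ).1 hg).2 t ht
  simp only [caputoNeg_neg_eq_fracInt ht.1.le]
  rw [← fracInt_congr ht.1.le (hf.deriv_deriv_add_const_mul hg hβ c ht),
    fracInt_add hfi (hgi.const_mul c), fracInt_const_mul]

end Caputo

section Profile

variable {θ α β lam A a b y t : ℝ}

lemma fracIntegrable_deriv_mlSolution (hθ0 : 0 < θ) (hθ1 : θ < 1) (ht : 0 < t) (c A : ℝ) :
    FracIntegrable (1 - θ) (deriv (mlSolution θ c A 0)) t := by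
  refine (((fracIntegrable_mlKernel (sub_pos.2 hθ1) hθ0 hθ0 ht c).const_mul c).const_mul A).congr
    ht.le fun s hs ↦ ?_
  rw [(hasDerivAt_mlSolution hθ0 hs.1 c A 0).deriv, zero_mul, add_zero]

lemma fracInt_deriv_mlSolution (hθ0 : 0 < θ) (hθ1 : θ < 1) (ht : 0 < t) (c A : ℝ) :
    fracInt (1 - θ) (deriv (mlSolution θ c A 0)) t = c * mlSolution θ c A 0 t := by
  have hderiv : EqOn (deriv (mlSolution θ c A 0)) (fun s ↦ A * (c * mlKernel θ θ c s)) (Ioo 0 t) :=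
    fun s hs ↦ by rw [(hasDerivAt_mlSolution hθ0 hs.1 c A 0).deriv, zero_mul, add_zero]
  rw [fracInt_congr ht.le hderiv, fracInt_const_mul, fracInt_const_mul,
    fracInt_mlKernel (sub_pos.2 hθ1) hθ0 hθ0 ht, add_sub_cancel, mlSolution]
  ring

lemma eqOn_deriv_deriv_mlSolution (hθ : 1 < θ) (c A B : ℝ) :
    EqOn (fun t ↦ A * (c * mlKernel θ (θ - 1) c t) + B * (c * mlKernel θ θ c t))
      (deriv (deriv (mlSolution θ c A B))) (Ioi 0) :=
  fun _ ht ↦ (hasDerivAt_deriv_mlSolution hθ ht c A B).deriv.symm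

lemma fracIntegrable_deriv_deriv_mlSolution (hθ1 : 1 < θ) (hθ2 : θ < 2) (ht : 0 < t)
    (c A B : ℝ) : FracIntegrable (2 - θ) (deriv (deriv (mlSolution θ c A B))) t := by
  have hθ0 := zero_lt_one.trans hθ1
  have h1 := fracIntegrable_mlKernel (sub_pos.2 hθ2) hθ0 (sub_pos.2 hθ1) ht c
  have h2 := fracIntegrable_mlKernel (sub_pos.2 hθ2) hθ0 hθ0 ht c
  exact (((h1.const_mul c).const_mul A).add ((h2.const_mul c).const_mul B)).congr ht.le
    ((eqOn_deriv_deriv_mlSolution hθ1 c A B).mono Ioo_subset_Ioi_self)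

lemma fracInt_deriv_deriv_mlSolution (hθ1 : 1 < θ) (hθ2 : θ < 2) (ht : 0 < t) (c A B : ℝ) :
    fracInt (2 - θ) (deriv (deriv (mlSolution θ c A B))) t = c * mlSolution θ c A B t := by
  have hθ0 := zero_lt_one.trans hθ1
  have h1 := fracIntegrable_mlKernel (sub_pos.2 hθ2) hθ0 (sub_pos.2 hθ1) ht c
  have h2 := fracIntegrable_mlKernel (sub_pos.2 hθ2) hθ0 hθ0 ht c
  rw [← fracInt_congr ht.le ((eqOn_deriv_deriv_mlSolution hθ1 c A B).mono Ioo_subset_Ioi_self),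
    fracInt_add ((h1.const_mul c).const_mul A) ((h2.const_mul c).const_mul B)]
  simp only [fracInt_const_mul]
  rw [fracInt_mlKernel (sub_pos.2 hθ2) hθ0 (sub_pos.2 hθ1) ht,
    fracInt_mlKernel (sub_pos.2 hθ2) hθ0 hθ0 ht, show θ - 1 + (2 - θ) = 1 by ring, add_sub_cancel,
    mlSolution]
  ring

/-- The `y`-factor, with value `A` at `0`, of the separated solutions belonging to the
eigenvalue `lam`. The two gluing conditions determine the branch on `y < 0` from the one on
`0 ≤ y`. -/
def profile (α β lam A y : ℝ) : ℝ :=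
  if 0 ≤ y then mlSolution α (-lam) A 0 y else mlSolution β (-lam) A (lam * A) (-y)

lemma profile_of_nonneg (hy : 0 ≤ y) : profile α β lam A y = mlSolution α (-lam) A 0 y :=
  if_pos hy

lemma profile_neg_of_pos (ht : 0 < t) :
    profile α β lam A (-t) = mlSolution β (-lam) A (lam * A) t := by
  rw [profile, if_neg (by linarith), neg_neg]

lemma profile_zero (hα : 0 < α) : profile α β lam A 0 = A := by
  rw [profile_of_nonneg le_rfl, mlSolution_zero hα]

lemma profile_eq_mul (α β lam A y : ℝ) : profile α β lam A y = A * profile α β lam 1 y := by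
  simp only [profile, mul_ite, ← mlSolution_const_mul]
  ring_nf

lemma continuous_profile (hα : 0 < α) (hβ : 0 < β) (lam A : ℝ) :
    Continuous (profile α β lam A) := by
  refine continuous_if_le continuous_const continuous_id (continuousOn_mlSolution hα _ _ _)
    ((continuousOn_mlSolution hβ _ _ _).comp continuousOn_neg
      fun y hy ↦ (neg_nonneg.2 hy : (0 : ℝ) ≤ -y)) ?_
  rintro y rfl
  rw [mlSolution_zero hα, neg_zero, mlSolution_zero hβ]

lemma profile_sub_profile_neg (hα : 0 < α) (hβ : 0 < β) (ha : 0 < a) (hb : 0 < b) (lam A : ℝ) :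
    profile α β lam A b - profile α β lam A (-a) = A * Delta α β a b lam := by
  rw [profile_of_nonneg hb.le, profile_neg_of_pos ha, mlSolution_eq hα.le hb.le,
    mlSolution_eq hβ.le ha.le, Delta]
  ring

lemma eqOn_profile (α β lam A : ℝ) :
    EqOn (profile α β lam A) (mlSolution α (-lam) A 0) (Ioi 0) :=
  fun _ hy ↦ profile_of_nonneg (le_of_lt hy)

lemma eqOn_profile_neg (α β lam A : ℝ) :
    EqOn (fun t ↦ profile α β lam A (-t)) (mlSolution β (-lam) A (lam * A)) (Ioi 0) :=
  fun _ ht ↦ profile_neg_of_pos ht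

lemma caputoPosExists_profile (hα0 : 0 < α) (hα1 : α < 1) (b β lam A : ℝ) :
    CaputoPosExists α b (profile α β lam A) := by
  have heq := eqOn_profile α β lam A
  refine (caputoPosExists_iff hα1).2 ⟨fun t ht ↦ ?_, fun t ht ↦ ?_⟩
  · exact ((hasDerivAt_mlSolution hα0 ht.1 _ _ _).congr_of_eventuallyEq
      (heq.eventuallyEq_of_mem (Ioi_mem_nhds ht.1))).differentiableAt
  · exact (fracIntegrable_deriv_mlSolution hα0 hα1 ht.1 _ _).congr ht.1.le
      ((heq.symm.deriv isOpen_Ioi).mono Ioo_subset_Ioi_self)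

lemma caputoPos_profile (hα0 : 0 < α) (hα1 : α < 1) (hy : 0 < y) (β lam A : ℝ) :
    caputoPos α (profile α β lam A) y = -lam * profile α β lam A y := by
  rw [caputoPos_eq_fracInt hy.le, profile_of_nonneg hy.le,
    ← fracInt_deriv_mlSolution hα0 hα1 hy]
  exact fracInt_congr hy.le (((eqOn_profile α β lam A).deriv isOpen_Ioi).mono Ioo_subset_Ioi_self)

lemma caputoNegExists_profile (hβ1 : 1 < β) (hβ2 : β < 2) (a α lam A : ℝ) :
    CaputoNegExists β a (profile α β lam A) := by
  have hβ0 := zero_lt_one.trans hβ1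
  have heq := eqOn_profile_neg α β lam A
  have heq' := heq.deriv isOpen_Ioi
  refine (caputoNegExists_iff hβ2).2 ⟨fun t ht ↦ ⟨?_, ?_⟩, fun t ht ↦ ?_⟩
  · exact ((hasDerivAt_mlSolution hβ0 ht.1 _ _ _).congr_of_eventuallyEq
      (heq.eventuallyEq_of_mem (Ioi_mem_nhds ht.1))).differentiableAt
  · exact ((hasDerivAt_deriv_mlSolution hβ1 ht.1 _ _ _).congr_of_eventuallyEq
      (heq'.eventuallyEq_of_mem (Ioi_mem_nhds ht.1))).differentiableAt
  · exact (fracIntegrable_deriv_deriv_mlSolution hβ1 hβ2 ht.1 _ _ _).congr ht.1.le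
      ((heq'.symm.deriv isOpen_Ioi).mono Ioo_subset_Ioi_self)

lemma caputoNeg_profile (hβ1 : 1 < β) (hβ2 : β < 2) (hy : y < 0) (α lam A : ℝ) :
    caputoNeg β (profile α β lam A) y = -lam * profile α β lam A y := by
  obtain ⟨t, rfl⟩ : ∃ t, y = -t := ⟨-y, (neg_neg y).symm⟩
  have ht : 0 < t := neg_lt_zero.1 hy
  rw [caputoNeg_neg_eq_fracInt ht.le, profile_neg_of_pos ht,
    ← fracInt_deriv_deriv_mlSolution hβ1 hβ2 ht]
  exact fracInt_congr ht.le ((((eqOn_profile_neg α β lam A).deriv isOpen_Ioi).deriv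
    isOpen_Ioi).mono Ioo_subset_Ioi_self)

lemma tendsto_caputoPos_profile (hα0 : 0 < α) (hα1 : α < 1) (hβ : 0 < β) (lam A : ℝ) :
    Tendsto (caputoPos α (profile α β lam A)) (𝓝[>] 0) (𝓝 (-lam * A)) := by
  have hlim := ((continuous_profile hα0 hβ lam A).const_mul (-lam)).tendsto 0
  rw [profile_zero hα0] at hlim
  refine (hlim.mono_left nhdsWithin_le_nhds).congr' ?_
  filter_upwards [self_mem_nhdsWithin] with y hy using (caputoPos_profile hα0 hα1 hy β lam A).symm

lemma tendsto_deriv_profile (hβ : 1 < β) (α lam A : ℝ) :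
    Tendsto (deriv (profile α β lam A)) (𝓝[<] 0) (𝓝 (-lam * A)) := by
  have hneg : Tendsto (fun y : ℝ ↦ -y) (𝓝[<] 0) (𝓝[>] 0) := by
    simpa using tendsto_neg_nhdsLT (a := (0 : ℝ))
  rw [neg_mul]
  refine ((tendsto_deriv_mlSolution hβ (-lam) A (lam * A)).comp hneg).neg.congr' ?_
  filter_upwards [self_mem_nhdsWithin] with y hy
  have hderiv := (eqOn_profile_neg α β lam A).deriv isOpen_Ioi (neg_pos.2 (mem_Iio.1 hy) : 0 < -y)
  rw [deriv_comp_neg, neg_neg] at hderiv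
  rw [Function.comp_apply, ← hderiv, neg_neg]

end Profile

/-! ### Solutions and eigenfunctions -/

lemma hasDerivAt_iteratedDerivWithin {n j : ℕ} {f : ℝ → ℝ}
    (hf : ContDiffOn ℝ ((n - 1 : ℕ) : WithTop ℕ∞) f (Icc 0 1))
    (hd : DifferentiableOn ℝ (iteratedDerivWithin (n - 1) f (Icc 0 1)) (Ioo 0 1))
    (hj : j < n) {x : ℝ} (hx : x ∈ Ioo (0 : ℝ) 1) :
    HasDerivAt (iteratedDerivWithin j f (Icc 0 1)) (iteratedDerivWithin (j + 1) f (Icc 0 1) x)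
      x := by
  have hdiff : DifferentiableAt ℝ (iteratedDerivWithin j f (Icc 0 1)) x := by
    rcases (Nat.le_sub_one_of_lt hj).eq_or_lt with rfl | hlt
    · exact hd.differentiableAt (isOpen_Ioo.mem_nhds hx)
    · exact (hf.differentiableOn_iteratedDerivWithin (by exact_mod_cast hlt)
        (uniqueDiffOn_Icc one_pos)).differentiableAt (Icc_mem_nhds hx.1 hx.2)
  rw [iteratedDerivWithin_succ, derivWithin_of_mem_nhds (Icc_mem_nhds hx.1 hx.2)]
  exact hdiff.hasDerivAt

lemma iteratedDerivWithin_Icc_eq (j : ℕ) (f : ℝ → ℝ) {x : ℝ} (hx : x ∈ Ioo (0 : ℝ) 1) :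
    iteratedDerivWithin j f (Icc 0 1) x = iteratedDeriv j f x := by
  rw [iteratedDerivWithin, iteratedDeriv,
    iteratedFDerivWithin_congr_set (eventuallyEq_univ.2 (Icc_mem_nhds hx.1 hx.2)),
    iteratedFDerivWithin_univ]

lemma tendsto_caputoPos_of_eqOn_zero {b : ℝ} {f : ℝ → ℝ} (hb : 0 < b) (hf : EqOn f 0 (Ioo 0 b))
    (α : ℝ) : Tendsto (caputoPos α f) (𝓝[>] 0) (𝓝 0) := by
  refine tendsto_const_nhds.congr' ?_
  filter_upwards [Ioo_mem_nhdsGT hb] with y hy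
  have hderiv : EqOn (deriv f) (fun _ ↦ 0) (Ioo 0 y) := fun z hz ↦ by
    rw [hf.deriv isOpen_Ioo ⟨hz.1, hz.2.trans hy.2⟩, deriv_zero]
    rfl
  rw [caputoPos_eq_fracInt hy.1.le, fracInt_congr hy.1.le hderiv]
  simp [fracInt]

lemma tendsto_deriv_of_eqOn_zero {a : ℝ} {f : ℝ → ℝ} (ha : 0 < a) (hf : EqOn f 0 (Ioo (-a) 0)) :
    Tendsto (deriv f) (𝓝[<] 0) (𝓝 0) := by
  refine tendsto_const_nhds.congr' ?_
  filter_upwards [Ioo_mem_nhdsLT (neg_lt_zero.2 ha)] with y hy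
  rw [hf.deriv isOpen_Ioo hy, deriv_zero]
  rfl

lemma exists_gluing_deriv_of_interior {k : ℕ} {α a b : ℝ} {u : ℝ → ℝ → ℝ} (hk : 1 ≤ k)
    (ha : 0 < a) (hb : 0 < b)
    (hbd : ∀ j < k, ∀ y ∈ Icc (-a) b, dx j u 0 y = 0 ∧ dx j u 1 y = 0)
    (hint : ∀ x ∈ Ioo (0 : ℝ) 1, ∃ l : ℝ,
      Tendsto (caputoPos α (u x)) (𝓝[>] 0) (𝓝 l) ∧ Tendsto (deriv (u x)) (𝓝[<] 0) (𝓝 l))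
    {x : ℝ} (hx : x ∈ Icc (0 : ℝ) 1) : ∃ l : ℝ,
      Tendsto (caputoPos α (u x)) (𝓝[>] 0) (𝓝 l) ∧ Tendsto (deriv (u x)) (𝓝[<] 0) (𝓝 l) := by
  rcases Set.eq_endpoints_or_mem_Ioo_of_mem_Icc hx with hx01 | hx01 | hx01
  on_goal 3 => exact hint x hx01
  all_goals
    have hzero : ∀ y ∈ Icc (-a) b, u x y = 0 := fun y hy ↦ by
      have := hbd 0 hk y hy
      simp_all [dx]
    exact ⟨0, tendsto_caputoPos_of_eqOn_zero hb
        (fun y hy ↦ hzero y ⟨by linarith [hy.1], hy.2.le⟩) α,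
      tendsto_deriv_of_eqOn_zero ha fun y hy ↦ hzero y ⟨hy.1.le, by linarith [hy.2]⟩⟩

namespace IsSolution

variable {k : ℕ} {m α β a b : ℝ} {φ ψ : ℝ → ℝ} {u v : ℝ → ℝ → ℝ}

lemma hasDerivAt_dx (hu : IsSolution k m α β a b φ u) {j : ℕ} (hj : j < 2 * k) {x y : ℝ}
    (hx : x ∈ Ioo (0 : ℝ) 1) (hy : y ∈ Icc (-a) b) :
    HasDerivAt (fun s ↦ dx j u s y) (dx (j + 1) u x y) x :=
  hasDerivAt_iteratedDerivWithin (hu.contDiff_x y hy) (hu.differentiable_dx y hy) hj hx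

lemma dx_add_const_mul (hu : IsSolution k m α β a b φ u) (hv : IsSolution k m α β a b ψ v)
    (c : ℝ) {j : ℕ} (hj : j ≤ 2 * k - 1) {x y : ℝ} (hx : x ∈ Icc (0 : ℝ) 1)
    (hy : y ∈ Icc (-a) b) :
    dx j (fun x y ↦ u x y + c * v x y) x y = dx j u x y + c * dx j v x y := by
  have hj' : (j : WithTop ℕ∞) ≤ ((2 * k - 1 : ℕ) : WithTop ℕ∞) := by exact_mod_cast hj
  have hcu := ((hu.contDiff_x y hy).of_le hj') x hx
  have hcv := ((hv.contDiff_x y hy).of_le hj') x hx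
  simp only [dx]
  rw [iteratedDerivWithin_fun_add hx (uniqueDiffOn_Icc one_pos) hcu
    (contDiffWithinAt_const.mul hcv), iteratedDerivWithin_const_mul_field]

lemma hasDerivAt_dx_add_const_mul (hu : IsSolution k m α β a b φ u)
    (hv : IsSolution k m α β a b ψ v) (hk : 1 ≤ k) (c : ℝ) {x y : ℝ} (hx : x ∈ Ioo (0 : ℝ) 1)
    (hy : y ∈ Icc (-a) b) :
    HasDerivAt (fun x ↦ dx (2 * k - 1) (fun x y ↦ u x y + c * v x y) x y)
      (dx (2 * k) u x y + c * dx (2 * k) v x y) x := by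
  have hdu := hu.hasDerivAt_dx (j := 2 * k - 1) (by lia) hx hy
  have hdv := hv.hasDerivAt_dx (j := 2 * k - 1) (by lia) hx hy
  rw [show 2 * k - 1 + 1 = 2 * k by lia] at hdu hdv
  refine (hdu.add (hdv.const_mul c)).congr_of_eventuallyEq ?_
  filter_upwards [Icc_mem_nhds hx.1 hx.2] with s hs using hu.dx_add_const_mul hv c le_rfl hs hy

lemma dx_top_add_const_mul (hu : IsSolution k m α β a b φ u) (hv : IsSolution k m α β a b ψ v)
    (hk : 1 ≤ k) (c : ℝ) {x y : ℝ} (hx : x ∈ Ioo (0 : ℝ) 1) (hy : y ∈ Icc (-a) b) :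
    dx (2 * k) (fun x y ↦ u x y + c * v x y) x y = dx (2 * k) u x y + c * dx (2 * k) v x y := by
  obtain ⟨n, hn⟩ : ∃ n, 2 * k = n + 1 := ⟨2 * k - 1, by lia⟩
  have hderiv := hu.hasDerivAt_dx_add_const_mul hv hk c hx hy
  rw [hn, Nat.add_sub_cancel] at hderiv
  rw [hn, ← hderiv.deriv, ← derivWithin_of_mem_nhds (Icc_mem_nhds hx.1 hx.2)]
  simp only [dx, iteratedDerivWithin_succ]

lemma gluing_deriv_add_const_mul (hu : IsSolution k m α β a b φ u)
    (hv : IsSolution k m α β a b ψ v) (hα : α < 1) (ha : 0 < a) (hb : 0 < b) (c : ℝ) {x : ℝ}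
    (hx : x ∈ Ioo (0 : ℝ) 1) : ∃ l : ℝ,
      Tendsto (caputoPos α fun y ↦ u x y + c * v x y) (𝓝[>] 0) (𝓝 l) ∧
      Tendsto (deriv fun y ↦ u x y + c * v x y) (𝓝[<] 0) (𝓝 l) := by
  obtain ⟨l, hlu, hlu'⟩ := hu.gluing_deriv x (Ioo_subset_Icc_self hx)
  obtain ⟨l', hlv, hlv'⟩ := hv.gluing_deriv x (Ioo_subset_Icc_self hx)
  refine ⟨l + c * l', (hlu.add (hlv.const_mul c)).congr' ?_,
    (hlu'.add (hlv'.const_mul c)).congr' ?_⟩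
  · filter_upwards [Ioo_mem_nhdsGT hb] with y hy
    exact ((hu.caputoPos_exists x hx).caputoPos_add_const_mul (hv.caputoPos_exists x hx) hα c
      hy).symm
  · filter_upwards [Ioo_mem_nhdsLT (neg_lt_zero.2 ha)] with y hy
    exact (deriv_add_const_mul c ((hu.caputoNeg_exists x hx).1 y hy).1
      ((hv.caputoNeg_exists x hx).1 y hy).1).symm

lemma boundary_add_const_mul (hu : IsSolution k m α β a b φ u) (hv : IsSolution k m α β a b ψ v)
    (c : ℝ) {j : ℕ} (hj : j < k) {y : ℝ} (hy : y ∈ Icc (-a) b) :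
    dx j (fun x y ↦ u x y + c * v x y) 0 y = 0 ∧
      dx j (fun x y ↦ u x y + c * v x y) 1 y = 0 := by
  rw [hu.dx_add_const_mul hv c (by lia) (left_mem_Icc.2 zero_le_one) hy,
    hu.dx_add_const_mul hv c (by lia) (right_mem_Icc.2 zero_le_one) hy,
    (hu.boundary j hj y hy).1, (hu.boundary j hj y hy).2,
    (hv.boundary j hj y hy).1, (hv.boundary j hj y hy).2, mul_zero, add_zero]
  exact ⟨rfl, rfl⟩

lemma memLp_dx_top_add_const_mul (hu : IsSolution k m α β a b φ u)
    (hv : IsSolution k m α β a b ψ v) (hk : 1 ≤ k) (c : ℝ) {y : ℝ} (hy : y ∈ Icc (-a) b) :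
    MemLp (fun x ↦ x ^ (m / 2) * dx (2 * k) (fun x y ↦ u x y + c * v x y) x y) 2
      (volume.restrict (Ioo 0 1)) := by
  refine ((hu.memLp_dx_top y hy).add ((hv.memLp_dx_top y hy).const_mul c)).ae_eq ?_
  filter_upwards [ae_restrict_mem measurableSet_Ioo] with x hx
  rw [hu.dx_top_add_const_mul hv hk c hx hy, Pi.add_apply]
  ring

lemma add_const_mul (hu : IsSolution k m α β a b φ u) (hv : IsSolution k m α β a b ψ v)
    (hk : 1 ≤ k) (hα : α < 1) (hβ : β < 2) (ha : 0 < a) (hb : 0 < b) (c : ℝ) :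
    IsSolution k m α β a b (fun x ↦ φ x + c * ψ x) (fun x y ↦ u x y + c * v x y) := by
  have hpos := fun x hx y ↦
    (hu.caputoPos_exists x hx).caputoPos_add_const_mul (y := y) (hv.caputoPos_exists x hx) hα c
  have hneg := fun x hx y ↦
    (hu.caputoNeg_exists x hx).caputoNeg_add_const_mul (y := y) (hv.caputoNeg_exists x hx) hβ c
  exact {
    contDiff_x := fun y hy ↦ (hu.contDiff_x y hy).add (contDiffOn_const.mul (hv.contDiff_x y hy))
    continuous_dx := fun j hj ↦ ((hu.continuous_dx j hj).add
      ((hv.continuous_dx j hj).const_mul c)).congr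
        fun p hp ↦ hu.dx_add_const_mul hv c hj hp.1 hp.2
    differentiable_dx := fun y hy x hx ↦
      (hu.hasDerivAt_dx_add_const_mul hv hk c hx hy).differentiableAt.differentiableWithinAt
    continuous_dx_top := (hu.continuous_dx_top.add (hv.continuous_dx_top.const_mul c)).congr
      fun p hp ↦ hu.dx_top_add_const_mul hv hk c hp.1 (Ioo_subset_Icc_self hp.2)
    memLp_dx_top := fun y hy ↦ hu.memLp_dx_top_add_const_mul hv hk c hy
    caputoPos_exists := fun x hx ↦
      (hu.caputoPos_exists x hx).add_const_mul (hv.caputoPos_exists x hx) hα c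
    caputoNeg_exists := fun x hx ↦
      (hu.caputoNeg_exists x hx).add_const_mul (hv.caputoNeg_exists x hx) hβ c
    continuous_caputoPos := (hu.continuous_caputoPos.add
      (hv.continuous_caputoPos.const_mul c)).congr fun p hp ↦ hpos p.1 hp.1 p.2 hp.2
    continuous_caputoNeg := (hu.continuous_caputoNeg.add
      (hv.continuous_caputoNeg.const_mul c)).congr fun p hp ↦ hneg p.1 hp.1 p.2 hp.2
    eq_pos := fun x hx y hy ↦ by
      rw [hpos x hx y hy, hu.dx_top_add_const_mul hv hk c hx ⟨by linarith [hy.1], hy.2.le⟩]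
      linear_combination hu.eq_pos x hx y hy + c * hv.eq_pos x hx y hy
    eq_neg := fun x hx y hy ↦ by
      rw [hneg x hx y hy, hu.dx_top_add_const_mul hv hk c hx ⟨hy.1.le, by linarith [hy.2]⟩]
      linear_combination hu.eq_neg x hx y hy + c * hv.eq_neg x hx y hy
    boundary := fun j hj y hy ↦ hu.boundary_add_const_mul hv c hj hy
    gluing := fun x hx ↦ by
      obtain ⟨l, hlu, hlu'⟩ := hu.gluing x hx
      obtain ⟨l', hlv, hlv'⟩ := hv.gluing x hx
      exact ⟨l + c * l', hlu.add (hlv.const_mul c), hlu'.add (hlv'.const_mul c)⟩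
    gluing_deriv := fun x hx ↦ exists_gluing_deriv_of_interior hk ha hb
      (fun j hj y hy ↦ hu.boundary_add_const_mul hv c hj hy)
      (fun _ hx ↦ hu.gluing_deriv_add_const_mul hv hα ha hb c hx) hx
    nonlocal := fun x hx ↦ by
      linear_combination hu.nonlocal x hx + c * hv.nonlocal x hx }

end IsSolution

/-- `X` solves the eigenvalue problem with parameter `lam`; unlike in `IsEigenvalue`, `X` may
vanish identically. -/
structure IsEigenfunction (k : ℕ) (m lam : ℝ) (X : ℝ → ℝ) : Prop where
  contDiff_Icc : ContDiffOn ℝ ((2 * k - 1 : ℕ) : WithTop ℕ∞) X (Icc 0 1)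
  contDiff_Ioo : ContDiffOn ℝ ((2 * k : ℕ) : WithTop ℕ∞) X (Ioo 0 1)
  eq : ∀ x ∈ Ioo (0 : ℝ) 1, iteratedDeriv (2 * k) X x = (-1) ^ k * lam * x ^ (-m) * X x
  boundary : ∀ j < k, iteratedDerivWithin j X (Icc 0 1) 0 = 0 ∧
    iteratedDerivWithin j X (Icc 0 1) 1 = 0

lemma isEigenvalue_iff {k : ℕ} {m lam : ℝ} :
    IsEigenvalue k m lam ↔ ∃ X, IsEigenfunction k m lam X ∧ ∃ x ∈ Ioo (0 : ℝ) 1, X x ≠ 0 :=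
  ⟨fun ⟨X, h1, h2, h3, h4, hX⟩ ↦ ⟨X, ⟨h1, h2, h3, h4⟩, hX⟩,
    fun ⟨X, ⟨h1, h2, h3, h4⟩, hX⟩ ↦ ⟨X, h1, h2, h3, h4, hX⟩⟩

namespace IsEigenfunction

variable {k : ℕ} {m lam : ℝ} {X : ℝ → ℝ}

lemma continuousOn (hX : IsEigenfunction k m lam X) : ContinuousOn X (Icc 0 1) :=
  hX.contDiff_Icc.continuousOn

lemma differentiableOn_top (hX : IsEigenfunction k m lam X) (hk : 1 ≤ k) :
    DifferentiableOn ℝ (iteratedDerivWithin (2 * k - 1) X (Icc 0 1)) (Ioo 0 1) := by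
  refine (hX.contDiff_Ioo.differentiableOn_iteratedDerivWithin (m := 2 * k - 1)
    (by exact_mod_cast (by lia : 2 * k - 1 < 2 * k)) isOpen_Ioo.uniqueDiffOn).congr fun x hx ↦ ?_
  rw [iteratedDerivWithin_Icc_eq _ _ hx, iteratedDerivWithin_of_isOpen isOpen_Ioo hx]

lemma iteratedDerivWithin_top (hX : IsEigenfunction k m lam X) {x : ℝ}
    (hx : x ∈ Ioo (0 : ℝ) 1) :
    iteratedDerivWithin (2 * k) X (Icc 0 1) x = (-1) ^ k * lam * x ^ (-m) * X x := by
  rw [iteratedDerivWithin_Icc_eq _ _ hx, hX.eq x hx]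

lemma exists_abs_le_mul_pow (hX : IsEigenfunction k m lam X) (hk : 1 ≤ k) :
    ∃ C, 0 ≤ C ∧ ∀ x ∈ Icc (0 : ℝ) 1, |X x| ≤ C * x ^ k := by
  obtain ⟨n, rfl⟩ := Nat.exists_eq_add_of_le' hk
  obtain ⟨C, hC⟩ := exists_taylor_mean_remainder_bound (n := n) (zero_le_one' ℝ)
    (hX.contDiff_Icc.of_le (by exact_mod_cast (by lia : n + 1 ≤ 2 * (n + 1) - 1)))
  have htaylor (x : ℝ) : taylorWithinEval X n (Icc 0 1) 0 x = 0 := by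
    rw [taylor_within_apply]
    refine Finset.sum_eq_zero fun j hj ↦ ?_
    rw [(hX.boundary j (Finset.mem_range.1 hj)).1, smul_zero]
  refine ⟨|C|, abs_nonneg C, fun x hx ↦ ?_⟩
  have hrem := hC x hx
  rw [htaylor, sub_zero, sub_zero, Real.norm_eq_abs] at hrem
  exact hrem.trans (mul_le_mul_of_nonneg_right (le_abs_self C) (pow_nonneg hx.1 _))

lemma exists_abs_rpow_mul_le (hX : IsEigenfunction k m lam X) (hk : 1 ≤ k) {p : ℝ} (hp : p ≤ k) :
    ∃ C, ∀ x ∈ Ioo (0 : ℝ) 1, |x ^ (-p) * X x| ≤ C := by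
  obtain ⟨C, hC0, hC⟩ := hX.exists_abs_le_mul_pow hk
  refine ⟨C, fun x hx ↦ ?_⟩
  have hpow := Real.rpow_nonneg hx.1.le (-p)
  calc |x ^ (-p) * X x| = x ^ (-p) * |X x| := by rw [abs_mul, abs_of_nonneg hpow]
    _ ≤ x ^ (-p) * (C * x ^ k) := by gcongr; exact hC x (Ioo_subset_Icc_self hx)
    _ = C * x ^ (-p + k) := by rw [Real.rpow_add hx.1, Real.rpow_natCast]; ring
    _ ≤ C := mul_le_of_le_one_right hC0 (Real.rpow_le_one hx.1.le hx.2.le (by linarith))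

lemma continuousOn_rpow_mul (hX : IsEigenfunction k m lam X) (p : ℝ) :
    ContinuousOn (fun x ↦ x ^ p * X x) (Ioo 0 1) :=
  (continuousOn_id.rpow_const fun _ hx ↦ Or.inl (ne_of_gt hx.1)).mul
    (hX.continuousOn.mono Ioo_subset_Icc_self)

lemma continuousOn_iteratedDerivWithin_top (hX : IsEigenfunction k m lam X) :
    ContinuousOn (iteratedDerivWithin (2 * k) X (Icc 0 1)) (Ioo 0 1) :=
  ((hX.continuousOn_rpow_mul (-m)).const_mul ((-1) ^ k * lam)).congr fun x hx ↦ by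
    rw [hX.iteratedDerivWithin_top hx]
    ring

lemma memLp_rpow_mul (hX : IsEigenfunction k m lam X) (hk : 1 ≤ k) (hm : m / 2 ≤ k) :
    MemLp (fun x ↦ x ^ (m / 2) * iteratedDerivWithin (2 * k) X (Icc 0 1) x) 2
      (volume.restrict (Ioo 0 1)) := by
  obtain ⟨C, hC⟩ := hX.exists_abs_rpow_mul_le hk hm
  have hweighted : MemLp (fun x ↦ x ^ (-(m / 2)) * X x) 2 (volume.restrict (Ioo (0 : ℝ) 1)) := by
    refine .of_bound ((hX.continuousOn_rpow_mul _).aestronglyMeasurable measurableSet_Ioo) C ?_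
    filter_upwards [ae_restrict_mem measurableSet_Ioo] with x hx using hC x hx
  refine (hweighted.const_mul ((-1) ^ k * lam)).ae_eq ?_
  filter_upwards [ae_restrict_mem measurableSet_Ioo] with x hx
  rw [hX.iteratedDerivWithin_top hx, show -(m / 2) = m / 2 + -m by ring, Real.rpow_add hx.1]
  ring

lemma neg_one_pow_mul_rpow_mul (hX : IsEigenfunction k m lam X) {x : ℝ} (hx : x ∈ Ioo (0 : ℝ) 1) :
    (-1) ^ k * x ^ m * iteratedDerivWithin (2 * k) X (Icc 0 1) x = lam * X x := by
  have hsign : ((-1 : ℝ) ^ k) * (-1) ^ k = 1 := by rw [← mul_pow]; simp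
  have hpow : x ^ m * x ^ (-m) = 1 := by rw [← Real.rpow_add hx.1]; simp
  rw [hX.iteratedDerivWithin_top hx]
  linear_combination (lam * X x) * (x ^ m * x ^ (-m) * hsign + hpow)

end IsEigenfunction

section Separated

variable {k : ℕ} {m α β a b lam : ℝ} {X : ℝ → ℝ}

lemma dx_profile (α β lam : ℝ) (X : ℝ → ℝ) (j : ℕ) (x y : ℝ) :
    dx j (fun x ↦ profile α β lam (X x)) x y =
      iteratedDerivWithin j X (Icc 0 1) x * profile α β lam 1 y := by
  simp only [dx, profile_eq_mul α β lam (X _), mul_comm _ (profile α β lam 1 y)]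
  exact iteratedDerivWithin_const_mul_field _ _

lemma continuousOn_mul_profile {f : ℝ → ℝ} {s t : Set ℝ} (hα : 0 < α) (hβ : 0 < β)
    (hf : ContinuousOn f s) (lam : ℝ) :
    ContinuousOn (fun p : ℝ × ℝ ↦ f p.1 * profile α β lam 1 p.2) (s ×ˢ t) :=
  (hf.comp continuousOn_fst fun _ hp ↦ hp.1).mul
    ((continuous_profile hα hβ lam 1).comp continuous_snd).continuousOn

lemma IsEigenfunction.profile_add_dx (hX : IsEigenfunction k m lam X) {x : ℝ}
    (hx : x ∈ Ioo (0 : ℝ) 1) (α β y : ℝ) :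
    -lam * profile α β lam (X x) y +
      (-1) ^ k * x ^ m * dx (2 * k) (fun x ↦ profile α β lam (X x)) x y = 0 := by
  rw [dx_profile, profile_eq_mul]
  linear_combination (profile α β lam 1 y) * hX.neg_one_pow_mul_rpow_mul hx

lemma IsEigenfunction.isSolution_profile (hX : IsEigenfunction k m lam X) (hk : 1 ≤ k)
    (hm : m / 2 ≤ k) (hα0 : 0 < α) (hα1 : α < 1) (hβ1 : 1 < β) (hβ2 : β < 2) (ha : 0 < a)
    (hb : 0 < b) (hΔ : Delta α β a b lam = 0) :
    IsSolution k m α β a b (fun _ ↦ 0) (fun x ↦ profile α β lam (X x)) := by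
  have hβ0 := zero_lt_one.trans hβ1
  have hcaputo (t : Set ℝ) : ContinuousOn
      (fun p : ℝ × ℝ ↦ -lam * profile α β lam (X p.1) p.2) (Ioo 0 1 ×ˢ t) := by
    simp only [profile_eq_mul α β lam (X _)]
    exact (continuousOn_mul_profile hα0 hβ0 (hX.continuousOn.mono Ioo_subset_Icc_self)
      lam).const_mul _
  exact {
    contDiff_x := fun y _ ↦ by
      simp only [profile_eq_mul α β lam (X _)]
      exact hX.contDiff_Icc.mul contDiffOn_const
    continuous_dx := fun j hj ↦ by
      simp only [dx_profile]
      exact continuousOn_mul_profile hα0 hβ0 (hX.contDiff_Icc.continuousOn_iteratedDerivWithin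
        (by exact_mod_cast hj) (uniqueDiffOn_Icc one_pos)) lam
    differentiable_dx := fun y _ ↦ by
      simp only [dx_profile]
      exact (hX.differentiableOn_top hk).mul_const _
    continuous_dx_top := by
      simp only [dx_profile]
      exact continuousOn_mul_profile hα0 hβ0 hX.continuousOn_iteratedDerivWithin_top lam
    memLp_dx_top := fun y _ ↦ by
      simp only [dx_profile, ← mul_assoc]
      exact (hX.memLp_rpow_mul hk hm).mul_const _
    caputoPos_exists := fun x _ ↦ caputoPosExists_profile hα0 hα1 b β lam (X x)
    caputoNeg_exists := fun x _ ↦ caputoNegExists_profile hβ1 hβ2 a α lam (X x)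
    continuous_caputoPos := (hcaputo _).congr fun p hp ↦ caputoPos_profile hα0 hα1 hp.2.1 ..
    continuous_caputoNeg := (hcaputo _).congr fun p hp ↦ caputoNeg_profile hβ1 hβ2 hp.2.2 ..
    eq_pos := fun x hx y hy ↦ by
      rw [caputoPos_profile hα0 hα1 hy.1, hX.profile_add_dx hx]
    eq_neg := fun x hx y hy ↦ by
      rw [caputoNeg_profile hβ1 hβ2 hy.2, hX.profile_add_dx hx]
    boundary := fun j hj y _ ↦ by
      simp only [dx_profile, hX.boundary j hj, zero_mul, and_self]
    gluing := fun x _ ↦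
      have hlim := (continuous_profile hα0 hβ0 lam (X x)).tendsto 0
      ⟨_, hlim.mono_left nhdsWithin_le_nhds, hlim.mono_left nhdsWithin_le_nhds⟩
    gluing_deriv := fun x _ ↦
      ⟨-lam * X x, tendsto_caputoPos_profile hα0 hα1 hβ0 lam (X x),
        tendsto_deriv_profile hβ1 α lam (X x)⟩
    nonlocal := fun x _ ↦ by
      rw [profile_sub_profile_neg hα0 hβ0 ha hb, hΔ, mul_zero] }

end Separated

/-! ### Fourier coefficients of solutions -/

section Truncation

variable {μ y p q : ℝ} {h : ℝ → ℝ → ℝ}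

lemma continuousOn_intervalIntegral {K : Set ℝ} (hK : IsCompact K)
    (hh : ContinuousOn (Function.uncurry h) (uIcc p q ×ˢ K)) :
    ContinuousOn (fun z ↦ ∫ x in p..q, h x z) K := by
  obtain ⟨C, hC⟩ := (isCompact_uIcc.prod hK).exists_bound_of_continuousOn hh
  intro z hz
  refine intervalIntegral.continuousWithinAt_of_dominated_interval (bound := fun _ ↦ C)
    ?_ ?_ intervalIntegrable_const ?_
  · filter_upwards [self_mem_nhdsWithin] with w hw
    refine ContinuousOn.aestronglyMeasurable ?_ measurableSet_uIoc
    exact hh.comp (f := fun x ↦ (x, w)) (by fun_prop) fun x hx ↦ ⟨uIoc_subset_uIcc hx, hw⟩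
  · filter_upwards [self_mem_nhdsWithin] with w hw
    exact ae_of_all _ fun x hx ↦ hC (x, w) ⟨uIoc_subset_uIcc hx, hw⟩
  · exact ae_of_all _ fun x hx ↦ hh.comp (f := fun w ↦ (x, w)) (by fun_prop)
      (fun w hw ↦ ⟨uIoc_subset_uIcc hx, hw⟩) z hz

lemma fracInt_intervalIntegral (hμ : 0 < μ) (hy : 0 < y)
    (hh : ContinuousOn (Function.uncurry h) (uIcc p q ×ˢ Icc 0 y)) :
    fracInt μ (fun z ↦ ∫ x in p..q, h x z) y = ∫ x in p..q, fracInt μ (h x) y := by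
  have hkernel : IntegrableOn (fun z ↦ rlKernel μ (y - z)) (uIoc 0 y) := by
    simpa [FracIntegrable, intervalIntegrable_iff] using
      fracIntegrable_of_continuousOn hμ hy (continuousOn_const (c := (1 : ℝ)))
  obtain ⟨C, hC⟩ := (isCompact_uIcc.prod isCompact_Icc).exists_bound_of_continuousOn hh
  have hsub : uIoc p q ×ˢ uIoc 0 y ⊆ uIcc p q ×ˢ Icc 0 y :=
    prod_mono uIoc_subset_uIcc (uIoc_of_le hy.le ▸ Ioc_subset_Icc_self)
  have hmeas : MeasurableSet (uIoc p q ×ˢ uIoc 0 y) := measurableSet_uIoc.prod measurableSet_uIoc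
  have hint : IntegrableOn (Function.uncurry fun x z ↦ rlKernel μ (y - z) * h x z)
      (uIoc p q ×ˢ uIoc 0 y) := by
    rw [IntegrableOn, Measure.volume_eq_prod, ← Measure.prod_restrict]
    have : IsFiniteMeasure (volume.restrict (uIoc p q)) := ⟨by simp [uIoc]⟩
    refine (hkernel.comp_snd (volume.restrict (uIoc p q))).mul_bdd (c := C) ?_ ?_ <;>
      rw [Measure.prod_restrict]
    · exact (hh.mono hsub).aestronglyMeasurable hmeas
    · filter_upwards [ae_restrict_mem hmeas] with w hw using hC w (hsub hw)
  simp only [fracInt, ← intervalIntegral.integral_const_mul]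
  exact (intervalIntegral_intervalIntegral_swap hint).symm

lemma tendsto_fracInt_of_bounded {ι : Type*} {l : Filter ι} [l.IsCountablyGenerated]
    {F : ι → ℝ → ℝ} {f : ℝ → ℝ} {C : ℝ} (hμ : 0 < μ) (hy : 0 < y)
    (hcont : ∀ᶠ i in l, ContinuousOn (F i) (Icc 0 y))
    (hbound : ∀ᶠ i in l, ∀ z ∈ Icc 0 y, |F i z| ≤ C)
    (hlim : ∀ z ∈ Icc 0 y, Tendsto (fun i ↦ F i z) l (𝓝 (f z))) :
    Tendsto (fun i ↦ fracInt μ (F i) y) l (𝓝 (fracInt μ f y)) := by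
  have hmem {z : ℝ} (hz : z ∈ uIoc 0 y) : z ∈ Icc 0 y :=
    Ioc_subset_Icc_self (uIoc_of_le hy.le ▸ hz)
  refine intervalIntegral.tendsto_integral_filter_of_dominated_convergence
    (fun z ↦ rlKernel μ (y - z) * C) ?_ ?_
    (fracIntegrable_of_continuousOn hμ hy continuousOn_const) ?_
  · filter_upwards [hcont] with i hi
    exact (fracIntegrable_of_continuousOn hμ hy hi).def'.aestronglyMeasurable
  · filter_upwards [hbound] with i hi
    refine ae_of_all _ fun z hz ↦ ?_
    have hkernel := rlKernel_nonneg hμ (sub_nonneg.2 (hmem hz).2)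
    rw [Real.norm_eq_abs, abs_mul, abs_of_nonneg hkernel]
    exact mul_le_mul_of_nonneg_left (hi z (hmem hz)) hkernel
  · exact ae_of_all _ fun z hz ↦ (hlim z (hmem hz)).const_mul _

lemma tendsto_one_sub_nhdsGT_zero : Tendsto (fun ε : ℝ ↦ 1 - ε) (𝓝[>] 0) (𝓝[<] 1) := by
  refine tendsto_nhdsWithin_iff.2 ⟨?_, ?_⟩
  · have h : Tendsto (fun ε : ℝ ↦ 1 - ε) (𝓝 0) (𝓝 (1 - 0)) := tendsto_id.const_sub 1
    rw [sub_zero] at h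
    exact h.mono_left nhdsWithin_le_nhds
  · filter_upwards [self_mem_nhdsWithin] with ε (hε : 0 < ε)
    exact sub_lt_self 1 hε

lemma tendsto_intervalIntegral_one_sub {f : ℝ → ℝ} (hf : IntegrableOn f (Ioo 0 1)) :
    Tendsto (fun ε ↦ ∫ x in ε..1 - ε, f x) (𝓝[>] 0) (𝓝 (∫ x in Ioo 0 1, f x)) := by
  have hcover : AECover (volume.restrict (Ioo (0 : ℝ) 1)) (𝓝[>] 0)
      fun ε : ℝ ↦ Ioc ε (1 - ε) :=
    aecover_Ioo_of_Ioc (tendsto_nhdsWithin_of_tendsto_nhds tendsto_id)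
      (tendsto_one_sub_nhdsGT_zero.mono_right nhdsWithin_le_nhds)
  refine (hcover.integral_tendsto_of_countably_generated hf).congr' ?_
  filter_upwards [Ioo_mem_nhdsGT (by norm_num : (0 : ℝ) < 1 / 2)] with ε hε
  rw [intervalIntegral.integral_of_le (by linarith [hε.2]), Measure.restrict_restrict
    measurableSet_Ioc, inter_eq_self_of_subset_left]
  exact fun x hx ↦ ⟨hε.1.trans hx.1, hx.2.trans_lt (by linarith [hε.1])⟩

end Truncation

section Concomitant

/-- The Lagrange bilinear concomitant of order `n` of two families `p`, `q`, where `p j` and `q j`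
play the role of the `j`-th derivatives of `p 0` and `q 0`: the boundary form of `n`-fold
integration by parts. -/
def concomitant (n : ℕ) (p q : ℕ → ℝ → ℝ) (x : ℝ) : ℝ :=
  ∑ j ∈ Finset.range n, (-1) ^ j * p j x * q (n - 1 - j) x

variable {n : ℕ} {p q : ℕ → ℝ → ℝ} {x : ℝ}

lemma hasDerivAt_concomitant (hp : ∀ j < n, HasDerivAt (p j) (p (j + 1) x) x)
    (hq : ∀ j < n, HasDerivAt (q j) (q (j + 1) x) x) :
    HasDerivAt (concomitant n p q) (p 0 x * q n x - (-1) ^ n * p n x * q 0 x) x := by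
  have hterm (j : ℕ) (hj : j ∈ Finset.range n) :
      HasDerivAt (fun x ↦ (-1) ^ j * p j x * q (n - 1 - j) x)
        ((-1) ^ j * p j x * q (n - j) x
          - (-1) ^ (j + 1) * p (j + 1) x * q (n - (j + 1)) x) x := by
    have hj' := Finset.mem_range.1 hj
    refine (((hp j hj').const_mul ((-1) ^ j)).mul (hq (n - 1 - j) (by lia))).congr_deriv ?_
    rw [show n - 1 - j + 1 = n - j by lia, show n - (j + 1) = n - 1 - j by lia]
    ring
  refine (HasDerivAt.fun_sum hterm).congr_deriv ?_
  rw [Finset.sum_range_sub' fun j ↦ (-1) ^ j * p j x * q (n - j) x]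
  simp

lemma concomitant_eq_zero {k : ℕ} (hp : ∀ j < k, p j x = 0) (hq : ∀ j < k, q j x = 0) :
    concomitant (2 * k) p q x = 0 := by
  refine Finset.sum_eq_zero fun j hj ↦ ?_
  rcases lt_or_ge j k with hjk | hjk
  · simp [hp j hjk]
  · simp [hq (2 * k - 1 - j) (by have := Finset.mem_range.1 hj; lia)]

end Concomitant

/-- The Fourier coefficient of `u(·, y)` with respect to `X` and the weight `x ^ (-m)`. -/
def coeff (m : ℝ) (X : ℝ → ℝ) (u : ℝ → ℝ → ℝ) (y : ℝ) : ℝ :=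
  ∫ x in Ioo (0 : ℝ) 1, x ^ (-m) * X x * u x y

/-- The part of `coeff m X u y` over `(ε, 1 - ε)`: the `2k`-th derivative of a solution is only
controlled locally uniformly in `y` away from `x = 0` and `x = 1`. -/
def truncCoeff (m : ℝ) (X : ℝ → ℝ) (ε : ℝ) (u : ℝ → ℝ → ℝ) (y : ℝ) : ℝ :=
  ∫ x in ε..1 - ε, x ^ (-m) * X x * u x y

/-- The spatial part `-(-1)ᵏ xᵐ ∂ₓ²ᵏ u` of the equation, moved to the side opposite to the Caputo
derivative. -/
def spatial (k : ℕ) (m : ℝ) (u : ℝ → ℝ → ℝ) (x y : ℝ) : ℝ :=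
  -((-1) ^ k * x ^ m * dx (2 * k) u x y)

/-- The boundary form of the integration by parts of `X ∂ₓ²ᵏ u`. -/
def boundaryForm (k : ℕ) (X : ℝ → ℝ) (u : ℝ → ℝ → ℝ) (x y : ℝ) : ℝ :=
  concomitant (2 * k) (fun j ↦ iteratedDerivWithin j X (Icc 0 1)) (fun j s ↦ dx j u s y) x

section Coefficients

variable {k : ℕ} {m α β a b lam ε y μ : ℝ} {φ X : ℝ → ℝ} {u v : ℝ → ℝ → ℝ}

lemma uIcc_one_sub_subset_Ioo (hε : ε ∈ Ioo (0 : ℝ) (1 / 2)) : uIcc ε (1 - ε) ⊆ Ioo 0 1 := by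
  rw [uIcc_of_le (by linarith [hε.2])]
  exact fun x hx ↦ ⟨hε.1.trans_le hx.1, hx.2.trans_lt (by linarith [hε.1])⟩

lemma IsEigenfunction.continuousOn_rpow_mul_mul (hX : IsEigenfunction k m lam X) {J : Set ℝ}
    (hv : ContinuousOn (Function.uncurry v) (Ioo 0 1 ×ˢ J)) :
    ContinuousOn (Function.uncurry fun x y ↦ x ^ (-m) * X x * v x y) (Ioo 0 1 ×ˢ J) :=
  ((hX.continuousOn_rpow_mul (-m)).comp continuousOn_fst fun _ hw ↦ hw.1).mul hv

lemma IsEigenfunction.continuousOn_truncCoeff (hX : IsEigenfunction k m lam X)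
    (hε : ε ∈ Ioo (0 : ℝ) (1 / 2)) {K : Set ℝ} (hK : IsCompact K)
    (hv : ContinuousOn (Function.uncurry v) (Ioo 0 1 ×ˢ K)) :
    ContinuousOn (truncCoeff m X ε v) K :=
  continuousOn_intervalIntegral hK <|
    (hX.continuousOn_rpow_mul_mul hv).mono (prod_mono_left (uIcc_one_sub_subset_Ioo hε))

lemma IsEigenfunction.fracInt_truncCoeff (hX : IsEigenfunction k m lam X)
    (hε : ε ∈ Ioo (0 : ℝ) (1 / 2)) (hμ : 0 < μ) (hy : 0 < y)
    (hv : ContinuousOn (Function.uncurry v) (Ioo 0 1 ×ˢ Icc 0 y)) :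
    fracInt μ (truncCoeff m X ε v) y = truncCoeff m X ε (fun x ↦ fracInt μ (v x)) y := by
  have h := (hX.continuousOn_rpow_mul_mul hv).mono (prod_mono_left (uIcc_one_sub_subset_Ioo hε))
  simp only [truncCoeff, ← fracInt_const_mul]
  exact fracInt_intervalIntegral hμ hy h

lemma IsEigenfunction.intervalIntegrable_truncCoeff (hX : IsEigenfunction k m lam X)
    (hε : ε ∈ Ioo (0 : ℝ) (1 / 2)) (hv : ContinuousOn (fun x ↦ v x y) (Ioo 0 1)) :
    IntervalIntegrable (fun x ↦ x ^ (-m) * X x * v x y) volume ε (1 - ε) :=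
  (((hX.continuousOn_rpow_mul (-m)).mul hv).mono
    (uIcc_one_sub_subset_Ioo hε)).intervalIntegrable

namespace IsSolution

lemma continuousOn (hu : IsSolution k m α β a b φ u) :
    ContinuousOn (Function.uncurry u) (Icc 0 1 ×ˢ Icc (-a) b) := by
  have h := hu.continuous_dx 0 (Nat.zero_le _)
  simp only [dx, iteratedDerivWithin_zero] at h
  exact h

lemma continuousOn_left (hu : IsSolution k m α β a b φ u) (hy : y ∈ Icc (-a) b) :
    ContinuousOn (fun x ↦ u x y) (Icc 0 1) :=
  (hu.contDiff_x y hy).continuousOn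

lemma continuousOn_right (hu : IsSolution k m α β a b φ u) {x : ℝ} (hx : x ∈ Icc (0 : ℝ) 1) :
    ContinuousOn (u x) (Icc (-a) b) :=
  hu.continuousOn.comp (f := fun y ↦ (x, y)) (by fun_prop) fun _ hy ↦ ⟨hx, hy⟩

lemma continuousOn_spatial (hu : IsSolution k m α β a b φ u) :
    ContinuousOn (Function.uncurry (spatial k m u)) (Ioo 0 1 ×ˢ Ioo (-a) b) :=
  ((continuousOn_const.mul (continuousOn_fst.rpow_const fun _ hp ↦ Or.inl hp.1.1.ne')).mul
    hu.continuous_dx_top).neg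

lemma exists_abs_rpow_mul_mul_le (hu : IsSolution k m α β a b φ u)
    (hX : IsEigenfunction k m lam X) (hk : 1 ≤ k) (hm : m ≤ k) :
    ∃ C, ∀ x ∈ Ioo (0 : ℝ) 1, ∀ y ∈ Icc (-a) b, |x ^ (-m) * X x * u x y| ≤ C := by
  obtain ⟨C, hC⟩ := hX.exists_abs_rpow_mul_le hk hm
  obtain ⟨D, hD⟩ :=
    (isCompact_Icc.prod isCompact_Icc).exists_bound_of_continuousOn hu.continuousOn
  refine ⟨C * D, fun x hx y hy ↦ ?_⟩
  rw [abs_mul]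
  exact mul_le_mul (hC x hx) (hD (x, y) ⟨Ioo_subset_Icc_self hx, hy⟩) (abs_nonneg _)
    ((abs_nonneg _).trans (hC x hx))

lemma aestronglyMeasurable_rpow_mul_mul (hu : IsSolution k m α β a b φ u)
    (hX : IsEigenfunction k m lam X) (hy : y ∈ Icc (-a) b) :
    AEStronglyMeasurable (fun x ↦ x ^ (-m) * X x * u x y) (volume.restrict (Ioo 0 1)) :=
  ((hX.continuousOn_rpow_mul (-m)).mul
    ((hu.continuousOn_left hy).mono Ioo_subset_Icc_self)).aestronglyMeasurable measurableSet_Ioo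

lemma integrableOn_rpow_mul_mul (hu : IsSolution k m α β a b φ u)
    (hX : IsEigenfunction k m lam X) (hk : 1 ≤ k) (hm : m ≤ k) (hy : y ∈ Icc (-a) b) :
    IntegrableOn (fun x ↦ x ^ (-m) * X x * u x y) (Ioo 0 1) := by
  obtain ⟨C, hC⟩ := hu.exists_abs_rpow_mul_mul_le hX hk hm
  refine Integrable.of_bound (hu.aestronglyMeasurable_rpow_mul_mul hX hy) C ?_
  filter_upwards [ae_restrict_mem measurableSet_Ioo] with x hx using hC x hx y hy

lemma continuousOn_coeff (hu : IsSolution k m α β a b φ u) (hX : IsEigenfunction k m lam X)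
    (hk : 1 ≤ k) (hm : m ≤ k) : ContinuousOn (coeff m X u) (Icc (-a) b) := by
  obtain ⟨C, hC⟩ := hu.exists_abs_rpow_mul_mul_le hX hk hm
  refine continuousOn_of_dominated (bound := fun _ ↦ C)
    (fun y hy ↦ hu.aestronglyMeasurable_rpow_mul_mul hX hy) (fun y hy ↦ ?_)
    (integrable_const C) ?_ <;>
    filter_upwards [ae_restrict_mem measurableSet_Ioo] with x hx
  · exact hC x hx y hy
  · exact continuousOn_const.mul (hu.continuousOn_right (Ioo_subset_Icc_self hx))

lemma tendsto_truncCoeff (hu : IsSolution k m α β a b φ u) (hX : IsEigenfunction k m lam X)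
    (hk : 1 ≤ k) (hm : m ≤ k) (hy : y ∈ Icc (-a) b) :
    Tendsto (fun ε ↦ truncCoeff m X ε u y) (𝓝[>] 0) (𝓝 (coeff m X u y)) :=
  tendsto_intervalIntegral_one_sub (hu.integrableOn_rpow_mul_mul hX hk hm hy)

lemma continuousOn_boundaryForm (hu : IsSolution k m α β a b φ u)
    (hX : IsEigenfunction k m lam X) :
    ContinuousOn (Function.uncurry (boundaryForm k X u)) (Icc 0 1 ×ˢ Icc (-a) b) := by
  simp only [boundaryForm, concomitant, Function.uncurry_def]
  refine continuousOn_finsetSum _ fun j hj ↦ ?_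
  have hj' := Finset.mem_range.1 hj
  have hXj : ContinuousOn (iteratedDerivWithin j X (Icc 0 1)) (Icc 0 1) :=
    hX.contDiff_Icc.continuousOn_iteratedDerivWithin
      (by exact_mod_cast (by lia : j ≤ 2 * k - 1)) (uniqueDiffOn_Icc one_pos)
  exact (continuousOn_const.mul (hXj.comp continuousOn_fst fun _ hp ↦ hp.1)).mul
    (hu.continuous_dx _ (by lia))

lemma boundaryForm_zero (hu : IsSolution k m α β a b φ u) (hX : IsEigenfunction k m lam X)
    (hy : y ∈ Icc (-a) b) : boundaryForm k X u 0 y = 0 :=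
  concomitant_eq_zero (fun j hj ↦ (hX.boundary j hj).1) fun j hj ↦ (hu.boundary j hj y hy).1

lemma boundaryForm_one (hu : IsSolution k m α β a b φ u) (hX : IsEigenfunction k m lam X)
    (hy : y ∈ Icc (-a) b) : boundaryForm k X u 1 y = 0 :=
  concomitant_eq_zero (fun j hj ↦ (hX.boundary j hj).2) fun j hj ↦ (hu.boundary j hj y hy).2

lemma hasDerivAt_boundaryForm (hu : IsSolution k m α β a b φ u)
    (hX : IsEigenfunction k m lam X) (hk : 1 ≤ k) {x : ℝ} (hx : x ∈ Ioo (0 : ℝ) 1)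
    (hy : y ∈ Icc (-a) b) :
    HasDerivAt (fun x ↦ boundaryForm k X u x y)
      (-(-1) ^ k * (x ^ (-m) * X x * spatial k m u x y + lam * (x ^ (-m) * X x * u x y))) x := by
  refine (hasDerivAt_concomitant (fun j hj ↦ hasDerivAt_iteratedDerivWithin hX.contDiff_Icc
    (hX.differentiableOn_top hk) hj hx) fun j hj ↦ hu.hasDerivAt_dx hj hx hy).congr_deriv ?_
  have hpow : x ^ m * x ^ (-m) = 1 := by rw [← Real.rpow_add hx.1]; simp
  have hsign : ((-1 : ℝ) ^ k) * (-1) ^ k = 1 := by rw [← mul_pow]; simp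
  rw [hX.iteratedDerivWithin_top hx, pow_mul]
  simp only [iteratedDerivWithin_zero, dx, spatial, neg_one_sq, one_pow]
  linear_combination (-X x * iteratedDerivWithin (2 * k) (fun s ↦ u s y) (Icc 0 1) x) *
    (x ^ m * x ^ (-m) * hsign + hpow)

lemma truncCoeff_spatial (hu : IsSolution k m α β a b φ u) (hX : IsEigenfunction k m lam X)
    (hk : 1 ≤ k) (hε : ε ∈ Ioo (0 : ℝ) (1 / 2)) (hy : y ∈ Ioo (-a) b) :
    truncCoeff m X ε (spatial k m u) y =
      -(-1) ^ k * (boundaryForm k X u (1 - ε) y - boundaryForm k X u ε y)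
        - lam * truncCoeff m X ε u y := by
  have hyI := Ioo_subset_Icc_self hy
  have hspatial := hX.intervalIntegrable_truncCoeff hε (v := spatial k m u)
    (hu.continuousOn_spatial.comp (f := fun x ↦ (x, y)) (by fun_prop) fun _ hx ↦ ⟨hx, hy⟩)
  have hui := hX.intervalIntegrable_truncCoeff hε (v := u)
    ((hu.continuousOn_left hyI).mono Ioo_subset_Icc_self)
  have hftc := intervalIntegral.integral_eq_sub_of_hasDerivAt
    (fun x hx ↦ hu.hasDerivAt_boundaryForm hX hk (uIcc_one_sub_subset_Ioo hε hx) hyI)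
    ((hspatial.add (hui.const_mul lam)).const_mul _)
  rw [intervalIntegral.integral_const_mul, intervalIntegral.integral_add hspatial
    (hui.const_mul lam), intervalIntegral.integral_const_mul] at hftc
  have hsign : ((-1 : ℝ) ^ k) * (-1) ^ k = 1 := by rw [← mul_pow]; simp
  change -(-1) ^ k * (truncCoeff m X ε (spatial k m u) y + lam * truncCoeff m X ε u y) = _ at hftc
  linear_combination (-(-1) ^ k) * hftc
    - (truncCoeff m X ε (spatial k m u) y + lam * truncCoeff m X ε u y) * hsign

lemma tendsto_truncCoeff_spatial (hu : IsSolution k m α β a b φ u)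
    (hX : IsEigenfunction k m lam X) (hk : 1 ≤ k) (hm : m ≤ k) (hy : y ∈ Ioo (-a) b) :
    Tendsto (fun ε ↦ truncCoeff m X ε (spatial k m u) y) (𝓝[>] 0)
      (𝓝 (-lam * coeff m X u y)) := by
  have hyI := Ioo_subset_Icc_self hy
  have hB : ContinuousOn (fun x ↦ boundaryForm k X u x y) (Icc 0 1) :=
    (hu.continuousOn_boundaryForm hX).comp (f := fun x ↦ (x, y)) (by fun_prop)
      fun _ hx ↦ ⟨hx, hyI⟩
  have hB0 : Tendsto (fun ε ↦ boundaryForm k X u ε y) (𝓝[>] 0) (𝓝 0) := by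
    have h := (hB.continuousWithinAt (left_mem_Icc.2 zero_le_one)).mono Ioo_subset_Icc_self
    rwa [ContinuousWithinAt, hu.boundaryForm_zero hX hyI, nhdsWithin_Ioo_eq_nhdsGT one_pos] at h
  have hB1 : Tendsto (fun ε ↦ boundaryForm k X u (1 - ε) y) (𝓝[>] 0) (𝓝 0) := by
    have h := (hB.continuousWithinAt (right_mem_Icc.2 zero_le_one)).mono Ioo_subset_Icc_self
    rw [ContinuousWithinAt, hu.boundaryForm_one hX hyI, nhdsWithin_Ioo_eq_nhdsLT one_pos] at h
    exact h.comp tendsto_one_sub_nhdsGT_zero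
  have hlim := ((hB1.sub hB0).const_mul (-(-1) ^ k)).sub
    ((hu.tendsto_truncCoeff hX hk hm hyI).const_mul lam)
  rw [sub_zero, mul_zero, zero_sub, ← neg_mul] at hlim
  refine hlim.congr' ?_
  filter_upwards [Ioo_mem_nhdsGT (by norm_num : (0 : ℝ) < 1 / 2)] with ε hε
  exact (hu.truncCoeff_spatial hX hk hε hy).symm

lemma exists_abs_truncCoeff_spatial_le (hu : IsSolution k m α β a b φ u)
    (hX : IsEigenfunction k m lam X) (hk : 1 ≤ k) (hm : m ≤ k) :
    ∃ C, ∀ ε ∈ Ioo (0 : ℝ) (1 / 2), ∀ y ∈ Ioo (-a) b,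
      |truncCoeff m X ε (spatial k m u) y| ≤ C := by
  obtain ⟨D, hD⟩ := (isCompact_Icc.prod isCompact_Icc).exists_bound_of_continuousOn
    (hu.continuousOn_boundaryForm hX)
  obtain ⟨C, hC⟩ := hu.exists_abs_rpow_mul_mul_le hX hk hm
  refine ⟨D + D + |lam| * C, fun ε hε y hy ↦ ?_⟩
  have hyI := Ioo_subset_Icc_self hy
  have hmem {x : ℝ} (hx : x ∈ uIcc ε (1 - ε)) : x ∈ Ioo 0 1 := uIcc_one_sub_subset_Ioo hε hx
  have hleft := hD (ε, y) ⟨Ioo_subset_Icc_self (hmem left_mem_uIcc), hyI⟩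
  have hright := hD (1 - ε, y) ⟨Ioo_subset_Icc_self (hmem right_mem_uIcc), hyI⟩
  have hC0 : 0 ≤ C := (abs_nonneg _).trans (hC ε (hmem left_mem_uIcc) y hyI)
  have hcoeff : |truncCoeff m X ε u y| ≤ C := by
    refine (intervalIntegral.norm_integral_le_of_norm_le_const
      (f := fun x ↦ x ^ (-m) * X x * u x y)
      fun x hx ↦ hC x (hmem (uIoc_subset_uIcc hx)) y hyI).trans (mul_le_of_le_one_right hC0 ?_)
    rw [abs_of_nonneg (by linarith [hε.2])]
    linarith [hε.1]
  rw [hu.truncCoeff_spatial hX hk hε hy]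
  refine (abs_sub _ _).trans ?_
  rw [abs_mul, abs_mul, abs_neg, abs_neg_one_pow, one_mul]
  exact add_le_add ((abs_sub _ _).trans (add_le_add hright hleft))
    (mul_le_mul_of_nonneg_left hcoeff (abs_nonneg _))

lemma tendsto_truncCoeff_fracInt_spatial (hu : IsSolution k m α β a b φ u)
    (hX : IsEigenfunction k m lam X) (hk : 1 ≤ k) (hm : m ≤ k) (hμ : 0 < μ) {t σ : ℝ} (ht : 0 < t)
    (hσ : ∀ s ∈ Icc 0 t, σ * s ∈ Ioo (-a) b) :
    Tendsto (fun ε ↦ truncCoeff m X ε (fun x ↦ fracInt μ fun s ↦ spatial k m u x (σ * s)) t)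
      (𝓝[>] 0) (𝓝 (-lam * fracInt μ (fun s ↦ coeff m X u (σ * s)) t)) := by
  have hcont : ContinuousOn (Function.uncurry fun x s ↦ spatial k m u x (σ * s))
      (Ioo 0 1 ×ˢ Icc 0 t) :=
    hu.continuousOn_spatial.comp (f := fun w : ℝ × ℝ ↦ (w.1, σ * w.2)) (by fun_prop)
      fun w hw ↦ ⟨hw.1, hσ _ hw.2⟩
  have hhalf : Ioo (0 : ℝ) (1 / 2) ∈ 𝓝[>] 0 := Ioo_mem_nhdsGT (by norm_num)
  obtain ⟨C, hC⟩ := hu.exists_abs_truncCoeff_spatial_le hX hk hm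
  rw [← fracInt_const_mul]
  refine (tendsto_fracInt_of_bounded (C := C) (l := 𝓝[>] 0)
    (F := fun ε ↦ truncCoeff m X ε fun x s ↦ spatial k m u x (σ * s)) hμ ht ?_ ?_
    fun s hs ↦ hu.tendsto_truncCoeff_spatial hX hk hm (hσ s hs)).congr' ?_ <;>
    filter_upwards [hhalf] with ε hε
  · exact hX.continuousOn_truncCoeff hε isCompact_Icc hcont
  · exact fun s hs ↦ hC ε hε _ (hσ s hs)
  · exact hX.fracInt_truncCoeff hε hμ ht hcont

/-- Both Volterra equations in `y` are inherited by the coefficients: `τ = 0` for `y > 0`, where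
only `u(x, 0)` enters, and `τ = -1` for `y < 0`, where `u_y(x, -0)` enters too. -/
lemma coeff_eq_add_fracInt (hu : IsSolution k m α β a b φ u) (hX : IsEigenfunction k m lam X)
    (hk : 1 ≤ k) (hm : m ≤ k) (hμ : 0 < μ) {t σ τ : ℝ} (ht : 0 < t)
    (hσ : ∀ s ∈ Icc 0 t, σ * s ∈ Ioo (-a) b)
    (heq : ∀ x ∈ Ioo (0 : ℝ) 1, u x (σ * t) = u x 0 + τ * spatial k m u x 0
      + fracInt μ (fun s ↦ spatial k m u x (σ * s)) t) :
    coeff m X u (σ * t) = coeff m X u 0 + τ * (-lam * coeff m X u 0)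
      + -lam * fracInt μ (fun s ↦ coeff m X u (σ * s)) t := by
  have h0 : (0 : ℝ) ∈ Ioo (-a) b := by simpa using hσ 0 (left_mem_Icc.2 ht.le)
  have hσt := hσ t (right_mem_Icc.2 ht.le)
  have hu_cont {y : ℝ} (hy : y ∈ Ioo (-a) b) : ContinuousOn (fun x ↦ u x y) (Ioo 0 1) :=
    (hu.continuousOn_left (Ioo_subset_Icc_self hy)).mono Ioo_subset_Icc_self
  have hspatial_cont : ContinuousOn (fun x ↦ spatial k m u x 0) (Ioo 0 1) :=
    hu.continuousOn_spatial.comp (f := fun x ↦ (x, 0)) (by fun_prop) fun _ hx ↦ ⟨hx, h0⟩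
  have htrunc : ∀ᶠ ε in 𝓝[>] 0, truncCoeff m X ε u (σ * t) - (truncCoeff m X ε u 0
      + τ * truncCoeff m X ε (spatial k m u) 0) =
      truncCoeff m X ε (fun x ↦ fracInt μ fun s ↦ spatial k m u x (σ * s)) t := by
    filter_upwards [Ioo_mem_nhdsGT (by norm_num : (0 : ℝ) < 1 / 2)] with ε hε
    have hi {y : ℝ} (hy : y ∈ Ioo (-a) b) := hX.intervalIntegrable_truncCoeff hε (hu_cont hy)
    have hi' := (hX.intervalIntegrable_truncCoeff hε hspatial_cont).const_mul τ
    simp only [truncCoeff]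
    rw [← intervalIntegral.integral_const_mul, ← intervalIntegral.integral_add (hi h0) hi',
      ← intervalIntegral.integral_sub (hi hσt) ((hi h0).add hi')]
    refine intervalIntegral.integral_congr fun x hx ↦ ?_
    simp only [heq x (uIcc_one_sub_subset_Ioo hε hx)]
    ring
  have hlim (y : ℝ) (hy : y ∈ Ioo (-a) b) :=
    hu.tendsto_truncCoeff hX hk hm (Ioo_subset_Icc_self hy)
  have hleft := ((hlim _ hσt).sub ((hlim 0 h0).add
    ((hu.tendsto_truncCoeff_spatial hX hk hm h0).const_mul τ))).congr' htrunc
  linarith [tendsto_nhds_unique hleft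
    (hu.tendsto_truncCoeff_fracInt_spatial hX hk hm hμ ht hσ)]

lemma eq_add_fracInt_spatial (hu : IsSolution k m α β a b φ u) (hα0 : 0 < α) (hα1 : α < 1)
    (ha : 0 ≤ a) {x : ℝ} (hx : x ∈ Ioo (0 : ℝ) 1) (hy : y ∈ Ioo 0 b) :
    u x y = u x 0 + fracInt α (spatial k m u x) y := by
  have hcont : ContinuousOn (u x) (Ico 0 b) :=
    (hu.continuousOn_right (Ioo_subset_Icc_self hx)).mono
      fun z hz ↦ ⟨by linarith [hz.1], hz.2.le⟩
  rw [(hu.caputoPos_exists x hx).eq_add_fracInt hα0 hα1 hcont hy]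
  congr 1
  refine fracInt_congr hy.1.le fun z hz ↦ ?_
  rw [spatial]
  linarith [hu.eq_pos x hx z ⟨hz.1, hz.2.trans hy.2⟩]

lemma tendsto_deriv_spatial (hu : IsSolution k m α β a b φ u) (ha : 0 < a) (hb : 0 < b) {x : ℝ}
    (hx : x ∈ Ioo (0 : ℝ) 1) : Tendsto (deriv (u x)) (𝓝[<] 0) (𝓝 (spatial k m u x 0)) := by
  obtain ⟨l, hcaputo, hderiv⟩ := hu.gluing_deriv x (Ioo_subset_Icc_self hx)
  have hcont : ContinuousOn (spatial k m u x) (Ioo (-a) b) :=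
    hu.continuousOn_spatial.comp (f := fun y ↦ (x, y)) (by fun_prop) fun _ hy ↦ ⟨hx, hy⟩
  have hlim : Tendsto (caputoPos α (u x)) (𝓝[>] 0) (𝓝 (spatial k m u x 0)) := by
    refine ((hcont.continuousAt (Ioo_mem_nhds (neg_lt_zero.2 ha) hb)).tendsto.mono_left
      nhdsWithin_le_nhds).congr' ?_
    filter_upwards [Ioo_mem_nhdsGT hb] with y hy
    rw [spatial]
    linarith [hu.eq_pos x hx y hy]
  rwa [tendsto_nhds_unique hcaputo hlim] at hderiv

lemma neg_eq_add_fracInt_spatial (hu : IsSolution k m α β a b φ u) (hβ1 : 1 ≤ β) (hβ2 : β < 2)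
    (hb : 0 < b) {x t : ℝ} (hx : x ∈ Ioo (0 : ℝ) 1) (ht : t ∈ Ioo 0 a) :
    u x (-t) = u x 0 + -t * spatial k m u x 0 + fracInt β (fun s ↦ spatial k m u x (-s)) t := by
  have hcont : ContinuousOn (u x) (Ioc (-a) 0) :=
    (hu.continuousOn_right (Ioo_subset_Icc_self hx)).mono
      fun z hz ↦ ⟨hz.1.le, by linarith [hz.2]⟩
  rw [(hu.caputoNeg_exists x hx).eq_add_fracInt hβ1 hβ2 hcont
    (hu.tendsto_deriv_spatial (ht.1.trans ht.2) hb hx) ht, neg_mul, ← sub_eq_add_neg, mul_comm t]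
  congr 1
  refine fracInt_congr ht.1.le fun s hs ↦ ?_
  rw [spatial]
  linarith [hu.eq_neg x hx (-s) ⟨by linarith [hs.2, ht.2], by linarith [hs.1]⟩]

lemma coeff_eq_profile (hu : IsSolution k m α β a b φ u) (hX : IsEigenfunction k m lam X)
    (hk : 1 ≤ k) (hm : m ≤ k) (hα0 : 0 < α) (hα1 : α < 1) (hβ1 : 1 ≤ β) (hβ2 : β < 2)
    (ha : 0 < a) (hb : 0 < b) (hy : y ∈ Icc (-a) b) :
    coeff m X u y = profile α β lam (coeff m X u 0) y := by
  have hcont := hu.continuousOn_coeff hX hk hm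
  rcases le_or_gt 0 y with hy0 | hy0
  · rw [profile_of_nonneg hy0]
    refine eqOn_mlSolution_of_eq_add_mul_fracInt hα0 hb
      (hcont.mono (Icc_subset_Icc_left (by linarith))) (fun t ht ↦ ?_) ⟨hy0, hy.2⟩
    have h := hu.coeff_eq_add_fracInt hX hk hm hα0 (σ := 1) (τ := 0) ht.1
      (fun s hs ↦ ⟨by linarith [hs.1], by linarith [hs.2, ht.2]⟩) fun x hx ↦ by
        simpa using hu.eq_add_fracInt_spatial hα0 hα1 ha.le hx ht
    simpa using h
  · have hvolterra : EqOn (fun t ↦ coeff m X u (-t))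
        (mlSolution β (-lam) (coeff m X u 0) (lam * coeff m X u 0)) (Icc 0 a) := by
      refine eqOn_mlSolution_of_eq_add_mul_fracInt (by linarith) ha (hcont.comp continuousOn_neg
        fun t ht ↦ ⟨by linarith [ht.2], by linarith [ht.1]⟩) fun t ht ↦ ?_
      have h := hu.coeff_eq_add_fracInt hX hk hm (by linarith : 0 < β) (σ := -1) (τ := -t) ht.1
        (fun s hs ↦ ⟨by linarith [hs.2, ht.2], by linarith [hs.1]⟩) fun x hx ↦ by
          simpa using hu.neg_eq_add_fracInt_spatial hβ1 hβ2 hb hx ht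
      simp only [neg_one_mul] at h
      linear_combination h
    have h := profile_neg_of_pos (α := α) (β := β) (lam := lam) (A := coeff m X u 0)
      (neg_pos.2 hy0)
    rw [neg_neg] at h
    rw [h, ← hvolterra ⟨by linarith, by linarith [hy.1]⟩]
    simp only [neg_neg]

lemma coeff_eq_zero (hu : IsSolution k m α β a b (fun _ ↦ 0) u) (hX : IsEigenfunction k m lam X)
    (hk : 1 ≤ k) (hm : m ≤ k) (hα0 : 0 < α) (hα1 : α < 1) (hβ1 : 1 ≤ β) (hβ2 : β < 2)
    (ha : 0 < a) (hb : 0 < b) (hΔ : Delta α β a b lam ≠ 0) (hy : y ∈ Icc (-a) b) :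
    coeff m X u y = 0 := by
  have hprofile {z : ℝ} (hz : z ∈ Icc (-a) b) :=
    hu.coeff_eq_profile hX hk hm hα0 hα1 hβ1 hβ2 ha hb hz
  have hends : coeff m X u b = coeff m X u (-a) :=
    setIntegral_congr_fun measurableSet_Ioo fun x hx ↦ by
      simp only [sub_eq_zero.1 (hu.nonlocal x (Ioo_subset_Icc_self hx))]
  rw [hprofile (right_mem_Icc.2 (by linarith)), hprofile (left_mem_Icc.2 (by linarith)),
    ← sub_eq_zero, profile_sub_profile_neg hα0 (by linarith) ha hb] at hends
  rw [hprofile hy, (mul_eq_zero.1 hends).resolve_right hΔ, profile_eq_mul, zero_mul]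

end IsSolution

end Coefficients

/-! ### Iterated primitives -/

section Prim

variable {c x y : ℝ} {f g : ℝ → ℝ}

/-- The primitive of `f` vanishing at `c`. With `c = 0` and `c = 1` these are, up to sign, mutually
adjoint operators on `(0, 1)`. -/
def prim (c : ℝ) (f : ℝ → ℝ) (x : ℝ) : ℝ := ∫ t in c..x, f t

lemma intervalIntegrable_of_integrableOn_unit (hf : IntegrableOn f (Ioo 0 1))
    (hx : x ∈ Icc (0 : ℝ) 1) (hy : y ∈ Icc (0 : ℝ) 1) : IntervalIntegrable f volume x y :=
  ((intervalIntegrable_iff_integrableOn_Ioo_of_le zero_le_one).2 hf).mono_set <| by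
    rw [uIcc_of_le zero_le_one]
    exact ordConnected_Icc.uIcc_subset hx hy

lemma integrableOn_unit_of_continuousOn (hf : ContinuousOn f (Icc 0 1)) :
    IntegrableOn f (Ioo 0 1) :=
  (hf.integrableOn_compact isCompact_Icc).mono_set Ioo_subset_Icc_self

lemma prim_one_eq_integral : prim 0 f 1 = ∫ x in Ioo 0 1, f x := by
  rw [prim, intervalIntegral.integral_of_le zero_le_one, integral_Ioc_eq_integral_Ioo]

lemma continuousOn_prim (hc : c ∈ Icc (0 : ℝ) 1) (hf : IntegrableOn f (Ioo 0 1)) :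
    ContinuousOn (prim c f) (Icc 0 1) := by
  rw [← uIcc_of_le zero_le_one] at hc ⊢
  exact intervalIntegral.continuousOn_primitive_interval'
    ((intervalIntegrable_iff_integrableOn_Ioo_of_le zero_le_one).2 hf) hc

lemma integrableOn_prim_iterate (hc : c ∈ Icc (0 : ℝ) 1) (hf : IntegrableOn f (Ioo 0 1)) (n : ℕ) :
    IntegrableOn ((prim c)^[n] f) (Ioo 0 1) := by
  induction n with
  | zero => exact hf
  | succ n ih =>
    rw [Function.iterate_succ_apply']
    exact integrableOn_unit_of_continuousOn (continuousOn_prim hc ih)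

lemma continuousOn_prim_iterate_succ (hc : c ∈ Icc (0 : ℝ) 1) (hf : IntegrableOn f (Ioo 0 1))
    (n : ℕ) : ContinuousOn ((prim c)^[n + 1] f) (Icc 0 1) := by
  rw [Function.iterate_succ_apply']
  exact continuousOn_prim hc (integrableOn_prim_iterate hc hf n)

lemma continuousOn_prim_iterate (hc : c ∈ Icc (0 : ℝ) 1) (hf : ContinuousOn f (Icc 0 1)) (n : ℕ) :
    ContinuousOn ((prim c)^[n] f) (Icc 0 1) := by
  cases n with
  | zero => exact hf
  | succ n => exact continuousOn_prim_iterate_succ hc (integrableOn_unit_of_continuousOn hf) n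

lemma prim_congr_ae (hc : c ∈ Icc (0 : ℝ) 1) (h : f =ᵐ[volume.restrict (Ioo 0 1)] g) :
    EqOn (prim c f) (prim c g) (Icc 0 1) := fun x hx ↦ by
  refine intervalIntegral.integral_congr_ae ?_
  rw [EventuallyEq, ae_restrict_iff' measurableSet_Ioo] at h
  filter_upwards [h, Measure.ae_ne volume 0, Measure.ae_ne volume 1] with t ht ht0 ht1 htx
  have ht' : t ∈ Icc (0 : ℝ) 1 := ordConnected_Icc.uIcc_subset hc hx (uIoc_subset_uIcc htx)
  exact ht ⟨lt_of_le_of_ne ht'.1 ht0.symm, lt_of_le_of_ne ht'.2 ht1⟩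

lemma prim_congr (hc : c ∈ Icc (0 : ℝ) 1) (h : EqOn f g (Icc 0 1)) :
    EqOn (prim c f) (prim c g) (Icc 0 1) :=
  prim_congr_ae hc <| (ae_restrict_mem measurableSet_Ioo).mono fun _ hx ↦
    h (Ioo_subset_Icc_self hx)

lemma prim_iterate_congr (hc : c ∈ Icc (0 : ℝ) 1) (h : EqOn f g (Icc 0 1)) (n : ℕ) :
    EqOn ((prim c)^[n] f) ((prim c)^[n] g) (Icc 0 1) := by
  induction n with
  | zero => exact h
  | succ n ih => simpa only [Function.iterate_succ_apply'] using prim_congr hc ih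

lemma prim_iterate_succ_congr_ae (hc : c ∈ Icc (0 : ℝ) 1)
    (h : f =ᵐ[volume.restrict (Ioo 0 1)] g) (n : ℕ) :
    EqOn ((prim c)^[n + 1] f) ((prim c)^[n + 1] g) (Icc 0 1) := by
  simpa only [Function.iterate_succ_apply] using prim_iterate_congr hc (prim_congr_ae hc h) n

lemma prim_const_mul (c r : ℝ) (f : ℝ → ℝ) :
    prim c (fun x ↦ r * f x) = fun x ↦ r * prim c f x :=
  funext fun _ ↦ intervalIntegral.integral_const_mul r f

lemma prim_iterate_const_mul (c r : ℝ) (f : ℝ → ℝ) (n : ℕ) :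
    (prim c)^[n] (fun x ↦ r * f x) = fun x ↦ r * (prim c)^[n] f x := by
  induction n with
  | zero => rfl
  | succ n ih => simp only [Function.iterate_succ_apply', ih, prim_const_mul]

lemma prim_add (hc : c ∈ Icc (0 : ℝ) 1) (hf : IntegrableOn f (Ioo 0 1))
    (hg : IntegrableOn g (Ioo 0 1)) :
    EqOn (prim c fun x ↦ f x + g x) (fun x ↦ prim c f x + prim c g x) (Icc 0 1) := fun _ hx ↦
  intervalIntegral.integral_add (intervalIntegrable_of_integrableOn_unit hf hc hx)
    (intervalIntegrable_of_integrableOn_unit hg hc hx)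

lemma prim_iterate_add (hc : c ∈ Icc (0 : ℝ) 1) (hf : IntegrableOn f (Ioo 0 1))
    (hg : IntegrableOn g (Ioo 0 1)) (n : ℕ) :
    EqOn ((prim c)^[n] fun x ↦ f x + g x) (fun x ↦ (prim c)^[n] f x + (prim c)^[n] g x)
      (Icc 0 1) := by
  induction n with
  | zero => exact fun _ _ ↦ rfl
  | succ n ih =>
    simp only [Function.iterate_succ_apply']
    exact (prim_congr hc ih).trans
      (prim_add hc (integrableOn_prim_iterate hc hf n) (integrableOn_prim_iterate hc hg n))

lemma abs_prim_iterate_le {C : ℝ} (hC : ∀ x ∈ Icc (0 : ℝ) 1, |f x| ≤ C) (n : ℕ)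
    (hx : x ∈ Icc (0 : ℝ) 1) : |(prim 0)^[n] f x| ≤ C * x ^ n := by
  have hC0 : 0 ≤ C := (abs_nonneg _).trans (hC 0 (left_mem_Icc.2 zero_le_one))
  induction n generalizing x with
  | zero => simpa using hC x hx
  | succ n ih =>
    rw [Function.iterate_succ_apply']
    have hbound : ∀ t ∈ uIoc 0 x, ‖(prim 0)^[n] f t‖ ≤ C * x ^ n := fun t ht ↦ by
      rw [uIoc_of_le hx.1] at ht
      exact (ih ⟨ht.1.le, ht.2.trans hx.2⟩).trans
        (mul_le_mul_of_nonneg_left (pow_le_pow_left₀ ht.1.le ht.2 n) hC0)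
    refine (intervalIntegral.norm_integral_le_of_norm_le_const hbound).trans_eq ?_
    rw [sub_zero, abs_of_nonneg hx.1, pow_succ, mul_assoc]

lemma prim_iterate_succ_self (c : ℝ) (f : ℝ → ℝ) (n : ℕ) : (prim c)^[n + 1] f c = 0 := by
  rw [Function.iterate_succ_apply', prim, intervalIntegral.integral_same]

lemma hasDerivWithinAt_prim (hc : c ∈ Icc (0 : ℝ) 1) (hf : ContinuousOn f (Icc 0 1))
    (hx : x ∈ Icc (0 : ℝ) 1) : HasDerivWithinAt (prim c f) (f x) (Icc 0 1) x :=
  have : Fact (x ∈ Icc (0 : ℝ) 1) := ⟨hx⟩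
  intervalIntegral.integral_hasDerivWithinAt_right
    (intervalIntegrable_of_integrableOn_unit (integrableOn_unit_of_continuousOn hf) hc hx)
    (hf.stronglyMeasurableAtFilter_nhdsWithin measurableSet_Icc x) (hf x hx)

lemma hasDerivWithinAt_prim_iterate_succ (hc : c ∈ Icc (0 : ℝ) 1) (hf : ContinuousOn f (Icc 0 1))
    (n : ℕ) (hx : x ∈ Icc (0 : ℝ) 1) :
    HasDerivWithinAt ((prim c)^[n + 1] f) ((prim c)^[n] f x) (Icc 0 1) x := by
  rw [Function.iterate_succ_apply']
  exact hasDerivWithinAt_prim hc (continuousOn_prim_iterate hc hf n) hx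

lemma hasDerivAt_prim (hc : c ∈ Icc (0 : ℝ) 1) (hf : IntegrableOn f (Ioo 0 1))
    (hf' : ContinuousOn f (Ioo 0 1)) (hx : x ∈ Ioo (0 : ℝ) 1) : HasDerivAt (prim c f) (f x) x :=
  intervalIntegral.integral_hasDerivAt_right
    (intervalIntegrable_of_integrableOn_unit hf hc (Ioo_subset_Icc_self hx))
    (hf'.stronglyMeasurableAtFilter isOpen_Ioo x hx) (hf'.continuousAt (isOpen_Ioo.mem_nhds hx))

lemma hasDerivAt_prim_iterate_succ (hc : c ∈ Icc (0 : ℝ) 1) (hf : IntegrableOn f (Ioo 0 1))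
    (hf' : ContinuousOn f (Ioo 0 1)) (n : ℕ) (hx : x ∈ Ioo (0 : ℝ) 1) :
    HasDerivAt ((prim c)^[n + 1] f) ((prim c)^[n] f x) x := by
  rw [Function.iterate_succ_apply']
  refine hasDerivAt_prim hc (integrableOn_prim_iterate hc hf n) ?_ hx
  cases n with
  | zero => exact hf'
  | succ n => exact (continuousOn_prim_iterate_succ hc hf n).mono Ioo_subset_Icc_self

lemma integral_prim_mul (hf : IntegrableOn f (Ioo 0 1)) (hg : IntegrableOn g (Ioo 0 1)) :
    ∫ x in Ioo 0 1, prim 0 f x * g x = -∫ x in Ioo 0 1, f x * prim 1 g x := by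
  have hfg : IntegrableOn (Function.uncurry fun s z ↦ g s * f z)
      {p | 0 < p.2 ∧ p.2 < p.1 ∧ p.1 < 1} := by
    have h : IntegrableOn (fun p : ℝ × ℝ ↦ g p.1 * f p.2) (Ioo 0 1 ×ˢ Ioo 0 1) := by
      rw [IntegrableOn, Measure.volume_eq_prod, ← Measure.prod_restrict]
      exact hg.mul_prod hf
    exact h.mono_set fun p hp ↦ ⟨⟨hp.1.trans hp.2.1, hp.2.2⟩, hp.1, hp.2.1.trans hp.2.2⟩
  have hswap := intervalIntegral_swap_triangle zero_le_one hfg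
  simp only [intervalIntegral.integral_const_mul, intervalIntegral.integral_mul_const] at hswap
  rw [← prim_one_eq_integral, ← prim_one_eq_integral, prim, prim,
    ← intervalIntegral.integral_neg]
  calc ∫ x in (0)..1, prim 0 f x * g x = ∫ s in (0)..1, g s * ∫ z in (0)..s, f z := by
        simp only [prim, mul_comm]
    _ = ∫ z in (0)..1, -(f z * prim 1 g z) := by
        simp only [hswap, prim, intervalIntegral.integral_symm _ (1 : ℝ), mul_neg, neg_neg,
          mul_comm]

lemma integral_prim_iterate_mul (hf : IntegrableOn f (Ioo 0 1)) (hg : IntegrableOn g (Ioo 0 1))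
    (n : ℕ) : ∫ x in Ioo 0 1, (prim 0)^[n] f x * g x =
      (-1) ^ n * ∫ x in Ioo 0 1, f x * (prim 1)^[n] g x := by
  have h1 := right_mem_Icc.2 (zero_le_one' ℝ)
  induction n generalizing g with
  | zero => simp
  | succ n ih =>
    rw [Function.iterate_succ_apply', integral_prim_mul
      (integrableOn_prim_iterate (left_mem_Icc.2 zero_le_one) hf n) hg,
      ih (g := prim 1 g) (integrableOn_prim_iterate h1 hg 1), Function.iterate_succ_apply, pow_succ]
    ring

lemma ae_eq_zero_of_prim_ae_eq_zero (hf : IntegrableOn f (Ioo 0 1))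
    (h : prim 0 f =ᵐ[volume.restrict (Ioo 0 1)] 0) : f =ᵐ[volume.restrict (Ioo 0 1)] 0 := by
  have h0 := left_mem_Icc.2 (zero_le_one' ℝ)
  have hprim : EqOn (prim 0 f) 0 (Ioo 0 1) :=
    Measure.eqOn_open_of_ae_eq h isOpen_Ioo ((continuousOn_prim h0 hf).mono Ioo_subset_Icc_self)
      continuousOn_const
  have hderiv := (intervalIntegrable_of_integrableOn_unit hf h0
    (right_mem_Icc.2 zero_le_one)).ae_hasDerivAt_integral
  rw [uIcc_of_le zero_le_one] at hderiv
  rw [EventuallyEq, ae_restrict_iff' measurableSet_Ioo]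
  filter_upwards [hderiv] with x hx hxI
  refine (hx (Ioo_subset_Icc_self hxI) 0 h0).unique
    ((hasDerivAt_const x 0).congr_of_eventuallyEq ?_)
  filter_upwards [isOpen_Ioo.mem_nhds hxI] with y hy using hprim hy

lemma ae_eq_zero_of_prim_iterate_ae_eq_zero (hf : IntegrableOn f (Ioo 0 1)) (n : ℕ)
    (h : (prim 0)^[n] f =ᵐ[volume.restrict (Ioo 0 1)] 0) : f =ᵐ[volume.restrict (Ioo 0 1)] 0 := by
  induction n with
  | zero => exact h
  | succ n ih =>
    rw [Function.iterate_succ_apply'] at h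
    exact ih (ae_eq_zero_of_prim_ae_eq_zero
      (integrableOn_prim_iterate (left_mem_Icc.2 zero_le_one) hf n) h)

lemma prim_iteratedDerivWithin_succ {n j : ℕ} (hf : ContDiffOn ℝ n f (Icc 0 1)) (hj : j < n)
    (h0 : iteratedDerivWithin j f (Icc 0 1) 0 = 0) :
    EqOn (prim 0 (iteratedDerivWithin (j + 1) f (Icc 0 1))) (iteratedDerivWithin j f (Icc 0 1))
      (Icc 0 1) := fun x hx ↦ by
  have hud := uniqueDiffOn_Icc (zero_lt_one' ℝ)
  have hcont := hf.continuousOn_iteratedDerivWithin (by exact_mod_cast hj.le) hud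
  have hcont' := hf.continuousOn_iteratedDerivWithin (m := j + 1) (by exact_mod_cast hj) hud
  have hdiff := hf.differentiableOn_iteratedDerivWithin (by exact_mod_cast hj) hud
  have hftc := intervalIntegral.integral_eq_sub_of_hasDerivAt_of_le hx.1
    (hcont.mono (Icc_subset_Icc_right hx.2))
    (f' := iteratedDerivWithin (j + 1) f (Icc 0 1)) (fun t ht ↦ by
      have ht' : Icc (0 : ℝ) 1 ∈ 𝓝 t := Icc_mem_nhds ht.1 (ht.2.trans_le hx.2)
      rw [iteratedDerivWithin_succ, derivWithin_of_mem_nhds ht']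
      exact (hdiff.differentiableAt ht').hasDerivAt)
    (intervalIntegrable_of_integrableOn_unit (integrableOn_unit_of_continuousOn hcont')
      (left_mem_Icc.2 zero_le_one) hx)
  rwa [h0, sub_zero] at hftc

lemma prim_iterate_iteratedDerivWithin {n i : ℕ} (hf : ContDiffOn ℝ n f (Icc 0 1))
    (h0 : ∀ j < n, iteratedDerivWithin j f (Icc 0 1) 0 = 0) (hi : i ≤ n) :
    EqOn ((prim 0)^[i] (iteratedDerivWithin n f (Icc 0 1)))
      (iteratedDerivWithin (n - i) f (Icc 0 1)) (Icc 0 1) := by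
  induction i with
  | zero => exact fun _ _ ↦ rfl
  | succ i ih =>
    rw [Function.iterate_succ_apply']
    refine (prim_congr (left_mem_Icc.2 zero_le_one) (ih (by lia))).trans ?_
    rw [show n - i = n - (i + 1) + 1 by lia]
    exact prim_iteratedDerivWithin_succ hf (by lia) (h0 _ (by lia))

end Prim

section Polynomial

open Polynomial

variable {f : ℝ → ℝ}

lemma iteratedDerivWithin_polynomial_eval {s : Set ℝ} (hs : UniqueDiffOn ℝ s) (P : ℝ[X]) (n : ℕ) :
    EqOn (iteratedDerivWithin n (fun x ↦ P.eval x) s) (fun x ↦ (derivative^[n] P).eval x) s := by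
  induction n generalizing P with
  | zero => exact fun _ _ ↦ by simp
  | succ n ih =>
    intro x hx
    rw [iteratedDerivWithin_succ', Function.iterate_succ_apply]
    exact (iteratedDerivWithin_congr (fun y hy ↦ P.derivWithin (hs y hy)) hx).trans (ih _ hx)

lemma iteratedDerivWithin_polynomial_eval_eq_zero {s : Set ℝ} (hs : UniqueDiffOn ℝ s) {P : ℝ[X]}
    {n : ℕ} (hP : P.degree < n) : EqOn (iteratedDerivWithin n (fun x ↦ P.eval x) s) 0 s :=
  (iteratedDerivWithin_polynomial_eval hs P n).trans fun x _ ↦ by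
    simp only [iterate_derivative_eq_zero_of_degree_lt hP, eval_zero, Pi.zero_apply]

lemma contDiff_polynomial_eval {n : WithTop ℕ∞} (P : ℝ[X]) : ContDiff ℝ n fun x ↦ P.eval x := by
  simpa only [coe_aeval_eq_eval] using P.contDiff_aeval (𝕜 := ℝ) n

lemma prim_one_iterate_one (n : ℕ) :
    (prim 1)^[n] (fun _ ↦ 1) = fun x ↦ (C (n.factorial : ℝ)⁻¹ * (X - C 1) ^ n).eval x := by
  induction n with
  | zero => simp
  | succ n ih =>
    ext x
    rw [Function.iterate_succ_apply', ih]
    simp only [prim, eval_mul, eval_C, eval_pow, eval_sub, eval_X,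
      intervalIntegral.integral_const_mul, intervalIntegral.integral_comp_sub_right (· ^ n),
      integral_pow, Nat.factorial_succ]
    push_cast
    field_simp
    simp

lemma integral_mul_polynomial (hf : IntegrableOn f (Ioo 0 1)) (P : ℝ[X]) :
    ∫ x in Ioo 0 1, f x * P.eval x =
      P.eval 1 * prim 0 f 1 - ∫ x in Ioo 0 1, prim 0 f x * (derivative P).eval x := by
  have hP' : Continuous fun x ↦ (derivative P).eval x := (derivative P).continuous
  have hP (x : ℝ) : P.eval x = P.eval 1 + prim 1 (fun x ↦ (derivative P).eval x) x := by
    rw [prim, intervalIntegral.integral_eq_sub_of_hasDerivAt (fun x _ ↦ P.hasDerivAt x)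
      (hP'.intervalIntegrable _ _)]
    ring
  have hcont := continuousOn_prim (right_mem_Icc.2 zero_le_one)
    (integrableOn_unit_of_continuousOn hP'.continuousOn)
  have hint : IntegrableOn (fun x ↦ f x * prim 1 (fun x ↦ (derivative P).eval x) x) (Ioo 0 1) :=
    (((integrableOn_Icc_iff_integrableOn_Ioo).2 hf).mul_continuousOn hcont
      isCompact_Icc).mono_set Ioo_subset_Icc_self
  rw [integral_prim_mul hf (integrableOn_unit_of_continuousOn hP'.continuousOn), sub_neg_eq_add,
    prim_one_eq_integral, ← integral_const_mul, ← integral_add (hf.const_mul _) hint]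
  exact integral_congr_ae (ae_of_all _ fun x ↦ by simp only [hP x]; ring)

lemma derivative_mem_degreeLT {n : ℕ} {P : ℝ[X]} (hP : P ∈ degreeLT ℝ (n + 1)) :
    derivative P ∈ degreeLT ℝ n := by
  rw [mem_degreeLT, degree_lt_iff_coeff_zero] at hP ⊢
  intro i hi
  rw [coeff_derivative, hP (i + 1) (by lia), zero_mul]

lemma integral_mul_polynomial_eq_zero_iff {n : ℕ} (hf : IntegrableOn f (Ioo 0 1)) :
    (∀ P ∈ degreeLT ℝ n, ∫ x in Ioo 0 1, f x * P.eval x = 0) ↔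
      ∀ i < n, (prim 0)^[i + 1] f 1 = 0 := by
  have h0 := left_mem_Icc.2 (zero_le_one' ℝ)
  constructor
  · intro h i hi
    have hP := h (C (i.factorial : ℝ)⁻¹ * (X - C 1) ^ i) <| mem_degreeLT.2 <| by
      rw [degree_C_mul (by positivity), degree_pow, degree_X_sub_C]
      simpa using hi
    have hswap := integral_prim_iterate_mul hf (integrableOn_unit_of_continuousOn
      (continuousOn_const (c := (1 : ℝ)))) i
    rw [prim_one_iterate_one, hP, mul_zero] at hswap
    rw [Function.iterate_succ_apply', prim_one_eq_integral]
    simpa using hswap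
  · intro h P hP
    induction n generalizing f P with
    | zero =>
      have hP0 : P = 0 := by simpa [mem_degreeLT] using hP
      simp [hP0]
    | succ n ih =>
      rw [integral_mul_polynomial hf, show prim 0 f 1 = 0 from h 0 (by lia), mul_zero, zero_sub,
        ih (f := prim 0 f) (integrableOn_prim_iterate h0 hf 1) (fun i hi ↦ h (i + 1) (by lia)) _
          (derivative_mem_degreeLT hP), neg_zero]

end Polynomial

section WeakEigenfunction

variable {s : Set ℝ} {D : ℕ → ℝ → ℝ}

lemma iteratedDerivWithin_add_of_hasDerivWithinAt (hs : UniqueDiffOn ℝ s)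
    (h : ∀ j, ∀ x ∈ s, HasDerivWithinAt (D (j + 1)) (D j x) s x) (n i j : ℕ) :
    EqOn (iteratedDerivWithin (n + j) (D (i + j)) s) (iteratedDerivWithin n (D i) s) s := by
  induction j with
  | zero => exact fun _ _ ↦ rfl
  | succ j ih =>
    intro x hx
    rw [← add_assoc, ← add_assoc, iteratedDerivWithin_succ',
      iteratedDerivWithin_congr (fun y hy ↦ (h (i + j) y hy).derivWithin (hs y hy)) hx]
    exact ih hx

lemma contDiffOn_add_of_hasDerivWithinAt (hs : UniqueDiffOn ℝ s)
    (h : ∀ j, ∀ x ∈ s, HasDerivWithinAt (D (j + 1)) (D j x) s x) {n : ℕ}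
    (h0 : ContDiffOn ℝ n (D 0) s) (j : ℕ) : ContDiffOn ℝ (n + j : ℕ) (D j) s := by
  induction j with
  | zero => exact h0
  | succ j ih =>
    rw [← add_assoc, Nat.cast_add_one, contDiffOn_succ_iff_derivWithin hs]
    exact ⟨fun x hx ↦ (h j x hx).differentiableWithinAt, by simp,
      ih.congr fun x hx ↦ (h j x hx).derivWithin (hs x hx)⟩

variable {c : ℝ} {f : ℝ → ℝ}

lemma contDiffOn_Icc_prim_iterate (hc : c ∈ Icc (0 : ℝ) 1) {n : ℕ}
    (hf : ContDiffOn ℝ n f (Icc 0 1)) (j : ℕ) :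
    ContDiffOn ℝ (n + j : ℕ) ((prim c)^[j] f) (Icc 0 1) :=
  contDiffOn_add_of_hasDerivWithinAt (D := fun j ↦ (prim c)^[j] f)
    (uniqueDiffOn_Icc zero_lt_one)
    (fun j _ hx ↦ hasDerivWithinAt_prim_iterate_succ hc hf.continuousOn j hx) hf j

lemma contDiffOn_Ioo_prim_iterate (hc : c ∈ Icc (0 : ℝ) 1) (hf : IntegrableOn f (Ioo 0 1)) {n : ℕ}
    (hf' : ContDiffOn ℝ n f (Ioo 0 1)) (j : ℕ) :
    ContDiffOn ℝ (n + j : ℕ) ((prim c)^[j] f) (Ioo 0 1) :=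
  contDiffOn_add_of_hasDerivWithinAt (D := fun j ↦ (prim c)^[j] f) isOpen_Ioo.uniqueDiffOn
    (fun j _ hx ↦ (hasDerivAt_prim_iterate_succ hc hf hf'.continuousOn j hx).hasDerivWithinAt)
    hf' j

lemma iteratedDerivWithin_Icc_prim_iterate (hc : c ∈ Icc (0 : ℝ) 1)
    (hf : ContinuousOn f (Icc 0 1)) (i j : ℕ) :
    EqOn (iteratedDerivWithin j ((prim c)^[i + j] f) (Icc 0 1)) ((prim c)^[i] f) (Icc 0 1) := by
  simpa using iteratedDerivWithin_add_of_hasDerivWithinAt (D := fun j ↦ (prim c)^[j] f)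
    (uniqueDiffOn_Icc zero_lt_one)
    (fun j _ hx ↦ hasDerivWithinAt_prim_iterate_succ hc hf j hx) 0 i j

lemma iteratedDerivWithin_Ioo_prim_iterate (hc : c ∈ Icc (0 : ℝ) 1)
    (hf : IntegrableOn f (Ioo 0 1)) (hf' : ContinuousOn f (Ioo 0 1)) (n j : ℕ) :
    EqOn (iteratedDerivWithin (n + j) ((prim c)^[j] f) (Ioo 0 1))
      (iteratedDerivWithin n f (Ioo 0 1)) (Ioo 0 1) := by
  simpa using iteratedDerivWithin_add_of_hasDerivWithinAt (D := fun j ↦ (prim c)^[j] f)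
    isOpen_Ioo.uniqueDiffOn
    (fun j _ hx ↦ (hasDerivAt_prim_iterate_succ hc hf hf' j hx).hasDerivWithinAt) n 0 j

lemma isEigenfunction_prim_iterate {k : ℕ} {m lam : ℝ} {w : ℝ → ℝ} (hk : 1 ≤ k)
    (hw : ContDiffOn ℝ (k - 1 : ℕ) w (Icc 0 1)) (hw' : ContDiffOn ℝ k w (Ioo 0 1))
    (heq : ∀ x ∈ Ioo (0 : ℝ) 1, iteratedDerivWithin k w (Ioo 0 1) x =
      (-1) ^ k * lam * x ^ (-m) * (prim 0)^[k] w x)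
    (h1 : ∀ i < k, (prim 0)^[i + 1] w 1 = 0) : IsEigenfunction k m lam ((prim 0)^[k] w) where
  contDiff_Icc := by
    rw [show 2 * k - 1 = k - 1 + k by lia]
    exact contDiffOn_Icc_prim_iterate (left_mem_Icc.2 zero_le_one) hw k
  contDiff_Ioo := by
    rw [two_mul]
    exact contDiffOn_Ioo_prim_iterate (left_mem_Icc.2 zero_le_one)
      (integrableOn_unit_of_continuousOn hw.continuousOn) hw' k
  eq x hx := by
    rw [← iteratedDerivWithin_of_isOpen isOpen_Ioo hx, two_mul, ← heq x hx]
    exact iteratedDerivWithin_Ioo_prim_iterate (left_mem_Icc.2 zero_le_one)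
      (integrableOn_unit_of_continuousOn hw.continuousOn) hw'.continuousOn k k hx
  boundary j hj := by
    have hderiv := iteratedDerivWithin_Icc_prim_iterate (left_mem_Icc.2 zero_le_one)
      hw.continuousOn (k - j - 1 + 1) j
    rw [show k - j - 1 + 1 + j = k by lia] at hderiv
    rw [hderiv (left_mem_Icc.2 zero_le_one), hderiv (right_mem_Icc.2 zero_le_one)]
    exact ⟨prim_iterate_succ_self _ _ _, h1 _ (by lia)⟩

open Polynomial in
lemma exists_isEigenfunction_of_ae_eq {k : ℕ} {m lam : ℝ} {h F : ℝ → ℝ} {P : ℝ[X]} (hk : 1 ≤ k)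
    (hh : IntegrableOn h (Ioo 0 1)) (hF : IntegrableOn F (Ioo 0 1))
    (hFh : ∀ x, F x = x ^ (-m) * (prim 0)^[k] h x) (hP : P ∈ degreeLT ℝ k)
    (hhF : h =ᵐ[volume.restrict (Ioo 0 1)]
      fun x ↦ lam * ((-1) ^ k * (prim 1)^[k] F x) + P.eval x)
    (h1 : ∀ i < k, (prim 0)^[i + 1] h 1 = 0) :
    ∃ X, IsEigenfunction k m lam X ∧ EqOn X ((prim 0)^[k] h) (Icc 0 1) := by
  obtain ⟨n, rfl⟩ := Nat.exists_eq_add_of_le' hk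
  have hzero := left_mem_Icc.2 (zero_le_one' ℝ)
  have hone := right_mem_Icc.2 (zero_le_one' ℝ)
  have hud := isOpen_Ioo.uniqueDiffOn (s := Ioo (0 : ℝ) 1) (𝕜 := ℝ)
  set w : ℝ → ℝ := fun x ↦ lam * ((-1) ^ (n + 1) * (prim 1)^[n + 1] F x) + P.eval x with hw
  have hhw (i : ℕ) : EqOn ((prim 0)^[i + 1] w) ((prim 0)^[i + 1] h) (Icc 0 1) :=
    prim_iterate_succ_congr_ae hzero hhF.symm i
  have hFcont : ContinuousOn F (Ioo 0 1) := by
    simp only [funext hFh]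
    exact (continuousOn_id.rpow_const fun _ hx ↦ Or.inl (ne_of_gt hx.1)).mul
      ((continuousOn_prim_iterate_succ hzero hh n).mono Ioo_subset_Icc_self)
  have hIcc : ContDiffOn ℝ n ((prim 1)^[n + 1] F) (Icc 0 1) := by
    simpa using contDiffOn_Icc_prim_iterate (n := 0) hone
      (contDiffOn_zero.2 (continuousOn_prim hone hF)) n
  have hIoo : ContDiffOn ℝ (n + 1 : ℕ) ((prim 1)^[n + 1] F) (Ioo 0 1) := by
    simpa using contDiffOn_Ioo_prim_iterate (n := 0) hone hF (contDiffOn_zero.2 hFcont) (n + 1)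
  have hderiv {x : ℝ} (hx : x ∈ Ioo (0 : ℝ) 1) :
      iteratedDerivWithin (n + 1) ((prim 1)^[n + 1] F) (Ioo 0 1) x = F x := by
    simpa using iteratedDerivWithin_Ioo_prim_iterate hone hF hFcont 0 (n + 1) hx
  have hmul {i : ℕ} {s : Set ℝ} (hs : ContDiffOn ℝ i ((prim 1)^[n + 1] F) s) :
      ContDiffOn ℝ i (fun x ↦ lam * ((-1) ^ (n + 1) * (prim 1)^[n + 1] F x)) s :=
    contDiffOn_const.mul (contDiffOn_const.mul hs)
  refine ⟨_, isEigenfunction_prim_iterate hk (w := w) ?_ ?_ (fun x hx ↦ ?_) (fun i hi ↦ ?_), hhw n⟩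
  · exact (hmul hIcc).add (contDiff_polynomial_eval P).contDiffOn
  · exact (hmul hIoo).add (contDiff_polynomial_eval P).contDiffOn
  · rw [hw, iteratedDerivWithin_fun_add hx hud (hmul hIoo x hx)
      (contDiff_polynomial_eval P).contDiffWithinAt, iteratedDerivWithin_const_mul_field,
      iteratedDerivWithin_const_mul_field, hderiv hx,
      iteratedDerivWithin_polynomial_eval_eq_zero hud (mem_degreeLT.1 hP) hx, Pi.zero_apply,
      add_zero, hFh, ← hw, hhw n (Ioo_subset_Icc_self hx)]
    ring
  · rw [hhw i hone, h1 i hi]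

end WeakEigenfunction

/-! ### Completeness of the eigenfunctions -/

open scoped BoundedContinuousFunction InnerProductSpace

section L2

/-- The Hilbert space `L²(0,1)`. -/
abbrev L2Unit : Type := Lp ℝ 2 (volume.restrict (Ioo (0 : ℝ) 1))

lemma integrableOn_coe (h : L2Unit) : IntegrableOn h (Ioo 0 1) :=
  (Lp.memLp h).integrable one_le_two

lemma inner_eq_integral (f g : L2Unit) : ⟪f, g⟫_ℝ = ∫ x in Ioo (0 : ℝ) 1, f x * g x := by
  rw [L2.inner_def]
  exact integral_congr_ae (ae_of_all _ fun x ↦ mul_comm _ _)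

lemma inner_toLp_eq_integral (f : L2Unit) {g : ℝ → ℝ}
    (hg : MemLp g 2 (volume.restrict (Ioo (0 : ℝ) 1))) :
    ⟪f, hg.toLp g⟫_ℝ = ∫ x in Ioo (0 : ℝ) 1, f x * g x := by
  rw [inner_eq_integral]
  refine integral_congr_ae ?_
  filter_upwards [hg.coeFn_toLp] with x hx
  rw [hx]

lemma memLp_of_continuousOn {f : ℝ → ℝ} (hf : ContinuousOn f (Icc 0 1)) :
    MemLp f 2 (volume.restrict (Ioo (0 : ℝ) 1)) := by
  obtain ⟨C, hC⟩ := isCompact_Icc.exists_bound_of_continuousOn hf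
  exact .of_bound ((hf.mono Ioo_subset_Icc_self).aestronglyMeasurable measurableSet_Ioo) C
    ((ae_restrict_mem measurableSet_Ioo).mono fun x hx ↦ hC x (Ioo_subset_Icc_self hx))

lemma abs_prim_sub_le (h : L2Unit) {x y : ℝ} (hx : x ∈ Icc (0 : ℝ) 1) (hy : y ∈ Icc (0 : ℝ) 1) :
    |prim 0 h x - prim 0 h y| ≤ ‖h‖ * √|x - y| := by
  wlog hxy : x ≤ y generalizing x y
  · rw [abs_sub_comm, abs_sub_comm x y]
    exact this hy hx (le_of_not_ge hxy)
  have h0 := left_mem_Icc.2 (zero_le_one' ℝ)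
  have hsub : Ioo x y ∩ Ioo 0 1 = Ioo x y :=
    inter_eq_self_of_subset_left (Ioo_subset_Ioo hx.1 hy.2)
  have hdiff : prim 0 h y - prim 0 h x = ∫ t in Ioo x y, h t := by
    rw [← integral_Ioc_eq_integral_Ioo, ← intervalIntegral.integral_of_le hxy]
    exact intervalIntegral.integral_interval_sub_left
      (intervalIntegrable_of_integrableOn_unit (integrableOn_coe h) h0 hy)
      (intervalIntegrable_of_integrableOn_unit (integrableOn_coe h) h0 hx)
  have hinner := L2.inner_indicatorConstLp_one (𝕜 := ℝ) (μ := volume.restrict (Ioo (0 : ℝ) 1))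
    (s := Ioo x y) measurableSet_Ioo (measure_ne_top _ _) h
  rw [Measure.restrict_restrict measurableSet_Ioo, hsub, ← hdiff] at hinner
  rw [abs_sub_comm, ← hinner, abs_sub_comm]
  refine (abs_real_inner_le_norm _ _).trans_eq ?_
  rw [norm_indicatorConstLp two_ne_zero ENNReal.ofNat_ne_top, mul_comm,
    measureReal_restrict_apply measurableSet_Ioo, hsub, Real.volume_real_Ioo_of_le hxy,
    abs_of_nonneg (sub_nonneg.2 hxy), Real.sqrt_eq_rpow]
  simp

lemma abs_prim_le (h : L2Unit) {x : ℝ} (hx : x ∈ Icc (0 : ℝ) 1) : |prim 0 h x| ≤ ‖h‖ := by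
  have hbound := abs_prim_sub_le h hx (left_mem_Icc.2 zero_le_one)
  rw [show prim 0 h 0 = 0 from intervalIntegral.integral_same, sub_zero, sub_zero,
    abs_of_nonneg hx.1] at hbound
  exact hbound.trans (mul_le_of_le_one_right (norm_nonneg _) (Real.sqrt_le_one.2 hx.2))

lemma prim_coe_add (f g : L2Unit) :
    EqOn (prim 0 (f + g : L2Unit)) (fun x ↦ prim 0 f x + prim 0 g x) (Icc 0 1) :=
  (prim_congr_ae (left_mem_Icc.2 zero_le_one) (Lp.coeFn_add f g)).trans
    (prim_add (left_mem_Icc.2 zero_le_one) (integrableOn_coe f) (integrableOn_coe g))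

lemma prim_coe_smul (r : ℝ) (f : L2Unit) :
    EqOn (prim 0 (r • f : L2Unit)) (fun x ↦ r * prim 0 f x) (Icc 0 1) :=
  (prim_congr_ae (left_mem_Icc.2 zero_le_one) (Lp.coeFn_smul r f)).trans
    fun x _ ↦ congrFun (prim_const_mul 0 r f) x

/-- Integration from `0` as a bounded operator from `L²(0,1)` to `C[0,1]`. -/
def primCLM : L2Unit →L[ℝ] (Icc (0 : ℝ) 1 →ᵇ ℝ) :=
  LinearMap.mkContinuous
    { toFun h := .mkOfCompact ⟨fun x : Icc (0 : ℝ) 1 ↦ prim 0 h x,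
        (continuousOn_prim (left_mem_Icc.2 zero_le_one) (integrableOn_coe h)).domRestrict⟩
      map_add' f g := by ext x; exact prim_coe_add f g x.2
      map_smul' r f := by ext x; exact prim_coe_smul r f x.2 } 1
    fun h ↦ by
      rw [one_mul, BoundedContinuousFunction.norm_le (norm_nonneg _)]
      exact fun x ↦ abs_prim_le h x.2

lemma primCLM_apply (h : L2Unit) (x : Icc (0 : ℝ) 1) : primCLM h x = prim 0 h x := rfl

lemma isCompactOperator_primCLM : IsCompactOperator primCLM := by
  refine (isCompactOperator_iff_isCompact_closure_image_closedBall
    (primCLM : L2Unit →ₗ[ℝ] (Icc (0 : ℝ) 1 →ᵇ ℝ)) one_pos).2 ?_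
  refine BoundedContinuousFunction.arzela_ascoli (Icc (-1) 1) isCompact_Icc _ ?_ ?_
  · rintro f x ⟨h, hh, rfl⟩
    exact abs_le.1 ((abs_prim_le h x.2).trans (by simpa using hh))
  · refine Metric.equicontinuous_of_continuity_modulus (fun r ↦ √r) ?_ _ ?_
    · simpa only [Real.sqrt_zero] using Real.continuous_sqrt.tendsto 0
    · rintro x y ⟨_, h, hh, rfl⟩
      exact (abs_prim_sub_le h x.2 y.2).trans
        (mul_le_of_le_one_left (Real.sqrt_nonneg _) (by simpa using hh))

end L2

section Weight

variable {m : ℝ} {n : ℕ}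

lemma memLp_rpow (hm : m < n + 1) :
    MemLp (fun x : ℝ ↦ x ^ ((n : ℝ) - m / 2)) 2 (volume.restrict (Ioo (0 : ℝ) 1)) := by
  have hmeas : Measurable fun x : ℝ ↦ x ^ ((n : ℝ) - m / 2) := measurable_id.pow_const _
  rw [memLp_two_iff_integrable_sq hmeas.aestronglyMeasurable]
  have hint := intervalIntegral.intervalIntegrable_rpow' (a := 0) (b := 1) (r := 2 * n - m)
    (by linarith [Nat.cast_nonneg (α := ℝ) n])
  rw [intervalIntegrable_iff_integrableOn_Ioo_of_le zero_le_one] at hint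
  refine hint.congr_fun (fun x hx ↦ ?_) measurableSet_Ioo
  simp only
  rw [← Real.rpow_mul_natCast hx.1.le]
  congr 1
  push_cast
  ring

lemma abs_rpow_mul_prim_iterate_le {F : ℝ → ℝ} {C p x : ℝ} (hC : ∀ x ∈ Icc (0 : ℝ) 1, |F x| ≤ C)
    (hx : x ∈ Ioo (0 : ℝ) 1) :
    |x ^ (-p) * (prim 0)^[n] F x| ≤ C * x ^ ((n : ℝ) - p) := by
  have hpow := Real.rpow_nonneg hx.1.le (-p)
  calc |x ^ (-p) * (prim 0)^[n] F x| = x ^ (-p) * |(prim 0)^[n] F x| := by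
        rw [abs_mul, abs_of_nonneg hpow]
    _ ≤ x ^ (-p) * (C * x ^ n) :=
        mul_le_mul_of_nonneg_left (abs_prim_iterate_le hC n (Ioo_subset_Icc_self hx)) hpow
    _ = C * x ^ ((n : ℝ) - p) := by
        rw [sub_eq_add_neg, Real.rpow_add hx.1, Real.rpow_natCast]
        ring

lemma aestronglyMeasurable_rpow_mul_prim_iterate {F : ℝ → ℝ} (hF : ContinuousOn F (Icc 0 1))
    (p : ℝ) : AEStronglyMeasurable (fun x ↦ x ^ (-p) * (prim 0)^[n] F x)
      (volume.restrict (Ioo (0 : ℝ) 1)) :=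
  ((continuousOn_id.rpow_const fun _ hx ↦ Or.inl (ne_of_gt hx.1)).mul
    ((continuousOn_prim_iterate (left_mem_Icc.2 zero_le_one) hF n).mono
      Ioo_subset_Icc_self)).aestronglyMeasurable measurableSet_Ioo

lemma memLp_rpow_mul_prim_iterate (hm : m < n + 1) {F : ℝ → ℝ} (hF : ContinuousOn F (Icc 0 1)) :
    MemLp (fun x ↦ x ^ (-(m / 2)) * (prim 0)^[n] F x) 2 (volume.restrict (Ioo (0 : ℝ) 1)) := by
  obtain ⟨C, hC⟩ := isCompact_Icc.exists_bound_of_continuousOn hF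
  refine (memLp_rpow hm).of_le_mul (c := C) (aestronglyMeasurable_rpow_mul_prim_iterate hF _) ?_
  filter_upwards [ae_restrict_mem measurableSet_Ioo] with x hx
  rw [Real.norm_of_nonneg (Real.rpow_nonneg hx.1.le _)]
  exact abs_rpow_mul_prim_iterate_le hC hx

lemma integrableOn_rpow_mul_prim_iterate_succ (hm : m < n + 1) (h : L2Unit) :
    IntegrableOn (fun x ↦ x ^ (-m) * (prim 0)^[n + 1] h x) (Ioo 0 1) := by
  have hcont := continuousOn_prim (left_mem_Icc.2 (zero_le_one' ℝ)) (integrableOn_coe h)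
  have hint := intervalIntegral.intervalIntegrable_rpow' (a := 0) (b := 1) (r := (n : ℝ) - m)
    (by linarith)
  rw [intervalIntegrable_iff_integrableOn_Ioo_of_le zero_le_one] at hint
  refine Integrable.mono' (hint.const_mul ‖h‖)
    (aestronglyMeasurable_rpow_mul_prim_iterate hcont m) ?_
  filter_upwards [ae_restrict_mem measurableSet_Ioo] with x hx
  exact abs_rpow_mul_prim_iterate_le (fun t ht ↦ abs_prim_le h ht) hx

/-- The operator `f ↦ x ^ (-m/2) (prim 0)^[n] f` from `C[0,1]` to `L²(0,1)`, as a linear map. The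
argument of `prim 0` is extended to the line by constants. -/
def weightLM (hm : m < n + 1) : (Icc (0 : ℝ) 1 →ᵇ ℝ) →ₗ[ℝ] L2Unit where
  toFun f := (memLp_rpow_mul_prim_iterate hm
    (f.continuous.Icc_extend' (h := zero_le_one)).continuousOn).toLp _
  map_add' f g := by
    rw [← MemLp.toLp_add, MemLp.toLp_eq_toLp_iff]
    filter_upwards [ae_restrict_mem measurableSet_Ioo] with x hx
    have hadd := prim_iterate_add (left_mem_Icc.2 zero_le_one)
      (integrableOn_unit_of_continuousOn (f.continuous.Icc_extend' (h := zero_le_one)).continuousOn)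
      (integrableOn_unit_of_continuousOn (g.continuous.Icc_extend' (h := zero_le_one)).continuousOn)
      n (Ioo_subset_Icc_self hx)
    exact (congrArg _ hadd).trans (mul_add _ _ _)
  map_smul' r f := by
    rw [RingHom.id_apply, ← MemLp.toLp_const_smul, MemLp.toLp_eq_toLp_iff]
    refine ae_of_all _ fun x ↦ ?_
    have hsmul := congrFun (prim_iterate_const_mul 0 r (IccExtend zero_le_one f) n) x
    exact (congrArg _ hsmul).trans (mul_left_comm _ _ _)

lemma weightLM_ae_eq (hm : m < n + 1) (f : Icc (0 : ℝ) 1 →ᵇ ℝ) :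
    weightLM hm f =ᵐ[volume.restrict (Ioo (0 : ℝ) 1)]
      fun x ↦ x ^ (-(m / 2)) * (prim 0)^[n] (IccExtend zero_le_one f) x :=
  (memLp_rpow_mul_prim_iterate hm
    (f.continuous.Icc_extend' (h := zero_le_one)).continuousOn).coeFn_toLp

lemma norm_weightLM_le (hm : m < n + 1) (f : Icc (0 : ℝ) 1 →ᵇ ℝ) :
    ‖weightLM hm f‖ ≤ ‖(memLp_rpow hm).toLp _‖ * ‖f‖ := by
  rw [mul_comm]
  refine Lp.norm_le_mul_norm_of_ae_le_mul ?_
  filter_upwards [ae_restrict_mem measurableSet_Ioo, (memLp_rpow hm).coeFn_toLp,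
    weightLM_ae_eq hm f] with x hx hpow hweight
  rw [hpow, hweight, Real.norm_of_nonneg (Real.rpow_nonneg hx.1.le _)]
  exact abs_rpow_mul_prim_iterate_le (fun t _ ↦ f.norm_coe_le_norm _) hx

/-- The operator `h ↦ x ^ (-m/2) (prim 0)^[n + 1] h` on `L²(0,1)`, factored through `C[0,1]`. -/
def weightedPrim (hm : m < n + 1) : L2Unit →L[ℝ] L2Unit :=
  (weightLM hm).mkContinuous _ (norm_weightLM_le hm) ∘L primCLM

lemma isCompactOperator_weightedPrim (hm : m < n + 1) : IsCompactOperator (weightedPrim hm) :=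
  isCompactOperator_primCLM.clm_comp ((weightLM hm).mkContinuous _ (norm_weightLM_le hm))

lemma weightedPrim_ae_eq (hm : m < n + 1) (h : L2Unit) :
    weightedPrim hm h =ᵐ[volume.restrict (Ioo (0 : ℝ) 1)]
      fun x ↦ x ^ (-(m / 2)) * (prim 0)^[n + 1] h x := by
  filter_upwards [ae_restrict_mem measurableSet_Ioo, weightLM_ae_eq hm (primCLM h)] with x hx hw
  refine hw.trans (congrArg _ ?_)
  refine prim_iterate_congr (left_mem_Icc.2 zero_le_one) (fun t ht ↦ ?_) n (Ioo_subset_Icc_self hx)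
  rw [IccExtend_of_mem _ _ ht, primCLM_apply]

lemma inner_weightedPrim (hm : m < n + 1) (f g : L2Unit) :
    ⟪weightedPrim hm f, weightedPrim hm g⟫_ℝ =
      ∫ x in Ioo (0 : ℝ) 1, x ^ (-m) * (prim 0)^[n + 1] f x * (prim 0)^[n + 1] g x := by
  rw [inner_eq_integral]
  refine integral_congr_ae ?_
  filter_upwards [ae_restrict_mem measurableSet_Ioo, weightedPrim_ae_eq hm f,
    weightedPrim_ae_eq hm g] with x hx hf hg
  rw [hf, hg, show -m = -(m / 2) + -(m / 2) by ring, Real.rpow_add hx.1]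
  ring

lemma eq_zero_of_prim_iterate_eq_zero {h : L2Unit} (n : ℕ)
    (h0 : ∀ x ∈ Ioo (0 : ℝ) 1, (prim 0)^[n] h x = 0) : h = 0 :=
  (Lp.eq_zero_iff_ae_eq_zero).2 <| ae_eq_zero_of_prim_iterate_ae_eq_zero (integrableOn_coe h) n <|
    (ae_restrict_mem measurableSet_Ioo).mono h0

end Weight

open scoped Polynomial

section Green

variable {m : ℝ} {n : ℕ}

lemma eq_zero_of_weightedPrim_eq_zero (hm : m < n + 1) {h : L2Unit} (h0 : weightedPrim hm h = 0) :
    h = 0 := by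
  refine (Lp.eq_zero_iff_ae_eq_zero).2 <|
    ae_eq_zero_of_prim_iterate_ae_eq_zero (integrableOn_coe h) (n + 1) ?_
  filter_upwards [ae_restrict_mem measurableSet_Ioo, Lp.eq_zero_iff_ae_eq_zero.1 h0,
    weightedPrim_ae_eq hm h] with x hx hzero hweight
  rw [hweight] at hzero
  exact (mul_eq_zero.1 hzero).resolve_left (Real.rpow_pos_of_pos hx.1 _).ne'

/-- Polynomials as elements of `L²(0,1)`. -/
def polyLp : ℝ[X] →ₗ[ℝ] L2Unit where
  toFun P := (memLp_of_continuousOn P.continuous.continuousOn).toLp fun x ↦ P.eval x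
  map_add' P Q := by
    simp only [Polynomial.eval_add]
    rfl
  map_smul' r P := by
    simp only [Polynomial.eval_smul]
    rfl

lemma polyLp_ae_eq (P : ℝ[X]) :
    polyLp P =ᵐ[volume.restrict (Ioo (0 : ℝ) 1)] fun x ↦ P.eval x :=
  (memLp_of_continuousOn P.continuous.continuousOn).coeFn_toLp

/-- The subspace of `L²(0,1)` of the polynomials of degree less than `n`. -/
def polySpan (n : ℕ) : Submodule ℝ L2Unit := (Polynomial.degreeLT ℝ n).map polyLp

instance (n : ℕ) : FiniteDimensional ℝ (polySpan n) :=
  have : FiniteDimensional ℝ (Polynomial.degreeLT ℝ n) :=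
    .of_surjective _ (Polynomial.degreeLTEquiv ℝ n).symm.surjective
  inferInstanceAs (FiniteDimensional ℝ ((Polynomial.degreeLT ℝ n).map polyLp))

lemma mem_orthogonal_polySpan {h : L2Unit} :
    h ∈ (polySpan n)ᗮ ↔ ∀ i < n, (prim 0)^[i + 1] h 1 = 0 := by
  rw [← integral_mul_polynomial_eq_zero_iff (integrableOn_coe h), Submodule.mem_orthogonal']
  simp only [polySpan, Submodule.mem_map, forall_exists_index, and_imp, forall_apply_eq_imp_iff₂]
  exact forall₂_congr fun P _ ↦ by
    rw [← inner_toLp_eq_integral h (memLp_of_continuousOn P.continuous.continuousOn)]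
    rfl

/-- The restriction of `weightedPrim` to the orthogonal complement of the polynomials of degree at
most `n`, that is, to the functions `h` whose iterated primitive `(prim 0)^[n + 1] h` vanishes to
order `n` at both endpoints. -/
def restrictedPrim (hm : m < n + 1) : (polySpan (n + 1))ᗮ →L[ℝ] L2Unit :=
  weightedPrim hm ∘L (polySpan (n + 1))ᗮ.subtypeL

/-- The inverse of the differential operator `(-1) ^ (n + 1) x ^ m ∂ ^ (2 (n + 1))`, conjugated by
the derivative of order `n + 1`. -/
def greenOp (hm : m < n + 1) : (polySpan (n + 1))ᗮ →L[ℝ] (polySpan (n + 1))ᗮ :=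
  ContinuousLinearMap.adjoint (restrictedPrim hm) ∘L restrictedPrim hm

lemma inner_greenOp (hm : m < n + 1) (f g : (polySpan (n + 1))ᗮ) :
    ⟪greenOp hm f, g⟫_ℝ = ⟪weightedPrim hm f, weightedPrim hm g⟫_ℝ :=
  ContinuousLinearMap.adjoint_inner_left (restrictedPrim hm) g (restrictedPrim hm f)

lemma isSymmetric_greenOp (hm : m < n + 1) : (greenOp hm).IsSymmetric := fun f g ↦ by
  change ⟪greenOp hm f, g⟫_ℝ = ⟪f, greenOp hm g⟫_ℝ
  rw [inner_greenOp, real_inner_comm, ← inner_greenOp hm g f, real_inner_comm]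

lemma isCompactOperator_greenOp (hm : m < n + 1) : IsCompactOperator (greenOp hm) :=
  ((isCompactOperator_weightedPrim hm).comp_clm (polySpan (n + 1))ᗮ.subtypeL).clm_comp
    (ContinuousLinearMap.adjoint (restrictedPrim hm))

lemma eq_zero_of_greenOp_eq_zero (hm : m < n + 1) {h : (polySpan (n + 1))ᗮ}
    (h0 : greenOp hm h = 0) : h = 0 := by
  have hinner := inner_greenOp hm h h
  rw [h0, inner_zero_left] at hinner
  exact Subtype.ext (eq_zero_of_weightedPrim_eq_zero hm (inner_self_eq_zero.1 hinner.symm))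

/-- The solution `Y` of `(-∂) ^ (n + 1) Y = x ^ (-m) (prim 0)^[n + 1] f` which vanishes to order `n`
at `1`. It represents `g ↦ ⟪weightedPrim hm f, weightedPrim hm g⟫`. -/
def potential (m : ℝ) (n : ℕ) (f : ℝ → ℝ) : ℝ → ℝ := fun x ↦
  (-1) ^ (n + 1) * (prim 1)^[n + 1] (fun x ↦ x ^ (-m) * (prim 0)^[n + 1] f x) x

lemma memLp_potential (hm : m < n + 1) (f : L2Unit) :
    MemLp (potential m n f) 2 (volume.restrict (Ioo (0 : ℝ) 1)) :=
  memLp_of_continuousOn <| continuousOn_const.mul <| continuousOn_prim_iterate_succ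
    (right_mem_Icc.2 zero_le_one) (integrableOn_rpow_mul_prim_iterate_succ hm f) n

lemma inner_weightedPrim_eq_inner_potential (hm : m < n + 1) (f g : L2Unit) :
    ⟪weightedPrim hm f, weightedPrim hm g⟫_ℝ = ⟪(memLp_potential hm f).toLp _, g⟫_ℝ := by
  rw [inner_weightedPrim, real_inner_comm, inner_toLp_eq_integral]
  simp only [potential, mul_left_comm _ ((-1 : ℝ) ^ (n + 1)), integral_const_mul]
  rw [← integral_prim_iterate_mul (integrableOn_coe g)
    (integrableOn_rpow_mul_prim_iterate_succ hm f)]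
  simp only [mul_comm]

lemma exists_greenOp_ae_eq (hm : m < n + 1) (h : (polySpan (n + 1))ᗮ) :
    ∃ P ∈ Polynomial.degreeLT ℝ (n + 1), (greenOp hm h : L2Unit)
      =ᵐ[volume.restrict (Ioo (0 : ℝ) 1)] fun x ↦ potential m n (h : L2Unit) x + P.eval x := by
  set V : L2Unit := (memLp_potential hm h).toLp _
  have hmem : (greenOp hm h : L2Unit) - V ∈ polySpan (n + 1) := by
    refine (Submodule.orthogonal_orthogonal (polySpan (n + 1))).le
      ((Submodule.mem_orthogonal' _ _).2 fun g hg ↦ ?_)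
    rw [inner_sub_left, ← inner_weightedPrim_eq_inner_potential hm h g]
    exact sub_eq_zero.2 (inner_greenOp hm h ⟨g, hg⟩)
  obtain ⟨P, hP, hPV⟩ := hmem
  have hsum : (greenOp hm h : L2Unit) = V + polyLp P := by rw [hPV]; abel
  refine ⟨P, hP, ?_⟩
  rw [hsum]
  filter_upwards [Lp.coeFn_add V (polyLp P), (memLp_potential hm h).coeFn_toLp, polyLp_ae_eq P]
    with x hadd hV hpoly
  rw [hadd, Pi.add_apply, hV, hpoly]

lemma exists_isEigenfunction (hm : m < n + 1) {μ : ℝ} (hμ : μ ≠ 0) {h : (polySpan (n + 1))ᗮ}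
    (hh : greenOp hm h = μ • h) :
    ∃ X, IsEigenfunction (n + 1) m μ⁻¹ X ∧
      EqOn X ((prim 0)^[n + 1] (h : L2Unit)) (Icc 0 1) := by
  obtain ⟨P, hP, hPh⟩ := exists_greenOp_ae_eq hm h
  refine exists_isEigenfunction_of_ae_eq (P := μ⁻¹ • P) n.succ_pos (integrableOn_coe _)
    (integrableOn_rpow_mul_prim_iterate_succ hm h) (fun _ ↦ rfl) (Submodule.smul_mem _ _ hP) ?_
    (mem_orthogonal_polySpan.1 h.2)
  have hh' : (h : L2Unit) = μ⁻¹ • (greenOp hm h : L2Unit) := by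
    rw [hh, Submodule.coe_smul, inv_smul_smul₀ hμ]
  have hsmul := Lp.coeFn_smul μ⁻¹ (greenOp hm h : L2Unit)
  rw [← hh'] at hsmul
  filter_upwards [hsmul, hPh] with x hx hP
  rw [hx, Pi.smul_apply, hP, Polynomial.eval_smul, smul_add]
  rfl

end Green

section Completeness

variable {k n : ℕ} {m : ℝ} {w : ℝ → ℝ}

lemma exists_mem_orthogonal_polySpan (hw : ContDiffOn ℝ (n : WithTop ℕ∞) w (Icc 0 1))
    (h0 : ∀ j < n, iteratedDerivWithin j w (Icc 0 1) 0 = 0 ∧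
      iteratedDerivWithin j w (Icc 0 1) 1 = 0) (hn : 1 ≤ n) :
    ∃ g ∈ (polySpan n)ᗮ, EqOn ((prim 0)^[n] g) w (Icc 0 1) := by
  have hgc : ContinuousOn (iteratedDerivWithin n w (Icc 0 1)) (Icc 0 1) :=
    hw.continuousOn_iteratedDerivWithin le_rfl (uniqueDiffOn_Icc one_pos)
  have hgL := memLp_of_continuousOn hgc
  have hprim (i : ℕ) (hi : i < n) : EqOn ((prim 0)^[i + 1] (hgL.toLp _))
      (iteratedDerivWithin (n - (i + 1)) w (Icc 0 1)) (Icc 0 1) :=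
    (prim_iterate_succ_congr_ae (left_mem_Icc.2 zero_le_one) hgL.coeFn_toLp i).trans
      (prim_iterate_iteratedDerivWithin hw (fun j hj ↦ (h0 j hj).1) hi)
  refine ⟨hgL.toLp _, mem_orthogonal_polySpan.2 fun i hi ↦ ?_, ?_⟩
  · rw [hprim i hi (right_mem_Icc.2 zero_le_one)]
    exact (h0 _ (by lia)).2
  · obtain ⟨i, rfl⟩ := Nat.exists_eq_add_of_le' hn
    simpa using hprim i i.lt_succ_self

lemma eq_zero_of_forall_eigenspace (hm : m < n + 1) {g : (polySpan (n + 1))ᗮ}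
    (hg : ∀ μ : ℝ, μ ≠ 0 → ∀ h, greenOp hm h = μ • h → ⟪h, g⟫_ℝ = 0) : g = 0 := by
  rw [← Submodule.mem_bot ℝ, ← ContinuousLinearMap.orthogonalComplement_iSup_eigenspaces_eq_bot
    (isCompactOperator_greenOp hm) (isSymmetric_greenOp hm), ← Submodule.iInf_orthogonal,
    Submodule.mem_iInf]
  intro μ
  refine (Submodule.mem_orthogonal _ _).2 fun h hh ↦ ?_
  have hμh : greenOp hm h = μ • h := Module.End.mem_eigenspace_iff.1 hh
  rcases eq_or_ne μ 0 with rfl | hμ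
  · rw [eq_zero_of_greenOp_eq_zero hm (hμh.trans (zero_smul ℝ h)), inner_zero_left]
  · exact hg μ hμ h hμh

lemma eq_zero_of_forall_eigenfunction (hk : 1 ≤ k) (hmk : m < k)
    (hw : ContDiffOn ℝ (k : WithTop ℕ∞) w (Icc 0 1))
    (h0 : ∀ j < k, iteratedDerivWithin j w (Icc 0 1) 0 = 0 ∧
      iteratedDerivWithin j w (Icc 0 1) 1 = 0)
    (hort : ∀ lam X, IsEigenfunction k m lam X → (∃ x ∈ Ioo (0 : ℝ) 1, X x ≠ 0) →
      ∫ x in Ioo (0 : ℝ) 1, x ^ (-m) * X x * w x = 0) :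
    EqOn w 0 (Icc 0 1) := by
  obtain ⟨n, rfl⟩ := Nat.exists_eq_add_of_le' hk
  have hm : m < n + 1 := by exact_mod_cast hmk
  obtain ⟨g, hg, hgw⟩ := exists_mem_orthogonal_polySpan hw h0 hk
  suffices (⟨g, hg⟩ : (polySpan (n + 1))ᗮ) = 0 by
    have hg0 : g =ᵐ[volume.restrict (Ioo (0 : ℝ) 1)] 0 :=
      Lp.eq_zero_iff_ae_eq_zero.1 (congrArg Subtype.val this)
    intro x hx
    have hbound := abs_prim_iterate_le (f := 0) (C := 0) (fun _ _ ↦ abs_zero.le) (n + 1) hx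
    rw [← prim_iterate_succ_congr_ae (left_mem_Icc.2 zero_le_one) hg0 n hx, hgw hx,
      zero_mul] at hbound
    exact abs_nonpos_iff.1 hbound
  refine eq_zero_of_forall_eigenspace hm fun μ hμ h hh ↦ ?_
  obtain ⟨X, hX, hXh⟩ := exists_isEigenfunction hm hμ hh
  by_cases hX0 : ∃ x ∈ Ioo (0 : ℝ) 1, X x ≠ 0
  · have hinner := inner_greenOp hm h ⟨g, hg⟩
    rw [hh, real_inner_smul_left, inner_weightedPrim] at hinner
    refine (mul_eq_zero.1 (hinner.trans ?_)).resolve_left hμ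
    refine (setIntegral_congr_fun measurableSet_Ioo fun x hx ↦ ?_).trans (hort _ X hX hX0)
    simp only [hXh (Ioo_subset_Icc_self hx), hgw (Ioo_subset_Icc_self hx)]
  · push Not at hX0
    have hh0 : (h : L2Unit) = 0 := eq_zero_of_prim_iterate_eq_zero (n + 1) fun x hx ↦
      (hXh (Ioo_subset_Icc_self hx)).symm.trans (hX0 x hx)
    rw [Submodule.coe_eq_zero.1 hh0, inner_zero_left]

end Completeness

/-! ### Uniqueness -/

section Uniqueness

variable {k : ℕ} {m α β a b : ℝ} {φ : ℝ → ℝ}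

lemma atMostOneSolution_of_Delta_ne_zero (hk : 1 ≤ k) (hmk : m < k) (hα0 : 0 < α) (hα1 : α < 1)
    (hβ1 : 1 < β) (hβ2 : β < 2) (ha : 0 < a) (hb : 0 < b)
    (hΔ : ∀ lam : ℝ, IsEigenvalue k m lam → Delta α β a b lam ≠ 0) (φ : ℝ → ℝ) :
    AtMostOneSolution k m α β a b φ := by
  intro u v hu hv x hx y hy
  have hdiff := hu.add_const_mul hv hk hα1 hβ2 ha hb (-1)
  simp only [neg_one_mul, add_neg_cancel] at hdiff
  have hzero := eq_zero_of_forall_eigenfunction hk hmk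
    ((hdiff.contDiff_x y hy).of_le (by exact_mod_cast (by lia : k ≤ 2 * k - 1)))
    (fun j hj ↦ hdiff.boundary j hj y hy)
    (fun lam X hX hX0 ↦ hdiff.coeff_eq_zero hX hk hmk.le hα0 hα1 hβ1.le hβ2 ha hb
      (hΔ lam (isEigenvalue_iff.2 ⟨X, hX, hX0⟩)) hy) hx
  exact sub_eq_zero.1 ((sub_eq_add_neg _ _).trans hzero)

lemma IsSolution.Delta_ne_zero {u : ℝ → ℝ → ℝ} (hu : IsSolution k m α β a b φ u)
    (huniq : AtMostOneSolution k m α β a b φ) (hk : 1 ≤ k) (hm : m / 2 ≤ k) (hα0 : 0 < α)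
    (hα1 : α < 1) (hβ1 : 1 < β) (hβ2 : β < 2) (ha : 0 < a) (hb : 0 < b) {lam : ℝ}
    (hlam : IsEigenvalue k m lam) : Delta α β a b lam ≠ 0 := by
  intro hΔ
  obtain ⟨X, hX, x, hx, hX0⟩ := isEigenvalue_iff.1 hlam
  have hsum := hu.add_const_mul
    (hX.isSolution_profile hk hm hα0 hα1 hβ1 hβ2 ha hb hΔ) hk hα1 hβ2 ha hb 1
  simp only [mul_zero, add_zero, one_mul] at hsum
  have heq := huniq _ _ hu hsum x (Ioo_subset_Icc_self hx) 0 ⟨by linarith, hb.le⟩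
  rw [profile_zero hα0, left_eq_add] at heq
  exact hX0 heq

end Uniqueness

end ProblemD

end

theorem mainTheorem2_general (k : ℕ) (m α β a b : ℝ) (hk : 1 ≤ k) (hmk : m < k)
    (hα0 : 0 < α) (hα1 : α < 1) (hβ1 : 1 < β) (hβ2 : β < 2) (ha : 0 < a) (hb : 0 < b) :
    ((∀ φ : ℝ → ℝ, ProblemD.AtMostOneSolution k m α β a b φ) ↔
      ∀ lam : ℝ, ProblemD.IsEigenvalue k m lam → ProblemD.Delta α β a b lam ≠ 0) ∧
    (∀ φ : ℝ → ℝ, (∃ u : ℝ → ℝ → ℝ, ProblemD.IsSolution k m α β a b φ u) →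
      (ProblemD.AtMostOneSolution k m α β a b φ ↔
        ∀ lam : ℝ, ProblemD.IsEigenvalue k m lam → ProblemD.Delta α β a b lam ≠ 0)) := by
  have hm : m / 2 ≤ k := by linarith [Nat.cast_nonneg (α := ℝ) k]
  have hunique := ProblemD.atMostOneSolution_of_Delta_ne_zero hk hmk hα0 hα1 hβ1 hβ2 ha hb
  refine ⟨⟨fun h lam hlam hΔ ↦ ?_, hunique⟩, fun φ ⟨u, hu⟩ ↦ ⟨fun h lam hlam ↦ ?_, (hunique · φ)⟩⟩
  · obtain ⟨X, hX, -⟩ := ProblemD.isEigenvalue_iff.1 hlam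
    have hsol := hX.isSolution_profile hk hm hα0 hα1 hβ1 hβ2 ha hb hΔ
    exact hsol.Delta_ne_zero (h _) hk hm hα0 hα1 hβ1 hβ2 ha hb hlam hΔ
  · exact hu.Delta_ne_zero h hk hm hα0 hα1 hβ1 hβ2 ha hb hlam

theorem mainTheorem2 (k : ℕ) (m α β a b : ℝ)
    (hm0 : 0 ≤ m) (hmk : m < k) (hmN : ∀ j : ℕ, 1 ≤ j → m ≠ j)
    (hα0 : 0 < α) (hα1 : α < 1) (hβ1 : 1 < β) (hβ2 : β < 2)
    (ha : 0 < a) (hb : 0 < b) :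
    ((∀ φ : ℝ → ℝ, ProblemD.AtMostOneSolution k m α β a b φ) ↔
      ∀ lam : ℝ, ProblemD.IsEigenvalue k m lam → ProblemD.Delta α β a b lam ≠ 0) ∧
    (∀ φ : ℝ → ℝ, (∃ u : ℝ → ℝ → ℝ, ProblemD.IsSolution k m α β a b φ u) →
      (ProblemD.AtMostOneSolution k m α β a b φ ↔
        ∀ lam : ℝ, ProblemD.IsEigenvalue k m lam → ProblemD.Delta α β a b lam ≠ 0)) :=
  mainTheorem2_general k m α β a b (Nat.cast_pos.1 (hm0.trans_lt hmk)) hmk hα0 hα1 hβ1 hβ2 ha hb
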